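/- **Setting.** Let $m\ge 1$ and let $\gamma=((i_1,\varepsilon_1),\dots,(i_k,\varepsilon_k))$ be a finite sequence with $1\le i_j\le m-1$ and $\varepsilon_j=\pm1$. Let $\beta=\beta(\gamma)=\sigma_{i_1}^{\varepsilon_1}\cdots\sigma_{i_k}^{\varepsilon_k}$ be the corresponding $m$-strand braid and $w(\beta)=\sum_j\varepsilon_j$ its writhe. Put $\mathcal R=\mathbb Z[q^{\pm1}]$. On $\mathcal P_k=\mathcal R[x_j^{\pm1},y_j^{\pm1},u_j^{\pm1}:1\le j\le k]$ let $\hat x_j,\hat y_j,\hat u_j$ be the multiplications by the variables, and let $\tau_{x_j}$ be the substitution $x_j\mapsto qx_j$ (similarly $\tau_{y_j},\tau_{u_j}$). If $\varepsilon_j=+1$ put (omitting the index $j$) $$a=(\hat u-\hat y\tau_x^{-1})\tau_y^{-1},\quad b=\hat u^2,\quad c=\hat x\tau_y^{-2}\tau_u^{-1},\qquad S_j=\begin{pmatrix}a&b\\c&0\end{pmatrix},$$ and if $\varepsilon_j=-1$ put $$a=(\tau_y-\hat x^{-1})\tau_x^{-1}\tau_u,\quad b=\hat u^2,\quad c=\hat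 y^{-1}\tau_x^{-1}\tau_u,\qquad S_j=\begin{pmatrix}0&c\\b&a\end{pmatrix}.$$ Let $A_j=I_{i_j-1}\oplus S_j\oplus I_{m-i_j-1}$ and $\rho(\gamma)=A_1A_2\cdots A_k$, and let $\rho'(\gamma)$ be $\rho(\gamma)$ with its first row and first column removed. For an $r\times r$ matrix $A$ of operators let $\det_q A=\sum_\pi(-q)^{\mathrm{inv}(\pi)}a_{\pi1,1}\cdots a_{\pi r,r}$ and $$\widetilde{\det}_q(I-A)=1-C,\qquad C=\sum_{\emptyset\ne J\subset\{1,\dots,r\}}(-1)^{|J|-1}\det{}_q(A_J),$$ where $A_J$ is the $J\times J$ submatrix, and interpret $1/(1-C)$ as $\sum_{n\ge0}C^n$. For an operator $P$ on $\mathcal P_k$, let $\mathcal E(P)\in\mathcal R[z^{\pm1}]$ be obtained by applying $P$ to the constant $1$ and then setting all $u_j=1$ and $x_j=y_j=z$, and let $\mathcal E_N(P)\in\mathcal R$ be obtained from $\mathcal E(P)$ by setting $z=q^{N-1}$. **Colored Jones polynomial.** Let $v^2=q$ and $[n]=(v^n-v^{-n})/(v-v^{-1})$. Let $W_N$ be the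 $N$-dimensional simple $U_v(sl_2)$-module over $\mathbb C(v^{1/2})$ with basis $e_0,\dots,e_{N-1}$, $Ke_i=v^{N-1-2i}e_i$, $Ee_i=\frac{1-q^{-i}}{1-q^{-1}}e_{i-1}$, $Fe_i=v^i[N-1-i]e_{i+1}$. Let $\Theta=\sum_{n\ge0}(-1)^nv^{-n(n-1)/2}\frac{(v-v^{-1})^n}{[n]!}F^n\otimes E^n$, let $D$ multiply a tensor product of vectors of weights $k,l$ by $v^{-kl/2}$, and let $\sigma_i$ act on $W_N^{\otimes m}$ by the braiding $a\otimes b\mapsto\Theta(D(b\otimes a))$ in the factors $i,i+1$; this defines $\tau(\beta)$. If the closure of $\beta$ is the knot $K$, then $$J_K(N)=v^{w(\beta)(N^2-1)/2}\,\mathrm{tr}\big(\tau(\beta)K^{-1},W_N^{\otimes m}\big),\qquad J'_K(N)=J_K(N)/[N]$$ (here $K^{-1}$ in the trace is the element of $U_v(sl_2)$). **Theorem 1.** Suppose that the closure of the $m$-strand braid $\beta(\gamma)$ is a knot $K$. Then $w(\beta)-m+1$ is even, and: (a) For every positive integer $N$, writing $\widetilde{\det}_q(I-q\rho'(\gamma))=1-C$,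 only finitely many of the elements $\mathcal E_N(C^n)$, $n\ge0$, are non-zero, and $$q^{(N-1)(w(\beta)-m+1)/2}\;\mathcal E_N\!\left(\frac1{\widetilde{\det}_q(I-q\rho'(\gamma))}\right)=q^{(N-1)(w(\beta)-m+1)/2}\sum_{n\ge0}\mathcal E_N(C^n)=J'_K(N).$$ (b) $\det\mathcal E(I-\rho'(\gamma))$ (where $\mathcal E$ is applied entrywise) lies in $\mathbb Z[z^{\pm1}]$ and is the Alexander polynomial of $K$, which is defined up to multiplication by a unit $\pm z^i$: it generates the first elementary ideal of the Alexander matrix, obtained by Fox calculus from the Wirtinger presentation of the knot group given by the closed braid diagram. -/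

import Mathlib

open scoped LaurentPolynomial Kronecker

noncomputable section

namespace ColoredJones

/-! ### Braid words -/

/-- A word of length `k` in the generators `σ_0, …, σ_{n-1}` of the braid group on `n + 1` strands
(the strands are numbered by `Fin (n + 1)`).  The letter `(i, true)` is `σ_i`, which involves the
strands `i.castSucc` and `i.succ`, and `(i, false)` is `σ_i⁻¹`. -/
abbrev BraidWord (n k : ℕ) : Type := Fin k → Fin n × Bool

variable {n k : ℕ}

/-- The sign `±1` of a letter. -/
def letterSign (l : Fin n × Bool) : ℤ := if l.2 then 1 else -1

/-- The writhe of a braid word: the sum of the signs of its letters. -/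
def writhe (γ : BraidWord n k) : ℤ := ∑ j, letterSign (γ j)

/-- The permutation of the strands induced by a braid word. -/
def braidPerm (γ : BraidWord n k) : Equiv.Perm (Fin (n + 1)) :=
  (List.ofFn fun j => Equiv.swap (γ j).1.castSucc (γ j).1.succ).prod

/-- The closure of the braid is a knot, i.e. it has a single component: the components of the
closure are the orbits of the permutation on all strands. -/
def ClosureIsKnot (γ : BraidWord n k) : Prop := (braidPerm γ).IsCycleOn Set.univ

/-! ### Operators on Laurent polynomials -/

/-- The ring `ℤ[q, q⁻¹]`; the variable `q` is `LaurentPolynomial.T 1`. -/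
abbrev Rq : Type := ℤ[T;T⁻¹]

/-- The unit `q` of `ℤ[q, q⁻¹]`. -/
def qUnit : Rqˣ where
  val := LaurentPolynomial.T 1
  inv := LaurentPolynomial.T (-1)
  val_inv := by rw [← LaurentPolynomial.T_add]; simp
  inv_val := by rw [← LaurentPolynomial.T_add]; simp

/-- The names of the three variables `x_j`, `y_j`, `u_j` attached to the letter `j`. -/
inductive Var : Type
  | x
  | y
  | u
  deriving DecidableEq

/-- The ring `ℤ[q^±1][x_j^±1, y_j^±1, u_j^±1 : j < k]`; a monomial is given by its exponents. -/
abbrev LaurentPoly (k : ℕ) : Type := AddMonoidAlgebra Rq (Fin k × Var → ℤ)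

/-- The ring of `ℤ[q^±1]`-linear operators on Laurent polynomials (with composition as product). -/
abbrev Op (k : ℕ) : Type := Module.End Rq (LaurentPoly k)

/-- Multiplication by the `e`-th power of the variable `i`. -/
def mulVar (i : Fin k × Var) (e : ℤ) : Op k :=
  LinearMap.mulLeft Rq (AddMonoidAlgebra.single (Pi.single i e) 1)

/-- The `e`-th power of the operator `τ_i`, i.e. the substitution `i ↦ q ^ e * i` for the
variable `i`; the other variables are left alone. -/
def shiftVar (i : Fin k × Var) (e : ℤ) : Op k :=
  (AddMonoidAlgebra.lift Rq (LaurentPoly k) (Fin k × Var → ℤ)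
    { toFun := fun a => AddMonoidAlgebra.single a.toAdd (LaurentPolynomial.T (e * a.toAdd i))
      map_one' := by
        rw [toAdd_one, Pi.zero_apply, mul_zero, LaurentPolynomial.T_zero]
        rfl
      map_mul' := fun a b => by
        rw [AddMonoidAlgebra.single_mul_single, ← LaurentPolynomial.T_add, toAdd_mul, Pi.add_apply,
          mul_add] }).toLinearMap

/-- `a_+ = (û - ŷ τ_x⁻¹) τ_y⁻¹`, in the variables number `j`. -/
def aPlus (j : Fin k) : Op k :=
  (mulVar (j, .u) 1 - mulVar (j, .y) 1 * shiftVar (j, .x) (-1)) * shiftVar (j, .y) (-1)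

/-- `b_+ = û²`. -/
def bPlus (j : Fin k) : Op k := mulVar (j, .u) 2

/-- `c_+ = x̂ τ_y⁻² τ_u⁻¹`. -/
def cPlus (j : Fin k) : Op k :=
  mulVar (j, .x) 1 * shiftVar (j, .y) (-2) * shiftVar (j, .u) (-1)

/-- `a_- = (τ_y - x̂⁻¹) τ_x⁻¹ τ_u`. -/
def aMinus (j : Fin k) : Op k :=
  (shiftVar (j, .y) 1 - mulVar (j, .x) (-1)) * shiftVar (j, .x) (-1) * shiftVar (j, .u) 1

/-- `b_- = û²`. -/
def bMinus (j : Fin k) : Op k := mulVar (j, .u) 2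

/-- `c_- = ŷ⁻¹ τ_x⁻¹ τ_u`. -/
def cMinus (j : Fin k) : Op k :=
  mulVar (j, .y) (-1) * shiftVar (j, .x) (-1) * shiftVar (j, .u) 1

/-! ### The deformed Burau matrix -/

/-- The `2 × 2` block `S_+` or `S_-` for the letter number `j`. -/
def sBlock (positive : Bool) (j : Fin k) : Matrix (Fin 2) (Fin 2) (Op k) :=
  if positive then !![aPlus j, bPlus j; cPlus j, 0] else !![0, cMinus j; bMinus j, aMinus j]

/-- The block sum of identity matrices and `S`, with `S` in the rows and columns
`i.castSucc`, `i.succ`. -/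
def blockSum {A : Type*} [Ring A] (i : Fin n) (S : Matrix (Fin 2) (Fin 2) A) :
    Matrix (Fin (n + 1)) (Fin (n + 1)) A :=
  Matrix.of fun r c =>
    if r = i.castSucc then
      if c = i.castSucc then S 0 0 else if c = i.succ then S 0 1 else 0
    else if r = i.succ then
      if c = i.castSucc then S 1 0 else if c = i.succ then S 1 1 else 0
    else if r = c then 1 else 0

/-- The deformed Burau matrix `ρ(γ) = A_1 A_2 ⋯ A_k`. -/
def rho (γ : BraidWord n k) : Matrix (Fin (n + 1)) (Fin (n + 1)) (Op k) :=
  (List.ofFn fun j => blockSum (γ j).1 (sBlock (γ j).2 j)).prod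

/-- The matrix `ρ'(γ)`: the first row and the first column of `ρ(γ)` are removed. -/
def rho' (γ : BraidWord n k) : Matrix (Fin n) (Fin n) (Op k) :=
  (rho γ).submatrix Fin.succ Fin.succ

/-! ### Quantum determinants -/

/-- The number of inversions of a permutation. -/
def inversions {r : ℕ} (π : Equiv.Perm (Fin r)) : ℕ :=
  (Finset.univ.filter fun p : Fin r × Fin r => p.1 < p.2 ∧ π p.2 < π p.1).card

/-- `det_q A = ∑_π (-q)^inv(π) a_{π1,1} a_{π2,2} ⋯ a_{πr,r}`. -/
def qDet {r : ℕ} (A : Matrix (Fin r) (Fin r) (Op k)) : Op k :=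
  ∑ π : Equiv.Perm (Fin r),
    (-LaurentPolynomial.T 1 : Rq) ^ inversions π • (List.ofFn fun j => A (π j) j).prod

/-- The `J` by `J` submatrix of `A`. -/
def principalSubmatrix {r : ℕ} (A : Matrix (Fin r) (Fin r) (Op k)) (J : Finset (Fin r)) :
    Matrix (Fin J.card) (Fin J.card) (Op k) :=
  A.submatrix (J.orderEmbOfFin rfl) (J.orderEmbOfFin rfl)

/-- The element `C = ∑_{J ≠ ∅} (-1)^(|J| - 1) det_q A_J`. -/
def minorSum {r : ℕ} (A : Matrix (Fin r) (Fin r) (Op k)) : Op k :=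
  ∑ J ∈ Finset.univ.filter fun J : Finset (Fin r) => J.Nonempty,
    (-1 : ℤ) ^ (J.card - 1) • qDet (principalSubmatrix A J)

/-- The modified quantum determinant of `I - A`, namely `1 - C`. -/
def qDetOneSub {r : ℕ} (A : Matrix (Fin r) (Fin r) (Op k)) : Op k := 1 - minorSum A

/-! ### The evaluations -/

/-- The substitution `u_j ↦ 1`, `x_j ↦ z`, `y_j ↦ z`, with values in `ℤ[q^±1][z^±1]`. -/
def substZ (k : ℕ) : LaurentPoly k →ₐ[Rq] Rq[T;T⁻¹] :=
  AddMonoidAlgebra.lift Rq (Rq[T;T⁻¹]) (Fin k × Var → ℤ)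
    { toFun := fun a =>
        LaurentPolynomial.T (∑ j : Fin k, (a.toAdd (j, Var.x) + a.toAdd (j, Var.y)))
      map_one' := by simp
      map_mul' := fun a b => by
        rw [← LaurentPolynomial.T_add, ← Finset.sum_add_distrib]
        congr 1
        refine Finset.sum_congr rfl fun j _ => ?_
        simp only [toAdd_mul, Pi.add_apply]
        ring }

/-- `𝓔(P)`: apply `P` to the constant `1`, then substitute `u_j = 1` and `x_j = y_j = z`. -/
def evalZ (P : Op k) : Rq[T;T⁻¹] := substZ k (P 1)

/-- `𝓔_N(P)`: substitute `z = q^(N-1)` in `𝓔(P)`. -/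
def evalN (N : ℕ) (P : Op k) : Rq :=
  LaurentPolynomial.eval₂ (RingHom.id Rq) (qUnit ^ ((N : ℤ) - 1)) (evalZ P)

/-! ### The colored Jones polynomial, from the `R`-matrix of `U_v(sl₂)` -/

/-- The field `ℂ(v^(1/2))`. -/
abbrev Kv : Type := RatFunc ℂ

/-- The generator `v^(1/2)`. -/
def vHalf : Kv := RatFunc.X

/-- `v`, the square of `v^(1/2)`. -/
def v : Kv := vHalf ^ 2

/-- The inclusion of `ℤ[q^±1]` in `ℂ(v^(1/2))`, with `q = v²`. -/
def inclRq : Rq →+* Kv :=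
  LaurentPolynomial.eval₂ (Int.castRingHom Kv)
    (Units.mk0 (v ^ 2) (pow_ne_zero _ (pow_ne_zero _ RatFunc.X_ne_zero)))

/-- The quantum integer `[a] = (v^a - v^(-a)) / (v - v⁻¹)`. -/
def qInt (a : ℤ) : Kv := (v ^ a - v ^ (-a)) / (v - v⁻¹)

/-- The quantum factorial `[a]!`. -/
def qFactorial (a : ℕ) : Kv := ∏ i ∈ Finset.range a, qInt ((i : ℤ) + 1)

/-- The weight of the basis vector `e_i` of the `N`-dimensional simple module `W_N`. -/
def weight {N : ℕ} (i : Fin N) : ℤ := (N : ℤ) - 1 - 2 * (i : ℕ)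

/-- The action of `E` on `W_N`: `E e_i = (1 - q^(-i)) / (1 - q⁻¹) e_{i-1}`. -/
def matE (N : ℕ) : Matrix (Fin N) (Fin N) Kv :=
  Matrix.of fun r c =>
    if (r : ℕ) + 1 = c then (1 - (v ^ 2) ^ (-((c : ℕ) : ℤ))) / (1 - (v ^ 2)⁻¹) else 0

/-- The action of `F` on `W_N`: `F e_i = v^i [N - 1 - i] e_{i+1}`. -/
def matF (N : ℕ) : Matrix (Fin N) (Fin N) Kv :=
  Matrix.of fun r c =>
    if (r : ℕ) = (c : ℕ) + 1 then v ^ (c : ℕ) * qInt ((N : ℤ) - 1 - (c : ℕ)) else 0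

/-- The quasi-`R`-matrix `Θ = ∑_a (-1)^a v^(-a(a-1)/2) (v - v⁻¹)^a / [a]! F^a ⊗ E^a` on
`W_N ⊗ W_N`, where the terms with `a ≥ N` vanish. -/
def theta (N : ℕ) : Matrix (Fin N × Fin N) (Fin N × Fin N) Kv :=
  ∑ a ∈ Finset.range N,
    ((-1) ^ a * v ^ (-((a.choose 2 : ℕ) : ℤ)) * (v - v⁻¹) ^ a / qFactorial a) •
      ((matF N ^ a) ⊗ₖ (matE N ^ a))

/-- The operator `u ⊗ w ↦ D (w ⊗ u)`, where `D` multiplies a tensor product of vectors of weights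
`k` and `l` by `v^(-kl/2)`. -/
def diagFlip (N : ℕ) : Matrix (Fin N × Fin N) (Fin N × Fin N) Kv :=
  Matrix.of fun r c =>
    if r = c.swap then vHalf ^ (-(weight r.1 * weight r.2)) else 0

/-- The braiding `u ⊗ w ↦ Θ (D (w ⊗ u))` of `W_N ⊗ W_N`. -/
def braiding (N : ℕ) : Matrix (Fin N × Fin N) (Fin N × Fin N) Kv := theta N * diagFlip N

/-- An operator on `W_N ⊗ W_N`, acting on the tensor factors `i.castSucc`, `i.succ` of
`W_N^⊗(n+1)`, whose standard basis is indexed by `Fin (n + 1) → Fin N`. -/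
def onStrands {N : ℕ} (i : Fin n) (B : Matrix (Fin N × Fin N) (Fin N × Fin N) Kv) :
    Matrix (Fin (n + 1) → Fin N) (Fin (n + 1) → Fin N) Kv :=
  Matrix.of fun s t =>
    if ∀ p, p ≠ i.castSucc → p ≠ i.succ → s p = t p then
      B (s i.castSucc, s i.succ) (t i.castSucc, t i.succ)
    else 0

/-- The operator `τ(β)` on `W_N^⊗(n+1)`: the product, over the letters of the word, of the braiding
or its inverse. -/
def braidOp (N : ℕ) (γ : BraidWord n k) :
    Matrix (Fin (n + 1) → Fin N) (Fin (n + 1) → Fin N) Kv :=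
  (List.ofFn fun j =>
    onStrands (γ j).1 (if (γ j).2 then braiding N else (braiding N)⁻¹)).prod

/-- The action of `K⁻¹` on `W_N^⊗(n+1)`. -/
def kInv (N n : ℕ) : Matrix (Fin (n + 1) → Fin N) (Fin (n + 1) → Fin N) Kv :=
  Matrix.diagonal fun s => ∏ p, v ^ (-weight (s p))

/-- The unframed colored Jones polynomial `J_K(N) = v^(w (N² - 1) / 2) tr (τ(β) K⁻¹)` of the
closure of a braid. -/
def coloredJones (γ : BraidWord n k) (N : ℕ) : Kv :=
  vHalf ^ (writhe γ * ((N : ℤ) ^ 2 - 1)) * (braidOp N γ * kInv N n).trace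

/-- The normalized colored Jones polynomial `J'_K(N) = J_K(N) / [N]`. -/
def normalizedColoredJones (γ : BraidWord n k) (N : ℕ) : Kv := coloredJones γ N / qInt N

/-! ### The Alexander polynomial, from the Wirtinger presentation by Fox calculus -/

/-- The free derivative, with respect to the generator `a`, of a word in a free group, mapped to
`ℤ[t^±1]` by sending every generator to `t`.  The letter `(b, true)` is the generator `b`, and
`(b, false)` is its inverse. -/
def foxDeriv {α : Type*} [DecidableEq α] (a : α) : List (α × Bool) → ℤ[T;T⁻¹]
  | [] => 0
  | (b, true) :: w => (if b = a then 1 else 0) + LaurentPolynomial.T 1 * foxDeriv a w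
  | (b, false) :: w =>
      LaurentPolynomial.T (-1) * (foxDeriv a w - if b = a then 1 else 0)

/-- The ideal generated by the minors of size `(number of columns) - d`. -/
def elementaryIdeal {ρ α A : Type*} [Fintype α] [CommRing A] (M : Matrix ρ α A) (d : ℕ) :
    Ideal A :=
  Ideal.span {x | ∃ (f : Fin (Fintype.card α - d) → ρ) (g : Fin (Fintype.card α - d) → α),
    (M.submatrix f g).det = x}

/-- The crossings cut the strands of the closed braid into segments: `(j, p)` is the segment in
position `p` before the letter number `j`, and for `j = k` after the last letter. -/
abbrev Segment (n k : ℕ) : Type := Fin (k + 1) × Fin (n + 1)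

/-- The Wirtinger relators at the letter number `j`, one for each outgoing segment `p`.  At a
positive crossing the strand coming from position `i` passes over the one coming from position
`i + 1`, and at a negative crossing it passes under.  An overcrossing strand keeps its generator,
an undercrossing strand is conjugated by the generator of the strand above it. -/
def crossingRelator (γ : BraidWord n k) (j : Fin k) (p : Fin (n + 1)) :
    List (Segment n k × Bool) :=
  let left : Segment n k := (j.castSucc, (γ j).1.castSucc)
  let right : Segment n k := (j.castSucc, (γ j).1.succ)
  let out : Segment n k := (j.succ, p)
  if p = (γ j).1.castSucc then
    if (γ j).2 then [(left, true), (right, true), (left, false), (out, false)]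
    else [(right, true), (out, false)]
  else if p = (γ j).1.succ then
    if (γ j).2 then [(left, true), (out, false)]
    else [(right, false), (left, true), (right, true), (out, false)]
  else [((j.castSucc, p), true), (out, false)]

/-- The relators of the Wirtinger presentation of the group of the closed braid: those of the
crossings, and those that identify the last segment in each position with the first one. -/
def wirtingerRelator (γ : BraidWord n k) :
    (Fin k × Fin (n + 1)) ⊕ Fin (n + 1) → List (Segment n k × Bool)
  | .inl (j, p) => crossingRelator γ j p
  | .inr p => [((Fin.last k, p), true), ((0, p), false)]

/-- The Alexander matrix of the closed braid: the free derivatives of the Wirtinger relators. -/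
def alexanderMatrix (γ : BraidWord n k) :
    Matrix ((Fin k × Fin (n + 1)) ⊕ Fin (n + 1)) (Segment n k) ℤ[T;T⁻¹] :=
  Matrix.of fun r a => foxDeriv a (wirtingerRelator γ r)

/-- `Δ` is the Alexander polynomial (which is defined up to multiplication by a unit `± t^i`) of
the closed braid: it generates the first elementary ideal of the Alexander matrix. -/
def IsAlexanderPolynomial (γ : BraidWord n k) (Δ : ℤ[T;T⁻¹]) : Prop :=
  elementaryIdeal (alexanderMatrix γ) 1 = Ideal.span {Δ}

/-- The inclusion of `ℤ[z^±1]` in `ℤ[q^±1][z^±1]`. -/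
def inclZ : ℤ[T;T⁻¹] →+* Rq[T;T⁻¹] :=
  LaurentPolynomial.eval₂ (Int.castRingHom _)
    { val := LaurentPolynomial.T 1
      inv := LaurentPolynomial.T (-1)
      val_inv := by rw [← LaurentPolynomial.T_add]; simp
      inv_val := by rw [← LaurentPolynomial.T_add]; simp }

end ColoredJones

end

open ColoredJones

open scoped LaurentPolynomial Kronecker

noncomputable section

namespace ColoredJones

/-! ### Quantum linear algebra: right-quantum matrices, the Koszul complex and the MacMahon master
theorem. -/

section

/-! ### Ordered products of `q`-commuting elements -/

section QuantumSpace

variable {R : Type*} [CommRing R] {r : ℕ}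

/-! Write κ = q⁻¹. Part (a) rests on the quantum MacMahon master theorem. The blocks S_± are
right-quantum: the substitution X_i ↦ ∑_j a_ij X_j respects the relations X_j X_i = κ X_i X_j (i <
j). Entries attached to different letters involve different variables and therefore commute, so the
property passes to block sums and products, hence to ρ(γ), to ρ'(γ) and to its multiples
(`RightQuantum.blockSum`, `RightQuantum.mul`, `rightQuantum_rho'`). A right-quantum matrix acts on
the quantum symmetric algebra and, on the other side, on the quantum exterior algebra. The two
actions together commute with the Koszul differential, which is contractible in positive degree, so
the alternating trace vanishes: ∑_J (-1)^|J| det_q(a_J) tr S^(d-|J|)(a) = 0 for d > 0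
(`RightQuantum.master`). Formally this says 1/(1 - C) = ∑_d tr S^d(a).

The formal identity is made finite by the evaluation. All elements involved are combinations of
balanced words, those whose row indices are a permutation of their column indices. The operators of
one letter q-commute up to powers of q, and an ordered monomial in them evaluates to a power of q
times a product of factors 1 - q^e. One factor vanishes as soon as the multiplicity of a strand
would pass from less than N to at least N at a crossing (`content_lt_of_letter`). In ρ' strand 0 has
multiplicity 0, and the closure is a knot, so following the strand around the closure bounds every
multiplicity by N - 1. Words longer than n(N - 1) thus evaluate to 0 (`evalLin_balancedSpan`), and
the series becomes a finite sum over states in {0, …, N-1}^n, weighted by q^(∑ m_p)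
(`finsum_evalN_pow`).

The evaluated action of one letter on monomials in two variables is explicit (`posWeight`,
`negWeight`). Restricted to exponents below N it is the braiding up to a scalar and a diagonal
change of basis (`braiding_eq`); the q-binomial theorem shows that the negative letter gives the
inverse matrix (`sum_posWeight_mul_negWeight`). The finite sum is therefore a weighted partial trace
with the first strand frozen in state 0. These matrices commute with a lowering operator, which
forces the partial trace to be the same for every state of the first strand (`partialTrace_eq`).
Hence the full trace is the partial trace times ∑_{i<N} q^i = v^(N-1) [N], and collecting powers of
v gives J'_K(N). The parity claim compares the sign of a full cycle with that of a product of k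
transpositions.

For (b), 𝓔 is multiplicative on distinct letters, so ρ(γ) evaluates to the Burau matrix B
(`evalZ_rhoList`). In the Alexander matrix the crossing relators express each level of segments
through the preceding one by the Burau matrix of the letter. Eliminating all levels but the initial
one leaves Bᵀ - 1, with one row and column removed (`associated_det_minor`). The row sums vanish and
the rows satisfy a linear relation with unit coefficients, so this one minor generates the first
elementary ideal (`elementaryIdeal_one_eq`). -/

/-- The sum of the entries of `m` with index less than `i`. -/
def lowerSum (i : Fin r) (m : Fin r → ℕ) : ℕ := ∑ p, if p < i then m p else 0

theorem lowerSum_zero_index (m : Fin (r + 1) → ℕ) : lowerSum 0 m = 0 := by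
  simp [lowerSum]

theorem lowerSum_succ_index (i : Fin r) (m : Fin (r + 1) → ℕ) :
    lowerSum i.succ m = m 0 + lowerSum i (fun p => m p.succ) := by
  simp [lowerSum, Fin.sum_univ_succ]

theorem lowerSum_eq_zero {i : Fin r} {m : Fin r → ℕ} (h : ∀ p < i, m p = 0) :
    lowerSum i m = 0 :=
  Finset.sum_eq_zero fun p _ => by
    split_ifs with hp
    · exact h p hp
    · rfl

theorem lowerSum_add (i : Fin r) (m m' : Fin r → ℕ) :
    lowerSum i (m + m') = lowerSum i m + lowerSum i m' := by
  rw [lowerSum, lowerSum, lowerSum, ← Finset.sum_add_distrib]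
  refine Finset.sum_congr rfl fun p _ => ?_
  split_ifs <;> simp

theorem lowerSum_single (i j : Fin r) :
    lowerSum i (Pi.single j 1) = if j < i then 1 else 0 := by
  rw [lowerSum, Finset.sum_eq_single j]
  · simp
  · intro p _ hp
    simp [hp]
  · simp

/-- The family `y` satisfies `y j * y i = κ • (y i * y j)` for `i < j`. -/
def QComm {E : Type*} [Ring E] [Algebra R E] (κ : R) (y : Fin r → E) : Prop :=
  ∀ i j, i < j → y j * y i = κ • (y i * y j)

/-- The ordered monomial `y 0 ^ m 0 * y 1 ^ m 1 * ⋯`. -/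
def ordPow {E : Type*} [Ring E] (y : Fin r → E) (m : Fin r → ℕ) : E :=
  (List.ofFn fun i => y i ^ m i).prod

theorem ordPow_zero {E : Type*} [Ring E] (y : Fin r → E) : ordPow y 0 = 1 := by
  simp [ordPow]

theorem ordPow_succ {E : Type*} [Ring E] (y : Fin (r + 1) → E) (m : Fin (r + 1) → ℕ) :
    ordPow y m = y 0 ^ m 0 * ordPow (fun i => y i.succ) (fun i => m i.succ) := by
  simp [ordPow, List.ofFn_succ]

theorem mul_pow_of_qComm {E : Type*} [Ring E] [Algebra R E] {κ : R} {x y : E}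
    (h : y * x = κ • (x * y)) (s : ℕ) : y * x ^ s = κ ^ s • (x ^ s * y) := by
  induction s with
  | zero => simp
  | succ s ih =>
    rw [pow_succ x, ← mul_assoc, ih, smul_mul_assoc, mul_assoc, h, mul_smul_comm, smul_smul,
      pow_succ κ, mul_assoc]

/-- The factor `y i` crosses `y p ^ m p` for each p < i at the cost of `κ ^ m p` and then joins the
power of `y i`; larger indices are never crossed. -/
theorem QComm.mul_ordPow {E : Type*} [Ring E] [Algebra R E] {κ : R} {y : Fin r → E}
    (h : QComm κ y) (i : Fin r) (m : Fin r → ℕ) :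
    y i * ordPow y m = κ ^ lowerSum i m • ordPow y (m + Pi.single i 1) := by
  induction r with
  | zero => exact i.elim0
  | succ r ih =>
    rw [ordPow_succ, ordPow_succ]
    refine Fin.cases ?_ (fun i => ?_) i
    · have hm : (fun p : Fin r => (m + Pi.single 0 1 : Fin (r + 1) → ℕ) p.succ) =
          fun p => m p.succ := by
        funext p
        simp
      rw [lowerSum_zero_index, pow_zero, one_smul, hm, ← mul_assoc, ← pow_succ']
      simp
    · have hm : (fun p : Fin r => (m + Pi.single i.succ 1 : Fin (r + 1) → ℕ) p.succ) =
          (fun p => m p.succ) + Pi.single i 1 := by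
        funext p
        by_cases hp : p = i
        · subst hp; simp
        · simp [hp]
      have h0 : (m + Pi.single i.succ 1 : Fin (r + 1) → ℕ) 0 = m 0 := by
        simp
      rw [lowerSum_succ_index, hm, h0, ← mul_assoc,
        mul_pow_of_qComm (h 0 i.succ (Fin.succ_pos i)), smul_mul_assoc, mul_assoc,
        ih (y := fun p => y p.succ) (fun a b hab => h _ _ (Fin.succ_lt_succ_iff.2 hab)),
        mul_smul_comm, smul_smul, pow_add]

/-- Every exponent is obtained from `0` by adding unit vectors at indices that are at most the
smallest index of the support. -/
theorem ordInduction {P : (Fin r → ℕ) → Prop} (h0 : P 0)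
    (hs : ∀ m i, (∀ p < i, m p = 0) → P m → P (m + Pi.single i 1)) (m : Fin r → ℕ) : P m := by
  induction hd : ∑ p, m p generalizing m with
  | zero =>
    have : m = 0 := by
      funext p
      simpa using (Finset.sum_eq_zero_iff.1 hd) p (Finset.mem_univ p)
    rwa [this]
  | succ d ih =>
    have hne : (Finset.univ.filter fun p => m p ≠ 0).Nonempty := by
      by_contra hcon
      rw [Finset.not_nonempty_iff_eq_empty, Finset.filter_eq_empty_iff] at hcon
      have : ∑ p, m p = 0 := Finset.sum_eq_zero fun p hp => by simpa using hcon hp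
      omega
    set i := Finset.min' _ hne with hi
    have himem := Finset.min'_mem _ hne
    rw [← hi, Finset.mem_filter] at himem
    have hlow : ∀ p < i, m p = 0 := by
      intro p hp
      by_contra hmp
      exact absurd (Finset.min'_le _ p (by simp [hmp])) (not_le.2 hp)
    have hm : m = (m - Pi.single i 1) + Pi.single i 1 := by
      funext p
      by_cases hp : p = i
      · subst hp
        have := himem.2
        simp
        omega
      · simp [hp]
    rw [hm]
    refine hs _ i (fun p hp => by simp [hlow p hp]) (ih _ ?_)
    have := congrArg (fun f => ∑ p, f p) hm
    simp only [Pi.add_apply, Finset.sum_add_distrib] at this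
    rw [hd] at this
    simp [Finset.sum_pi_single'] at this
    simpa using this.symm

/-- Every quadratic relation below is a double sum that cancels in this way: diagonal terms vanish,
and (c, c') cancels against (c', c). -/
theorem sum_sum_eq_zero_of_antisymm {E : Type*} [AddCommGroup E] (F : Fin r → Fin r → E)
    (h0 : ∀ c, F c c = 0) (h : ∀ c c', c < c' → F c c' + F c' c = 0) :
    ∑ c, ∑ c', F c c' = 0 := by
  rw [← Finset.sum_product' Finset.univ Finset.univ F]
  refine Finset.sum_involution (fun a _ => a.swap) ?_ ?_ ?_ ?_
  · rintro ⟨a, b⟩ _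
    rcases lt_trichotomy a b with hab | rfl | hab
    · exact h _ _ hab
    · simp [h0]
    · rw [add_comm]; exact h _ _ hab
  · rintro ⟨a, b⟩ _ hne heq
    simp only [Prod.swap_prod_mk, Prod.mk.injEq] at heq
    obtain ⟨rfl, -⟩ := heq
    exact hne (h0 _)
  · intros; simp
  · intros; simp

/-! ### Right-quantum matrices -/

/-- A right-quantum matrix, where `κ` is the inverse of `q`. -/
structure RightQuantum {A : Type*} [Ring A] [Algebra R A] (κ : R)
    (a : Matrix (Fin r) (Fin r) A) : Prop where
  col : ∀ i j c, i < j → a j c * a i c = κ • (a i c * a j c)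
  cross : ∀ i j c c', i < j → c < c' →
    a j c * a i c' + κ • (a j c' * a i c) = κ • (a i c * a j c' + κ • (a i c' * a j c))

variable {A : Type*} [Ring A] [Algebra R A] {κ : R}

theorem add_smul_mul_eq_zero {E : Type*} [Ring E] [Algebra R E] {κ : R} {P Q : E}
    (h : P + κ • Q = 0) (X : E) : P * X + κ • (Q * X) = 0 := by
  rw [← smul_mul_assoc, ← add_mul, h, zero_mul]

/-- With D(c, c') = a_jc a_ic' - κ a_ic a_jc', the two axioms read D(c, c) = 0 and D(c, c') + κ
D(c', c) = 0. This is the form in which they enter double sums. -/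
theorem RightQuantum.cross_sub {a : Matrix (Fin r) (Fin r) A} (ha : RightQuantum κ a)
    {i j c c' : Fin r} (hij : i < j) (hc : c < c') :
    (a j c * a i c' - κ • (a i c * a j c')) + κ • (a j c' * a i c - κ • (a i c' * a j c)) = 0 := by
  rw [smul_sub, sub_add_sub_comm, ha.cross i j c c' hij hc, smul_add, sub_self]

/-- The expression D(c, c') of the product is ∑_{k,l} D_a(k, l) b_kc b_lc'. The relations of `b`
turn the (l, k) term into κ D_a(l, k) times the factor of the (k, l) term, and those of `a` then
cancel the pair. -/
theorem RightQuantum.mul {a b : Matrix (Fin r) (Fin r) A} (ha : RightQuantum κ a)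
    (hb : RightQuantum κ b) (hab : ∀ i j k l, Commute (a i j) (b k l)) :
    RightQuantum κ (a * b) := by
  have key : ∀ (i j c c' : Fin r), (a * b) j c * (a * b) i c' - κ • ((a * b) i c * (a * b) j c') =
      ∑ k, ∑ l, (a j k * a i l - κ • (a i k * a j l)) * (b k c * b l c') := by
    intro i j c c'
    simp only [Matrix.mul_apply, Finset.sum_mul_sum, Finset.smul_sum, ← Finset.sum_sub_distrib]
    refine Finset.sum_congr rfl fun k _ => Finset.sum_congr rfl fun l _ => ?_
    rw [sub_mul, smul_mul_assoc]
    have h1 := (hab i l k c).eq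
    have h2 := (hab j l k c).eq
    rw [mul_assoc (a j k), ← mul_assoc (b k c), ← h1, mul_assoc (a i k), ← mul_assoc (b k c), ← h2]
    simp only [mul_assoc]
  constructor
  · intro i j c hij
    rw [← sub_eq_zero, key]
    refine sum_sum_eq_zero_of_antisymm _ (fun k => ?_) fun k l hkl => ?_
    · rw [ha.col i j k hij, sub_self, zero_mul]
    · rw [hb.col k l c hkl, mul_smul_comm]
      exact add_smul_mul_eq_zero (ha.cross_sub hij hkl) _
  · intro i j c c' hij hcc
    have : (a * b) j c * (a * b) i c' + κ • ((a * b) j c' * (a * b) i c) -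
        κ • ((a * b) i c * (a * b) j c' + κ • ((a * b) i c' * (a * b) j c)) =
        ((a * b) j c * (a * b) i c' - κ • ((a * b) i c * (a * b) j c')) +
        κ • ((a * b) j c' * (a * b) i c - κ • ((a * b) i c' * (a * b) j c)) := by
      simp only [smul_add, smul_sub]
      abel
    rw [← sub_eq_zero, this, key, key]
    simp only [Finset.smul_sum, ← Finset.sum_add_distrib]
    have hmul : ∀ x y z : A, x * y + κ • (x * z) = x * (y + κ • z) := fun x y z => by
      rw [mul_add, mul_smul_comm]
    simp only [hmul]
    refine sum_sum_eq_zero_of_antisymm _ (fun k => ?_) fun k l hkl => ?_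
    · rw [ha.col i j k hij, sub_self, zero_mul]
    · rw [hb.cross k l c c' hkl hcc, mul_smul_comm]
      exact add_smul_mul_eq_zero (ha.cross_sub hij hkl) _

theorem RightQuantum.one : RightQuantum κ (1 : Matrix (Fin r) (Fin r) A) := by
  constructor
  · intro i j c hij
    rcases eq_or_ne i c with rfl | h
    · simp [Matrix.one_apply_ne hij.ne']
    · simp [Matrix.one_apply_ne h]
  · intro i j c c' hij hcc
    rcases eq_or_ne j c with rfl | h
    · rw [Matrix.one_apply_ne (hij.trans hcc).ne, Matrix.one_apply_ne hij.ne,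
        Matrix.one_apply_ne hcc.ne]
      simp
    · rw [Matrix.one_apply_ne h]
      rcases eq_or_ne i c with rfl | h'
      · simp
      · rw [Matrix.one_apply_ne h']
        simp

theorem RightQuantum.submatrix {s : ℕ} {a : Matrix (Fin r) (Fin r) A} (ha : RightQuantum κ a)
    {e : Fin s → Fin r} (he : StrictMono e) : RightQuantum κ (a.submatrix e e) :=
  ⟨fun _ _ _ hij => ha.col _ _ _ (he hij), fun _ _ _ _ hij hc => ha.cross _ _ _ _ (he hij) (he hc)⟩

theorem RightQuantum.smul {a : Matrix (Fin r) (Fin r) A} (ha : RightQuantum κ a) (t : R) :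
    RightQuantum κ (t • a) := by
  constructor
  · intro i j c hij
    simp only [Matrix.smul_apply, smul_mul_smul_comm, ha.col i j c hij, smul_comm κ]
  · intro i j c c' hij hcc
    simp only [Matrix.smul_apply, smul_mul_smul_comm, smul_comm κ (t * t), ← smul_add,
      ha.cross i j c c' hij hcc]

/-- The reason for the axioms: in the difference of the two products of linear forms, D(k, l) is
exactly the coefficient of `y k * y l`. -/
theorem RightQuantum.qComm {a : Matrix (Fin r) (Fin r) A} (ha : RightQuantum κ a)
    {E : Type*} [Ring E] [Algebra R E] (L : A →ₐ[R] E) {y : Fin r → E} (hy : QComm κ y)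
    (hc : ∀ b i, Commute (L b) (y i)) : QComm κ (fun i => ∑ c, L (a i c) * y c) := by
  intro i j hij
  rw [← sub_eq_zero]
  simp only [Finset.sum_mul_sum, Finset.smul_sum, ← Finset.sum_sub_distrib]
  have key : ∀ k l, L (a j k) * y k * (L (a i l) * y l) - κ • (L (a i k) * y k * (L (a j l) * y l))
      = L (a j k * a i l - κ • (a i k * a j l)) * (y k * y l) := by
    intro k l
    rw [mul_assoc (L (a j k)), ← mul_assoc (y k), ← (hc (a i l) k).eq, mul_assoc (L (a i k)),
      ← mul_assoc (y k), ← (hc (a j l) k).eq]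
    simp only [map_sub, map_mul, map_smul, sub_mul, mul_assoc, smul_mul_assoc]
  simp only [key]
  refine sum_sum_eq_zero_of_antisymm _ (fun k => ?_) fun k l hkl => ?_
  · rw [ha.col i j k hij, sub_self, map_zero, zero_mul]
  · rw [hy k l hkl, mul_smul_comm]
    refine add_smul_mul_eq_zero ?_ _
    rw [← map_smul L κ, ← map_add, ha.cross_sub hij hkl, map_zero]

/-! ### The action on the quantum symmetric algebra -/

variable (κ A) in
/-- Left multiplication by the `j`-th variable of the quantum space, on coefficient functions. -/
def varOp (j : Fin r) : Module.End R ((Fin r → ℕ) → A) where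
  -- The power of κ is the one of `QComm.mul_ordPow`, read at the exponent before X_j is added; the
  -- subtraction is only used where it is exact.
  toFun φ m := if 0 < m j then κ ^ lowerSum j (m - Pi.single j 1) • φ (m - Pi.single j 1) else 0
  map_add' φ ψ := by
    funext m
    simp only [Pi.add_apply]
    split_ifs <;> simp
  map_smul' t φ := by
    funext m
    simp only [Pi.smul_apply, RingHom.id_apply]
    split_ifs
    · rw [smul_comm]
    · simp

theorem varOp_apply (j : Fin r) (φ : (Fin r → ℕ) → A) (m : Fin r → ℕ) :
    varOp A κ j φ m =
      if 0 < m j then κ ^ lowerSum j (m - Pi.single j 1) • φ (m - Pi.single j 1) else 0 := rfl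

theorem varOp_apply_add (j : Fin r) (φ : (Fin r → ℕ) → A) (m : Fin r → ℕ) :
    varOp A κ j φ (m + Pi.single j 1) = κ ^ lowerSum j m • φ m := by
  rw [varOp_apply, if_pos (by simp), add_tsub_cancel_right]

theorem eq_add_single {m : Fin r → ℕ} {j : Fin r} (h : 0 < m j) :
    m = (m - Pi.single j 1) + Pi.single j 1 := by
  funext p
  by_cases hp : p = j
  · subst hp; simp; omega
  · simp [hp]

theorem varOp_single (j : Fin r) (m : Fin r → ℕ) (b : A) :
    varOp A κ j (Pi.single m b) = Pi.single (m + Pi.single j 1) (κ ^ lowerSum j m • b) := by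
  funext m'
  by_cases h : 0 < m' j
  · obtain ⟨m₀, rfl⟩ : ∃ m₀ : Fin r → ℕ, m' = (m₀ + Pi.single j 1 : Fin r → ℕ) :=
      ⟨_, eq_add_single h⟩
    rw [varOp_apply_add, Pi.single_apply, Pi.single_apply]
    simp only [add_left_inj]
    split_ifs with h1
    · rw [h1]
    · simp
  · rw [varOp_apply, if_neg h, Pi.single_eq_of_ne]
    rintro rfl
    simp at h

/-- Applying X_i before X_j raises the `lowerSum` seen by j by one, since i < j; in the other order
nothing changes for i. The ratio is κ. -/
theorem varOp_qComm : QComm κ (varOp (r := r) A κ) := by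
  intro i j hij
  apply LinearMap.ext
  intro φ
  funext m
  rw [LinearMap.smul_apply, Module.End.mul_apply, Module.End.mul_apply, Pi.smul_apply]
  by_cases hi : 0 < m i
  · by_cases hj : 0 < m j
    · obtain ⟨m₁, rfl⟩ : ∃ m₁ : Fin r → ℕ, m = (m₁ + Pi.single j 1 : Fin r → ℕ) :=
        ⟨_, eq_add_single hj⟩
      have hi' : 0 < m₁ i := by simpa [hij.ne] using hi
      obtain ⟨m₀, rfl⟩ : ∃ m₀ : Fin r → ℕ, m₁ = (m₀ + Pi.single i 1 : Fin r → ℕ) :=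
        ⟨_, eq_add_single hi'⟩
      rw [varOp_apply_add, varOp_apply_add, add_right_comm, varOp_apply_add, varOp_apply_add,
        lowerSum_add, lowerSum_add, lowerSum_single, lowerSum_single, if_pos hij,
        if_neg hij.le.not_gt]
      simp only [smul_smul]
      congr 1
      ring
    · rw [varOp_apply, if_neg hj, varOp_apply, if_pos hi, varOp_apply, if_neg]
      · simp
      · simpa [hij.ne'] using hj
  · rw [varOp_apply (j := i), if_neg hi, smul_zero, varOp_apply]
    split_ifs with hj
    · rw [varOp_apply, if_neg, smul_zero]
      simpa [hij.ne] using hi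
    · rfl

theorem lsmul_commute_varOp (b : A) (j : Fin r) :
    Commute (Algebra.lsmul R R ((Fin r → ℕ) → A) b) (varOp A κ j) := by
  apply LinearMap.ext
  intro φ
  funext m
  simp only [Module.End.mul_apply, Algebra.lsmul_coe, Pi.smul_apply, varOp_apply, smul_eq_mul]
  split_ifs <;> simp

variable (κ) in
/-- The image of the `i`-th variable under the substitution `X_i ↦ ∑_j a_ij X_j`. -/
def rowOp (a : Matrix (Fin r) (Fin r) A) (i : Fin r) : Module.End R ((Fin r → ℕ) → A) :=
  ∑ j, Algebra.lsmul R R ((Fin r → ℕ) → A) (a i j) * varOp A κ j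

theorem rowOp_apply (a : Matrix (Fin r) (Fin r) A) (i : Fin r) (φ : (Fin r → ℕ) → A)
    (m : Fin r → ℕ) : rowOp κ a i φ m = ∑ j, a i j * varOp A κ j φ m := by
  simp [rowOp, LinearMap.sum_apply, Module.End.mul_apply, Finset.sum_apply]

theorem RightQuantum.rowOp_qComm {a : Matrix (Fin r) (Fin r) A} (ha : RightQuantum κ a) :
    QComm κ (rowOp κ a) :=
  ha.qComm (Algebra.lsmul R R ((Fin r → ℕ) → A)) varOp_qComm lsmul_commute_varOp

variable (κ) in
/-- `symCoeff κ a m m'` is the coefficient of the monomial `m'` in the image of the monomial `m`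
under the substitution `X_i ↦ ∑_j a_ij X_j`. -/
def symCoeff (a : Matrix (Fin r) (Fin r) A) (m : Fin r → ℕ) : (Fin r → ℕ) → A :=
  ordPow (rowOp κ a) m (Pi.single 0 1)

theorem symCoeff_zero (a : Matrix (Fin r) (Fin r) A) : symCoeff κ a 0 = Pi.single 0 1 := by
  simp [symCoeff, ordPow_zero]

theorem RightQuantum.rowOp_symCoeff {a : Matrix (Fin r) (Fin r) A} (ha : RightQuantum κ a)
    (i : Fin r) (m : Fin r → ℕ) :
    rowOp κ a i (symCoeff κ a m) = κ ^ lowerSum i m • symCoeff κ a (m + Pi.single i 1) := by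
  rw [symCoeff, ← Module.End.mul_apply, ha.rowOp_qComm.mul_ordPow, LinearMap.smul_apply, symCoeff]

/-- A generator that is at most every index in use goes to the front of the ordered monomial, so no
power of κ appears. Together with `ordInduction` this is the recursion behind most facts on
`symCoeff`. -/
theorem RightQuantum.symCoeff_add_single {a : Matrix (Fin r) (Fin r) A} (ha : RightQuantum κ a)
    (i : Fin r) (m : Fin r → ℕ) (h : ∀ p < i, m p = 0) :
    symCoeff κ a (m + Pi.single i 1) = rowOp κ a i (symCoeff κ a m) := by
  rw [ha.rowOp_symCoeff, lowerSum_eq_zero h, pow_zero, one_smul]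

/-- The substitution is homogeneous: each step trades one variable for a linear form. -/
theorem RightQuantum.symCoeff_eq_zero {a : Matrix (Fin r) (Fin r) A} (ha : RightQuantum κ a)
    (m m' : Fin r → ℕ) (h : ∑ p, m p ≠ ∑ p, m' p) : symCoeff κ a m m' = 0 := by
  induction m using ordInduction generalizing m' with
  | h0 =>
    rw [symCoeff_zero, Pi.single_eq_of_ne]
    rintro rfl
    exact h rfl
  | hs m i hi ih =>
    rw [ha.symCoeff_add_single i m hi, rowOp_apply]
    refine Finset.sum_eq_zero fun j _ => ?_
    rw [varOp_apply]
    split_ifs with hj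
    · rw [ih, smul_zero, mul_zero]
      intro heq
      apply h
      rw [eq_add_single hj]
      simp [Finset.sum_add_distrib, heq]
    · rw [mul_zero]

/-- Functoriality of the quantum symmetric algebra. The last hypothesis lets the entries of `b` move
past the coefficients already produced by `a`; homogeneity keeps the sum finite. -/
theorem RightQuantum.symCoeff_mul {a b : Matrix (Fin r) (Fin r) A} (ha : RightQuantum κ a)
    (hb : RightQuantum κ b) (hab : ∀ i j k l, Commute (a i j) (b k l)) (m m' : Fin r → ℕ)
    (hcomm : ∀ m m' k l, Commute (symCoeff κ a m m') (b k l)) :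
    symCoeff κ (a * b) m m' =
      ∑ m₁ ∈ Finset.piAntidiag Finset.univ (∑ p, m p), symCoeff κ a m m₁ * symCoeff κ b m₁ m' := by
  have hab' := ha.mul hb hab
  induction m using ordInduction generalizing m' with
  | h0 =>
    simp [symCoeff_zero]
  | hs m i hi ih =>
    rw [hab'.symCoeff_add_single i m hi, ha.symCoeff_add_single i m hi, rowOp_apply]
    simp only [rowOp_apply, Finset.sum_mul]
    rw [Finset.sum_comm]
    -- Reindexing m₁ = m₂ + e_j: monomials without X_j are killed by `varOp`, and the power of κ
    -- produced by X_j is absorbed by `rowOp_symCoeff` for `b`.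
    have hre : ∀ j, ∑ m₁ ∈ Finset.piAntidiag Finset.univ (∑ p, (m + Pi.single i 1 : Fin r → ℕ) p),
        a i j * varOp A κ j (symCoeff κ a m) m₁ * symCoeff κ b m₁ m' =
        ∑ m₂ ∈ Finset.piAntidiag Finset.univ (∑ p, m p),
          ∑ l, a i j * symCoeff κ a m m₂ * (b j l * varOp A κ l (symCoeff κ b m₂) m') := by
      intro j
      have : ∀ m₂ : Fin r → ℕ, (∑ l, a i j * symCoeff κ a m m₂ *
          (b j l * varOp A κ l (symCoeff κ b m₂) m')) =
          a i j * varOp A κ j (symCoeff κ a m) (m₂ + Pi.single j 1) *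
            symCoeff κ b (m₂ + Pi.single j 1) m' := by
        intro m₂
        rw [← Finset.mul_sum, ← rowOp_apply, hb.rowOp_symCoeff, varOp_apply_add, Pi.smul_apply]
        simp
      simp only [this]
      symm
      refine Finset.sum_of_injOn (fun m₂ => m₂ + Pi.single j 1) ?_ ?_ ?_ ?_
      · intro x _ y _ hxy
        simpa using hxy
      · intro x hx
        rw [Finset.mem_coe, Finset.mem_piAntidiag] at hx ⊢
        simp [Finset.sum_add_distrib, hx.1]
      · intro x hx hx'
        by_cases hj : 0 < x j
        · exfalso
          apply hx'
          refine ⟨x - Pi.single j 1, ?_, (eq_add_single hj).symm⟩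
          have := eq_add_single hj
          simp only [Finset.mem_piAntidiag, Finset.mem_univ] at hx
          have h2 := hx.1
          rw [this] at h2
          simp only [Pi.add_apply, Finset.sum_add_distrib, Finset.sum_pi_single'] at h2
          simp at h2
          simp [h2]
        · rw [varOp_apply, if_neg hj]
          simp
      · intro x _
        rfl
    rw [Finset.sum_congr rfl fun j _ => hre j]
    simp only [Matrix.mul_apply, Finset.sum_mul]
    rw [Finset.sum_comm]
    refine Finset.sum_congr rfl fun j _ => ?_
    rw [Finset.sum_comm]
    refine Finset.sum_congr rfl fun l _ => ?_
    rw [varOp_apply]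
    split_ifs with hl
    · rw [ih, Finset.smul_sum, Finset.mul_sum]
      refine Finset.sum_congr rfl fun m₂ _ => ?_
      rw [varOp_apply, if_pos hl]
      have := (hcomm m m₂ j l).eq
      simp only [mul_smul_comm]
      rw [mul_assoc (a i j) (symCoeff κ a m m₂), ← mul_assoc (symCoeff κ a m m₂) (b j l), this]
      simp only [mul_assoc]
    · rw [mul_zero]
      symm
      refine Finset.sum_eq_zero fun m₂ _ => ?_
      rw [varOp_apply, if_neg hl]
      simp

end QuantumSpace

end

section

/-! ### The action on the quantum exterior algebra -/

section QuantumExterior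

variable {R : Type*} [CommRing R] {r : ℕ} {A : Type*} [Ring A] [Algebra R A] {q κ : R}

/-- The number of elements of `J` that are greater than `i`. -/
def upperCard (i : Fin r) (J : Finset (Fin r)) : ℕ := (J.filter (i < ·)).card

theorem upperCard_insert {i j : Fin r} {J : Finset (Fin r)} (h : j ∉ J) :
    upperCard i (insert j J) = upperCard i J + if i < j then 1 else 0 := by
  unfold upperCard
  rw [Finset.filter_insert]
  split_ifs with hij
  · rw [Finset.card_insert_of_notMem (by simp [h])]
  · rfl

theorem upperCard_eq_zero {i : Fin r} {J : Finset (Fin r)} (h : ∀ j ∈ J, j < i) :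
    upperCard i J = 0 := by
  simp only [upperCard, Finset.card_eq_zero, Finset.filter_eq_empty_iff]
  exact fun j hj => (h j hj).le.not_gt

variable (q A) in
/-- Right multiplication by the `j`-th exterior variable, on coefficient functions. -/
def extOp (j : Fin r) : Module.End R (Finset (Fin r) → A) where
  toFun φ J := if j ∈ J then (-q) ^ upperCard j (J.erase j) • φ (J.erase j) else 0
  map_add' φ ψ := by
    funext J
    simp only [Pi.add_apply]
    split_ifs <;> simp
  map_smul' t φ := by
    funext J
    simp only [Pi.smul_apply, RingHom.id_apply]
    split_ifs
    · rw [smul_comm]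
    · simp

theorem extOp_apply (j : Fin r) (φ : Finset (Fin r) → A) (J : Finset (Fin r)) :
    extOp A q j φ J = if j ∈ J then (-q) ^ upperCard j (J.erase j) • φ (J.erase j) else 0 := rfl

theorem extOp_apply_insert {j : Fin r} (φ : Finset (Fin r) → A) {J : Finset (Fin r)} (h : j ∉ J) :
    extOp A q j φ (insert j J) = (-q) ^ upperCard j J • φ J := by
  rw [extOp_apply, if_pos (Finset.mem_insert_self _ _), Finset.erase_insert h]

theorem extOp_mul_self (j : Fin r) : extOp A q j * extOp A q j = 0 := by
  apply LinearMap.ext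
  intro φ
  funext J
  rw [Module.End.mul_apply, extOp_apply]
  split_ifs
  · rw [extOp_apply, if_neg (by simp), smul_zero]
    rfl
  · rfl

/-- The exterior variables satisfy ξ_j ξ_i = -q ξ_i ξ_j for i < j; since the operators multiply on
the right, composition reverses the order. -/
theorem extOp_mul_comm {i j : Fin r} (hij : i < j) :
    extOp A q i * extOp A q j = -q • (extOp A q j * extOp A q i) := by
  apply LinearMap.ext
  intro φ
  funext J
  rw [LinearMap.smul_apply, Pi.smul_apply, Module.End.mul_apply, Module.End.mul_apply]
  by_cases hi : i ∈ J
  · obtain ⟨J₁, hi₁, rfl⟩ : ∃ J₁, i ∉ J₁ ∧ J = insert i J₁ :=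
      ⟨J.erase i, by simp, (Finset.insert_erase hi).symm⟩
    by_cases hj : j ∈ J₁
    · obtain ⟨J₀, hj₀, rfl⟩ : ∃ J₀, j ∉ J₀ ∧ J₁ = insert j J₀ :=
        ⟨J₁.erase j, by simp, (Finset.insert_erase hj).symm⟩
      have hi₀ : i ∉ J₀ := fun h => hi₁ (Finset.mem_insert_of_mem h)
      have hj₁ : j ∉ insert i J₀ := by simp [hij.ne', hj₀]
      rw [extOp_apply_insert _ hi₁, extOp_apply_insert _ hj₀, Finset.insert_comm,
        extOp_apply_insert _ hj₁, extOp_apply_insert _ hi₀, upperCard_insert hj₀,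
        upperCard_insert hi₀, if_pos hij, if_neg hij.le.not_gt]
      simp only [smul_smul]
      congr 1
      ring
    · rw [extOp_apply_insert _ hi₁, extOp_apply, if_neg hj, extOp_apply, if_neg]
      · simp
      · simp [hij.ne', hj]
  · rw [extOp_apply, if_neg hi, extOp_apply]
    split_ifs
    · rw [extOp_apply, if_neg, smul_zero, smul_zero]
      simp [hi]
    · rw [smul_zero]

open MulOpposite in
/-- Right multiplication by `b` on coefficient functions. -/
def rightMul (b : A) : Module.End R (Finset (Fin r) → A) :=
  Algebra.lsmul R R (Finset (Fin r) → A) (op b)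

theorem rightMul_apply (b : A) (φ : Finset (Fin r) → A) (J : Finset (Fin r)) :
    rightMul (R := R) b φ J = φ J * b := rfl

theorem rightMul_mul (b c : A) :
    rightMul (R := R) (r := r) b * rightMul c = rightMul (c * b) := by
  apply LinearMap.ext
  intro φ
  funext J
  simp [Module.End.mul_apply, rightMul_apply, mul_assoc]

theorem rightMul_commute_extOp (b : A) (j : Fin r) : Commute (rightMul b) (extOp A q j) := by
  apply LinearMap.ext
  intro φ
  funext J
  simp only [Module.End.mul_apply, rightMul_apply, extOp_apply]
  split_ifs <;> simp

theorem rightMul_add (b c : A) :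
    rightMul (R := R) (r := r) (b + c) = rightMul b + rightMul c := by
  apply LinearMap.ext
  intro φ
  funext J
  simp [rightMul_apply, mul_add]

theorem rightMul_smul (t : R) (b : A) :
    rightMul (R := R) (r := r) (t • b) = t • rightMul b := by
  apply LinearMap.ext
  intro φ
  funext J
  simp [rightMul_apply]

theorem rightMul_zero : rightMul (R := R) (r := r) (0 : A) = 0 := by
  apply LinearMap.ext
  intro φ
  funext J
  simp [rightMul_apply]

variable (q) in
/-- Right multiplication by the `c`-th column combination of the exterior variables. -/
def colOp (a : Matrix (Fin r) (Fin r) A) (c : Fin r) : Module.End R (Finset (Fin r) → A) :=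
  ∑ i, rightMul (a i c) * extOp A q i

theorem colOp_apply (a : Matrix (Fin r) (Fin r) A) (c : Fin r) (φ : Finset (Fin r) → A)
    (J : Finset (Fin r)) : colOp q a c φ J = ∑ i, extOp A q i φ J * a i c := by
  simp [colOp, LinearMap.sum_apply, Module.End.mul_apply, Finset.sum_apply, rightMul_apply]

/-- Right multiplications compose in reverse, which is why `a j c'` stands to the left of `a i c`.
This is the order of factors in the right-quantum relations. -/
theorem colOp_mul_colOp (a : Matrix (Fin r) (Fin r) A) (c c' : Fin r) :
    colOp q a c * colOp q a c' =
      ∑ i, ∑ j, rightMul (a j c' * a i c) * (extOp A q i * extOp A q j) := by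
  simp only [colOp, Finset.sum_mul_sum]
  refine Finset.sum_congr rfl fun i _ => Finset.sum_congr rfl fun j _ => ?_
  rw [mul_assoc, ← mul_assoc (extOp A q i), ← (rightMul_commute_extOp (a j c') i).eq,
    ← rightMul_mul]
  simp only [mul_assoc]

/-- Exchanging i and j costs -q from the exterior variables and κ from the column relation, and -qκ
= -1. -/
theorem RightQuantum.colOp_mul_self {a : Matrix (Fin r) (Fin r) A} (ha : RightQuantum κ a)
    (hq : q * κ = 1) (c : Fin r) : colOp q a c * colOp q a c = 0 := by
  rw [colOp_mul_colOp]
  refine sum_sum_eq_zero_of_antisymm _ (fun i => ?_) fun i j hij => ?_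
  · rw [extOp_mul_self, mul_zero]
  · rw [extOp_mul_comm hij, mul_smul_comm, ← smul_mul_assoc, ← rightMul_smul, ← add_mul,
      ← rightMul_add, ha.col i j c hij, smul_smul, neg_mul, hq, neg_smul, one_smul,
      neg_add_cancel, rightMul_zero, zero_mul]

/-- The cancellation of the (i, j) and (j, i) terms is the cross relation multiplied by q². -/
theorem RightQuantum.colOp_mul_comm {a : Matrix (Fin r) (Fin r) A} (ha : RightQuantum κ a)
    (hq : q * κ = 1) {c c' : Fin r} (hc : c < c') :
    colOp q a c * colOp q a c' = -q • (colOp q a c' * colOp q a c) := by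
  rw [← sub_eq_zero, colOp_mul_colOp, colOp_mul_colOp]
  simp only [Finset.smul_sum, ← Finset.sum_sub_distrib]
  have hsub : ∀ (x y : A) (Z : Module.End R (Finset (Fin r) → A)),
      rightMul x * Z - -q • (rightMul y * Z) = rightMul (x + q • y) * Z := by
    intro x y Z
    rw [rightMul_add, rightMul_smul, add_mul, smul_mul_assoc, sub_eq_add_neg]
    congr 1
    exact (congrArg Neg.neg (neg_smul q (rightMul y * Z))).trans (neg_neg _)
  simp only [hsub]
  refine sum_sum_eq_zero_of_antisymm _ (fun i => ?_) fun i j hij => ?_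
  · rw [extOp_mul_self, mul_zero]
  · rw [extOp_mul_comm hij, mul_smul_comm, ← smul_mul_assoc, ← rightMul_smul, ← add_mul,
      ← rightMul_add]
    have h := congrArg (fun x => (q * q) • x) (ha.cross i j c c' hij hc)
    simp only [smul_add, smul_smul, mul_assoc, hq, mul_one] at h
    rw [← mul_assoc q κ κ, hq, one_mul, hq, one_smul] at h
    rw [smul_add, smul_smul, neg_mul, neg_smul, neg_smul,
      show ∀ x y z w : A, -x + -y + (z + w) = (w + z) - (y + x) by intros; abel, ← h, sub_self,
      rightMul_zero, zero_mul]

variable (q) in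
/-- `extCoeff q a K J` is the quantum minor of `a` with rows `J` and columns `K`. -/
def extCoeff (a : Matrix (Fin r) (Fin r) A) (K : Finset (Fin r)) : Finset (Fin r) → A :=
  (K.sort (· ≥ ·)).foldr (fun c φ => colOp q a c φ) (Pi.single ∅ 1)

theorem extCoeff_empty (a : Matrix (Fin r) (Fin r) A) : extCoeff q a ∅ = Pi.single ∅ 1 := by
  simp [extCoeff]

theorem extCoeff_insert_max (a : Matrix (Fin r) (Fin r) A) {c : Fin r} {K : Finset (Fin r)}
    (h : ∀ k ∈ K, k < c) : extCoeff q a (insert c K) = colOp q a c (extCoeff q a K) := by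
  rw [extCoeff, Finset.sort_insert _ (fun k hk => (h k hk).le)
    (fun hc => lt_irrefl _ (h c hc)), List.foldr_cons, extCoeff]

/-- The column forms obey the exterior relations themselves, so a new column c moves to its place
past the larger columns at the cost of -q each, and a repeated column gives 0. This is the Laplace
expansion of quantum minors. -/
theorem RightQuantum.colOp_extCoeff {a : Matrix (Fin r) (Fin r) A} (ha : RightQuantum κ a)
    (hq : q * κ = 1) (c : Fin r) (K : Finset (Fin r)) :
    colOp q a c (extCoeff q a K) =
      if c ∈ K then 0 else (-q) ^ upperCard c K • extCoeff q a (insert c K) := by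
  induction K using Finset.induction_on_max generalizing c with
  | empty =>
    rw [if_neg (by simp), extCoeff_insert_max a (by simp), upperCard_eq_zero (by simp), pow_zero,
      one_smul]
  | insert x K hx ih =>
    have hxK : x ∉ K := fun h => lt_irrefl _ (hx x h)
    rcases lt_trichotomy c x with hcx | rfl | hcx
    · rw [extCoeff_insert_max a hx, ← Module.End.mul_apply, ha.colOp_mul_comm hq hcx,
        LinearMap.smul_apply, Module.End.mul_apply, ih]
      simp only [Finset.mem_insert, hcx.ne, false_or]
      split_ifs with hc
      · simp
      · rw [map_smul, smul_smul, upperCard_insert hxK, if_pos hcx, ← pow_succ',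
          Finset.insert_comm, ← extCoeff_insert_max]
        intro k hk
        rcases Finset.mem_insert.1 hk with rfl | hk
        · exact hcx
        · exact hx k hk
    · rw [extCoeff_insert_max a hx, ← Module.End.mul_apply, ha.colOp_mul_self hq]
      simp
    · have hall : ∀ k ∈ insert x K, k < c := by
        intro k hk
        rcases Finset.mem_insert.1 hk with rfl | hk
        · exact hcx
        · exact (hx k hk).trans hcx
      rw [if_neg (fun h => lt_irrefl _ (hall c h)), upperCard_eq_zero hall, pow_zero, one_smul,
        extCoeff_insert_max a hall]

/-! ### Quantum minors as sums over words -/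

/-- The number of inversions of a word. -/
def wordInv {b : ℕ} (w : Fin b → Fin r) : ℕ :=
  (Finset.univ.filter fun p : Fin b × Fin b => p.1 < p.2 ∧ w p.2 < w p.1).card

/-- A last letter i forms an inversion with exactly the earlier letters larger than i; injectivity
lets these be counted in the image. -/
theorem wordInv_snoc {b : ℕ} {w : Fin b → Fin r} (hw : Function.Injective w) (i : Fin r) :
    wordInv (Fin.snoc w i : Fin (b + 1) → Fin r) =
      upperCard i (Finset.univ.image w) + wordInv w := by
  simp only [wordInv, Finset.card_filter, Fintype.sum_prod_type, Fin.sum_univ_castSucc,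
    Fin.snoc_castSucc, Fin.snoc_last, Fin.castSucc_lt_castSucc_iff, Fin.castSucc_lt_last, true_and,
    lt_self_iff_false, and_false, false_and, if_false, add_zero,
    fun x : Fin b => (Fin.castSucc_lt_last x).not_gt, Finset.sum_const_zero,
    Finset.sum_add_distrib]
  rw [add_comm, upperCard, Finset.card_filter, Finset.sum_image (fun _ _ _ _ h => hw h)]

variable (q) in
/-- Iterated column operators, along the tuple `e` of columns. -/
def colIter {b : ℕ} (a : Matrix (Fin r) (Fin r) A) (e : Fin b → Fin r) : Finset (Fin r) → A :=
  (List.ofFn e).reverse.foldr (fun c φ => colOp q a c φ) (Pi.single ∅ 1)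

theorem colIter_succ {b : ℕ} (a : Matrix (Fin r) (Fin r) A) (e : Fin (b + 1) → Fin r) :
    colIter q a e = colOp q a (e (Fin.last b)) (colIter q a fun i => e i.castSucc) := by
  rw [colIter, List.ofFn_succ']
  simp [List.concat_eq_append, colIter]

theorem injective_snoc_and_image {b : ℕ} (w : Fin b → Fin r) (i : Fin r) (J : Finset (Fin r)) :
    (Function.Injective (Fin.snoc w i : Fin (b + 1) → Fin r) ∧
      Finset.univ.image (Fin.snoc w i : Fin (b + 1) → Fin r) = J) ↔
    i ∈ J ∧ Function.Injective w ∧ Finset.univ.image w = J.erase i := by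
  have himg : Finset.univ.image (Fin.snoc w i : Fin (b + 1) → Fin r) =
      insert i (Finset.univ.image w) := by
    ext x
    simp only [Finset.mem_image, Finset.mem_univ, true_and, Finset.mem_insert,
      Fin.exists_fin_succ', Fin.snoc_castSucc, Fin.snoc_last]
    tauto
  rw [himg, Fin.snoc_injective_iff]
  constructor
  · rintro ⟨⟨hw, hi⟩, rfl⟩
    refine ⟨by simp, hw, ?_⟩
    rw [Finset.erase_insert]
    simpa using hi
  · rintro ⟨hi, hw, himg⟩
    refine ⟨⟨hw, ?_⟩, ?_⟩
    · have : i ∉ Finset.univ.image w := by rw [himg]; simp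
      simpa using this
    · rw [himg, Finset.insert_erase hi]

-- Expanding the product of column forms produces all words of row indices. Words with a repetition
-- die because ξ_i² = 0, and sorting the remaining ones produces (-q) to the number of inversions.
open Classical in
theorem colIter_apply {b : ℕ} (a : Matrix (Fin r) (Fin r) A) (e : Fin b → Fin r)
    (J : Finset (Fin r)) :
    colIter q a e J = ∑ w : Fin b → Fin r,
      if Function.Injective w ∧ Finset.univ.image w = J then
        (-q) ^ wordInv w • (List.ofFn fun l => a (w l) (e l)).prod else 0 := by
  induction b generalizing J with
  | zero =>
    have h0 : ∀ w : Fin 0 → Fin r, Function.Injective w := fun w x => x.elim0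
    simp only [colIter, List.ofFn_zero, List.reverse_nil, List.foldr_nil, Pi.single_apply, h0,
      true_and, Finset.univ_eq_empty, Finset.image_empty, List.prod_nil, Finset.univ_unique,
      Finset.sum_singleton, wordInv, Finset.filter_empty, Finset.card_empty, pow_zero, one_smul,
      eq_comm (a := J)]
  | succ b ih =>
    rw [colIter_succ, colOp_apply, ← (Fin.snocEquiv fun _ => Fin r).sum_comp,
      Fintype.sum_prod_type]
    refine Finset.sum_congr rfl fun i _ => ?_
    have hsn : ∀ w : Fin b → Fin r, Fin.snocEquiv (fun _ => Fin r) (i, w) = Fin.snoc w i :=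
      fun _ => rfl
    simp only [hsn, injective_snoc_and_image]
    rw [extOp_apply]
    split_ifs with hi
    · rw [ih, Finset.smul_sum, Finset.sum_mul]
      refine Finset.sum_congr rfl fun w _ => ?_
      simp only [hi, true_and]
      split_ifs with hw
      · rw [wordInv_snoc hw.1, hw.2, List.ofFn_succ', List.concat_eq_append, List.prod_append,
          pow_add]
        simp [mul_smul]
      · simp
    · rw [zero_mul]
      symm
      refine Finset.sum_eq_zero fun w _ => ?_
      rw [if_neg]
      tauto

theorem extCoeff_eq_colIter (a : Matrix (Fin r) (Fin r) A) (K : Finset (Fin r)) :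
    extCoeff q a K = colIter q a (K.orderEmbOfFin rfl) := by
  rw [extCoeff, colIter]
  congr 1
  refine List.SortedGT.eq_of_mem_iff K.sortedGT_sort ?_ ?_
  · rw [List.sortedGT_reverse]
    exact List.sortedLT_ofFn_iff.2 (K.orderEmbOfFin rfl).strictMono
  · intro x
    simp only [Finset.mem_sort, List.mem_reverse, List.mem_ofFn]
    rw [← Finset.mem_coe, ← Finset.range_orderEmbOfFin K rfl, Set.mem_range]

/-- Injective words with image J are the permutations of J, so the coefficient is the principal
quantum minor in the form used by `qDet`. -/
theorem extCoeff_self (a : Matrix (Fin r) (Fin r) A) (J : Finset (Fin r)) :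
    extCoeff q a J J = ∑ π : Equiv.Perm (Fin J.card), (-q) ^ inversions π •
      (List.ofFn fun l => a (J.orderEmbOfFin rfl (π l)) (J.orderEmbOfFin rfl l)).prod := by
  classical
  rw [extCoeff_eq_colIter, colIter_apply, ← Finset.sum_filter]
  symm
  refine Finset.sum_of_injOn (fun π l => J.orderEmbOfFin rfl (π l)) ?_ ?_ ?_ ?_
  · intro π _ π' _ h
    ext l
    have := congrFun h l
    exact congrArg Fin.val (by simpa using this)
  · intro π _
    simp only [Finset.coe_filter, Finset.mem_univ, true_and, Set.mem_ofPred_eq]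
    refine ⟨fun x y h => by simpa using h, ?_⟩
    ext x
    rw [← Finset.mem_coe (s := J), ← Finset.range_orderEmbOfFin J rfl]
    simp only [Finset.mem_image, Finset.mem_univ, true_and, Set.mem_range]
    exact ⟨fun ⟨y, hy⟩ => ⟨π y, hy⟩, fun ⟨y, hy⟩ => ⟨π.symm y, by simpa using hy⟩⟩
  · intro w hw hw'
    exfalso
    rw [Finset.mem_filter] at hw
    obtain ⟨-, hinj, himg⟩ := hw
    have hmem : ∀ l, w l ∈ J := fun l => by
      rw [← himg]; exact Finset.mem_image_of_mem _ (Finset.mem_univ l)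
    have hinj' : Function.Injective fun l => (J.orderIsoOfFin rfl).symm ⟨w l, hmem l⟩ := by
      intro x y h
      have := (J.orderIsoOfFin rfl).symm.injective h
      exact hinj (by simpa using this)
    refine hw' ⟨Equiv.ofBijective _ (Finite.injective_iff_bijective.1 hinj'), by simp, ?_⟩
    funext l
    simp [Finset.orderEmbOfFin]
  · intro π _
    simp only [wordInv, inversions, OrderEmbedding.lt_iff_lt]

end QuantumExterior

end

section

/-! ### The quantum MacMahon master theorem, by the Koszul complex -/

section Koszul

variable {R : Type*} [CommRing R] {A : Type*} [Ring A] [Algebra R A]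

/-- A chain endomorphism of a contractible complex has supertrace zero. The entries of `M` need not
commute: cyclicity of the trace is only used against δ, whose entries are scalars, and the sign
comes from δ changing the parity. That δ squares to zero is not needed. -/
theorem sum_sign_diag_eq_zero {σ : Type*} [Fintype σ] [DecidableEq σ] (M : Matrix σ σ A)
    (δ h : Matrix σ σ R) (ε : σ → ℤ)
    (hM : M * δ.map (algebraMap R A) = δ.map (algebraMap R A) * M) (hδ : δ * h + h * δ = 1)
    (hε : ∀ s t, δ s t ≠ 0 → ε s = -ε t) : ∑ s, ε s • M s s = 0 := by
  set D := δ.map (algebraMap R A)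
  set H := h.map (algebraMap R A)
  have hDH : D * H + H * D = 1 := by
    have := congrArg (fun X : Matrix σ σ R => X.map (algebraMap R A)) hδ
    simpa [Matrix.map_add, Matrix.map_mul] using this
  have hX : ∑ s, ε s • (M * (D * H)) s s = -∑ s, ε s • (M * (H * D)) s s := by
    rw [← mul_assoc, hM, mul_assoc, ← mul_assoc M H D, ← Finset.sum_neg_distrib]
    have e1 : ∀ s, (D * (M * H)) s s = ∑ t, D s t * (M * H) t s := fun s => Matrix.mul_apply
    have e2 : ∀ s, (M * H * D) s s = ∑ t, (M * H) s t * D t s := fun s => Matrix.mul_apply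
    simp only [e1, e2, Finset.smul_sum, ← Finset.sum_neg_distrib]
    rw [Finset.sum_comm]
    refine Finset.sum_congr rfl fun t _ => Finset.sum_congr rfl fun s _ => ?_
    by_cases hst : δ s t = 0
    · simp [D, hst]
    · rw [hε s t hst, neg_smul]
      simp only [D, Matrix.map_apply, Algebra.commutes]
  calc ∑ s, ε s • M s s = ∑ s, ε s • (M * (D * H + H * D)) s s := by rw [hDH, mul_one]
    _ = ∑ s, ε s • (M * (D * H)) s s + ∑ s, ε s • (M * (H * D)) s s := by
      rw [mul_add, ← Finset.sum_add_distrib]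
      simp [smul_add]
    _ = 0 := by rw [hX, neg_add_cancel]

variable {r : ℕ} {q κ : R}

/-- The basis of the degree `d` part of the Koszul complex. -/
def koszulBasis (r d : ℕ) : Finset ((Fin r → ℕ) × Finset (Fin r)) :=
  ((Fintype.piFinset fun _ => Finset.range (d + 1)) ×ˢ Finset.univ).filter
    fun s => ∑ p, s.1 p + s.2.card = d

theorem mem_koszulBasis {d : ℕ} {s : (Fin r → ℕ) × Finset (Fin r)} :
    s ∈ koszulBasis r d ↔ ∑ p, s.1 p + s.2.card = d := by
  simp only [koszulBasis, Finset.mem_filter, Finset.mem_product, Fintype.mem_piFinset,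
    Finset.mem_range, Finset.mem_univ, and_true, and_iff_right_iff_imp]
  intro h p
  have := Finset.single_le_sum (f := s.1) (fun _ _ => Nat.zero_le _) (Finset.mem_univ p)
  omega

/-- The coefficient of the Koszul differential for the generator `i`. -/
def koszulCoeff (q κ : R) (i : Fin r) (m : Fin r → ℕ) (J : Finset (Fin r)) : R :=
  κ ^ lowerSum i m * (-q) ^ upperCard i J

/-- The state obtained by turning the exterior generator `i` into a symmetric one. -/
def koszulMove (i : Fin r) (s : (Fin r → ℕ) × Finset (Fin r)) : (Fin r → ℕ) × Finset (Fin r) :=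
  (s.1 + Pi.single i 1, s.2.erase i)

/-- The state obtained by turning the symmetric generator `i` into an exterior one. -/
def koszulBack (i : Fin r) (s : (Fin r → ℕ) × Finset (Fin r)) : (Fin r → ℕ) × Finset (Fin r) :=
  (s.1 - Pi.single i 1, insert i s.2)

theorem koszulMove_mem {d : ℕ} {i : Fin r} {s : (Fin r → ℕ) × Finset (Fin r)}
    (hs : s ∈ koszulBasis r d) (hi : i ∈ s.2) : koszulMove i s ∈ koszulBasis r d := by
  rw [mem_koszulBasis] at hs ⊢
  have := Finset.card_pos.2 ⟨i, hi⟩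
  simp only [koszulMove, Pi.add_apply, Finset.sum_add_distrib, Finset.card_erase_of_mem hi,
    Finset.sum_pi_single', Finset.mem_univ, if_true]
  omega

theorem koszulBack_mem {d : ℕ} {i : Fin r} {s : (Fin r → ℕ) × Finset (Fin r)}
    (hs : s ∈ koszulBasis r d) (hi : i ∉ s.2) (hm : 0 < s.1 i) :
    koszulBack i s ∈ koszulBasis r d := by
  rw [mem_koszulBasis] at hs ⊢
  have h := congrArg (fun f : Fin r → ℕ => ∑ p, f p) (eq_add_single hm)
  simp only [Pi.add_apply, Finset.sum_add_distrib, Finset.sum_pi_single', Finset.mem_univ,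
    if_true] at h
  simp only [koszulBack, Finset.card_insert_of_notMem hi]
  omega

theorem koszulMove_eq_iff {i : Fin r} {s t : (Fin r → ℕ) × Finset (Fin r)} :
    (i ∈ s.2 ∧ t = koszulMove i s) ↔ (i ∉ t.2 ∧ 0 < t.1 i) ∧ s = koszulBack i t := by
  constructor
  · rintro ⟨hi, rfl⟩
    refine ⟨⟨by simp [koszulMove], by simp [koszulMove]⟩, ?_⟩
    simp [koszulMove, koszulBack, Finset.insert_erase hi]
  · rintro ⟨⟨hi, hm⟩, rfl⟩
    refine ⟨by simp [koszulBack], ?_⟩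
    simp [koszulMove, koszulBack, Finset.erase_insert hi, ← eq_add_single hm]

/-- The Koszul differential. -/
def koszulD (q κ : R) (d : ℕ) : Matrix (koszulBasis r d) (koszulBasis r d) R :=
  Matrix.of fun s t => ∑ i, if i ∈ s.1.2 ∧ t.1 = koszulMove i s.1 then
    koszulCoeff q κ i s.1.1 (s.1.2.erase i) else 0

/-- The smallest index of a generator in the state `s` is `p`. -/
def IsPivot (p : Fin r) (s : (Fin r → ℕ) × Finset (Fin r)) : Prop :=
  (0 < s.1 p ∨ p ∈ s.2) ∧ ∀ i < p, s.1 i = 0 ∧ i ∉ s.2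

theorem IsPivot.unique {p p' : Fin r} {s : (Fin r → ℕ) × Finset (Fin r)} (h : IsPivot p s)
    (h' : IsPivot p' s) : p = p' := by
  rcases lt_trichotomy p p' with hlt | rfl | hlt
  · have := h'.2 p hlt
    rcases h.1 with h1 | h1
    · omega
    · exact absurd h1 this.2
  · rfl
  · have := h.2 p' hlt
    rcases h'.1 with h1 | h1
    · omega
    · exact absurd h1 this.2

theorem exists_isPivot {d : ℕ} (hd : 0 < d) {s : (Fin r → ℕ) × Finset (Fin r)}
    (hs : s ∈ koszulBasis r d) : ∃ p, IsPivot p s := by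
  have hne : (Finset.univ.filter fun p => 0 < s.1 p ∨ p ∈ s.2).Nonempty := by
    by_contra hcon
    rw [Finset.not_nonempty_iff_eq_empty, Finset.filter_eq_empty_iff] at hcon
    rw [mem_koszulBasis] at hs
    have h1 : ∑ p, s.1 p = 0 := Finset.sum_eq_zero fun p hp => by
      have := hcon hp
      push Not at this
      omega
    have h2 : s.2 = ∅ := by
      ext p
      have := hcon (Finset.mem_univ p)
      push Not at this
      simp [this.2]
    rw [h1, h2] at hs
    simp at hs
    omega
  refine ⟨Finset.min' _ hne, ?_, ?_⟩
  · simpa using Finset.min'_mem _ hne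
  · intro i hi
    by_contra hcon
    refine absurd (Finset.min'_le _ i ?_) (not_le.2 hi)
    simp only [Finset.mem_filter, Finset.mem_univ, true_and]
    by_contra h2
    push Not at h2
    exact hcon ⟨by omega, h2.2⟩

/-- The differential changes the type of a generator but not the set of indices in use, so the pivot
is preserved. -/
theorem IsPivot.move {p i : Fin r} {s : (Fin r → ℕ) × Finset (Fin r)} (h : IsPivot p s)
    (hi : i ∈ s.2) : IsPivot p (koszulMove i s) := by
  have hpi : p ≤ i := by
    by_contra hlt
    exact (h.2 i (not_le.1 hlt)).2 hi
  constructor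
  · rcases eq_or_ne p i with rfl | hne
    · simp [koszulMove]
    · rcases h.1 with h1 | h1
      · left
        simp only [koszulMove, Pi.add_apply]
        omega
      · right
        simp [koszulMove, hne, h1]
  · intro j hj
    have hji : j ≠ i := (hj.trans_le hpi).ne
    simp [koszulMove, hji, h.2 j hj]

open Classical in
/-- The contracting homotopy of the Koszul complex. -/
def koszulH (κ : R) (d : ℕ) : Matrix (koszulBasis r d) (koszulBasis r d) R :=
  Matrix.of fun s t => ∑ p, if IsPivot p s.1 ∧ p ∉ s.1.2 ∧ t.1 = koszulBack p s.1 then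
    (-κ) ^ s.1.2.card else 0

theorem koszulH_apply {d : ℕ} {s t : koszulBasis r d} {p : Fin r} (hp : IsPivot p s.1) :
    koszulH κ d s t = if p ∉ s.1.2 ∧ t.1 = koszulBack p s.1 then (-κ) ^ s.1.2.card else 0 := by
  classical
  rw [koszulH, Matrix.of_apply, Finset.sum_eq_single p]
  · simp [hp]
  · intro p' _ hne
    rw [if_neg]
    rintro ⟨h, -⟩
    exact hne (h.unique hp)
  · simp

theorem sum_koszulD_mul {d : ℕ} (s : koszulBasis r d) (F : koszulBasis r d → A) :
    ∑ t, algebraMap R A (koszulD q κ d s t) * F t = ∑ i, if h : i ∈ s.1.2 then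
      koszulCoeff q κ i s.1.1 (s.1.2.erase i) • F ⟨koszulMove i s.1, koszulMove_mem s.2 h⟩
      else 0 := by
  simp only [koszulD, Matrix.of_apply, map_sum, Finset.sum_mul]
  rw [Finset.sum_comm]
  refine Finset.sum_congr rfl fun i _ => ?_
  split_ifs with hi
  · rw [Finset.sum_eq_single ⟨koszulMove i s.1, koszulMove_mem s.2 hi⟩]
    · simp [hi, Algebra.smul_def]
    · intro t _ ht
      rw [if_neg, map_zero, zero_mul]
      rintro ⟨-, h⟩
      exact ht (Subtype.ext h)
    · simp
  · exact Finset.sum_eq_zero fun t _ => by simp [hi]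

theorem sum_mul_koszulD {d : ℕ} (t : koszulBasis r d) (F : koszulBasis r d → A) :
    ∑ s, F s * algebraMap R A (koszulD q κ d s t) = ∑ i, if h : i ∉ t.1.2 ∧ 0 < t.1.1 i then
      koszulCoeff q κ i (t.1.1 - Pi.single i 1) t.1.2 •
        F ⟨koszulBack i t.1, koszulBack_mem t.2 h.1 h.2⟩ else 0 := by
  simp only [koszulD, Matrix.of_apply, map_sum, Finset.mul_sum, koszulMove_eq_iff]
  rw [Finset.sum_comm]
  refine Finset.sum_congr rfl fun i _ => ?_
  split_ifs with hi
  · rw [Finset.sum_eq_single ⟨koszulBack i t.1, koszulBack_mem t.2 hi.1 hi.2⟩]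
    · rw [if_pos ⟨hi, rfl⟩, ← Algebra.commutes, ← Algebra.smul_def]
      simp [koszulBack, Finset.erase_insert hi.1]
    · intro s _ hs
      rw [if_neg, map_zero, mul_zero]
      rintro ⟨-, h⟩
      exact hs (Subtype.ext h)
    · simp
  · exact Finset.sum_eq_zero fun t _ => by simp [hi]

theorem lowerSum_sub_single {p i : Fin r} {m : Fin r → ℕ} (hpi : p < i) (hp : 0 < m p) :
    lowerSum i m = lowerSum i (m - Pi.single p 1) + 1 := by
  conv_lhs => rw [eq_add_single hp, lowerSum_add, lowerSum_single, if_pos hpi]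

theorem upperCard_eq_card {i : Fin r} {J : Finset (Fin r)} (h : ∀ j ∈ J, i < j) :
    upperCard i J = J.card := by
  rw [upperCard, Finset.filter_true_of_mem h]

/-- Let p be the smallest index in use. No generator lies below p and all other exterior ones lie
above it, so the differential at p has coefficient (-q)^|J| with J the remaining exterior
generators; the homotopy has the inverse coefficient. If p is exterior, only i = p in the first
product survives. If p is symmetric, i = p in the second product gives the identity and the terms
with i ≠ p cancel between the two products. -/
theorem koszulD_homotopy {d : ℕ} (hd : 0 < d) (hq : q * κ = 1) :
    koszulD (r := r) q κ d * koszulH κ d + koszulH κ d * koszulD q κ d = 1 := by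
  ext s t
  obtain ⟨p, hp⟩ := exists_isPivot hd s.2
  have hq' : ∀ n : ℕ, (-q) ^ n * (-κ) ^ n = 1 := fun n => by
    rw [← mul_pow, neg_mul_neg, hq, one_pow]
  rw [Matrix.add_apply, Matrix.mul_apply, Matrix.mul_apply]
  have h1 := sum_koszulD_mul (q := q) (κ := κ) s (fun u => koszulH κ d u t)
  simp only [Algebra.algebraMap_self, RingHom.id_apply] at h1
  rw [h1]
  have hlow : ∀ i ∈ s.1.2, i ≠ p → p < i := fun i hi hne => by
    by_contra hlt
    exact (hp.2 i (lt_of_le_of_ne (not_lt.1 hlt) hne)).2 hi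
  have hmove : ∀ i (hi : i ∈ s.1.2), koszulH κ d ⟨koszulMove i s.1, koszulMove_mem s.2 hi⟩ t =
      if p ∉ s.1.2.erase i ∧ t.1 = koszulBack p (koszulMove i s.1) then
        (-κ) ^ (s.1.2.erase i).card else 0 := fun i hi =>
    koszulH_apply (s := ⟨koszulMove i s.1, koszulMove_mem s.2 hi⟩) (hp.move hi)
  by_cases hps : p ∈ s.1.2
  · have hzero : ∑ u, koszulH κ d s u * koszulD q κ d u t = 0 :=
      Finset.sum_eq_zero fun u _ => by
        rw [koszulH_apply hp, if_neg (by simp [hps]), zero_mul]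
    rw [hzero, add_zero, Finset.sum_eq_single p]
    · rw [dif_pos hps, hmove p hps]
      have hback : koszulBack p (koszulMove p s.1) = s.1 := by
        simp [koszulBack, koszulMove, Finset.insert_erase hps]
      rw [hback, Matrix.one_apply, koszulCoeff, lowerSum_eq_zero (fun i hi => (hp.2 i hi).1),
        upperCard_eq_card (fun j hj => hlow j (Finset.mem_of_mem_erase hj)
          (Finset.ne_of_mem_erase hj))]
      by_cases hst : s = t
      · subst hst
        simp [hq']
      · rw [if_neg hst, if_neg, smul_zero]
        rintro ⟨-, h⟩
        exact hst (Subtype.ext h.symm)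
    · intro i _ hne
      split_ifs with hi
      · rw [hmove i hi, if_neg (by simp [hne.symm, hps]), smul_zero]
      · rfl
    · simp
  · have hmp : 0 < s.1.1 p := hp.1.resolve_right hps
    have h2 : ∑ u, koszulH κ d s u * koszulD q κ d u t = (-κ) ^ s.1.2.card *
        koszulD q κ d ⟨koszulBack p s.1, koszulBack_mem s.2 hps hmp⟩ t := by
      rw [Finset.sum_eq_single ⟨koszulBack p s.1, koszulBack_mem s.2 hps hmp⟩]
      · rw [koszulH_apply hp, if_pos ⟨hps, rfl⟩]
      · intro u _ hu
        rw [koszulH_apply hp, if_neg, zero_mul]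
        rintro ⟨-, h⟩
        exact hu (Subtype.ext h)
      · simp
    rw [h2, koszulD, Matrix.of_apply, Finset.mul_sum, ← Finset.sum_add_distrib,
      Finset.sum_eq_single p]
    · rw [dif_neg hps, zero_add]
      have hmb : koszulMove p (koszulBack p s.1) = s.1 := by
        simp [koszulBack, koszulMove, Finset.erase_insert hps, ← eq_add_single hmp]
      simp only [hmb]
      have hcoef : koszulCoeff q κ p (koszulBack p s.1).1 ((koszulBack p s.1).2.erase p) =
          (-q) ^ s.1.2.card := by
        rw [koszulCoeff, koszulBack, Finset.erase_insert hps, lowerSum_eq_zero, pow_zero, one_mul,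
          upperCard_eq_card]
        · intro j hj
          exact hlow j hj (fun h => hps (h ▸ hj))
        · intro i hi
          simp [(hp.2 i hi).1]
      rw [hcoef, Matrix.one_apply]
      by_cases hst : s = t
      · subst hst
        rw [if_pos ⟨by simp [koszulBack], rfl⟩, if_pos rfl, mul_comm, hq']
      · rw [if_neg hst, if_neg, mul_zero]
        rintro ⟨-, h⟩
        exact hst (Subtype.ext h.symm)
    · intro i _ hne
      have hmem : i ∈ (koszulBack p s.1).2 ↔ i ∈ s.1.2 := by simp [koszulBack, hne]
      by_cases hi : i ∈ s.1.2
      · have hpi := hlow i hi hne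
        have hcomm : koszulBack p (koszulMove i s.1) = koszulMove i (koszulBack p s.1) := by
          simp only [koszulBack, koszulMove, Finset.erase_insert_of_ne hpi.ne, Prod.mk.injEq,
            and_true]
          funext j
          by_cases hj : j = p
          · subst hj; simp [hpi.ne]
          · simp [hj]
        rw [dif_pos hi, hmove i hi, hcomm]
        simp only [hmem, hi, true_and]
        have hpe : p ∉ s.1.2.erase i := fun h => hps (Finset.mem_of_mem_erase h)
        simp only [hpe, not_false_eq_true, true_and]
        split_ifs with ht
        · have hcoef : koszulCoeff q κ i (koszulBack p s.1).1 ((koszulBack p s.1).2.erase i) =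
              κ ^ lowerSum i (s.1.1 - Pi.single p 1) * (-q) ^ upperCard i (s.1.2.erase i) := by
            rw [koszulCoeff, koszulBack, Finset.erase_insert_of_ne hpi.ne,
              upperCard_insert (by simp [hps]), if_neg hpi.le.not_gt, add_zero]
          -- In one product the symmetric p is still present and contributes an extra κ through
          -- `lowerSum`; in the other the exterior set has one more element and contributes an extra
          -- -κ. Hence the opposite signs.
          rw [hcoef, koszulCoeff, lowerSum_sub_single hpi hmp, smul_eq_mul,
            Finset.card_erase_of_mem hi]
          obtain ⟨c, hc⟩ : ∃ c, s.1.2.card = c + 1 :=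
            ⟨s.1.2.card - 1, by have := Finset.card_pos.2 ⟨i, hi⟩; omega⟩
          rw [hc]
          simp only [add_tsub_cancel_right]
          ring
        · simp
      · rw [dif_neg hi, if_neg, mul_zero, add_zero]
        simp [hmem, hi]
    · simp

/-- The action of a matrix on the Koszul complex. -/
def koszulAct (q κ : R) (a : Matrix (Fin r) (Fin r) A) (d : ℕ) :
    Matrix (koszulBasis r d) (koszulBasis r d) A :=
  Matrix.of fun s t => extCoeff q a t.1.2 s.1.2 * symCoeff κ a s.1.1 t.1.1

/-- Both composites equal the sum over i and j of (minor without row i) · a_ij · (X_j applied to the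
symmetric coefficient). On one side a_ij comes from expanding a minor along the column j, on the
other from adding the variable X_i to the symmetric monomial. -/
theorem RightQuantum.koszulAct_comm {a : Matrix (Fin r) (Fin r) A} (ha : RightQuantum κ a)
    (hq : q * κ = 1) (d : ℕ) :
    koszulAct q κ a d * (koszulD q κ d).map (algebraMap R A) =
      (koszulD q κ d).map (algebraMap R A) * koszulAct q κ a d := by
  ext s t
  rw [Matrix.mul_apply, Matrix.mul_apply]
  simp only [Matrix.map_apply]
  rw [sum_koszulD_mul, sum_mul_koszulD]
  simp only [koszulAct, Matrix.of_apply]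
  have hcol : ∀ j, (if j ∈ t.1.2 then (0 : A) else
      (-q) ^ upperCard j t.1.2 • extCoeff q a (insert j t.1.2) s.1.2) =
      ∑ i, if i ∈ s.1.2 then (-q) ^ upperCard i (s.1.2.erase i) •
        extCoeff q a t.1.2 (s.1.2.erase i) * a i j else 0 := by
    intro j
    have := congrFun (ha.colOp_extCoeff hq j t.1.2) s.1.2
    rw [colOp_apply] at this
    simp only [extOp_apply, ite_mul, zero_mul] at this
    rw [this]
    split_ifs <;> rfl
  have hrow : ∀ i, κ ^ lowerSum i s.1.1 • symCoeff κ a (s.1.1 + Pi.single i 1) t.1.1 =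
      ∑ j, a i j * varOp A κ j (symCoeff κ a s.1.1) t.1.1 := by
    intro i
    rw [← rowOp_apply, ha.rowOp_symCoeff, Pi.smul_apply]
  have hL : ∀ j, (if h : j ∉ t.1.2 ∧ 0 < t.1.1 j then
      koszulCoeff q κ j (t.1.1 - Pi.single j 1) t.1.2 •
        (extCoeff q a (koszulBack j t.1).2 s.1.2 *
          symCoeff κ a s.1.1 (koszulBack j t.1).1) else 0) =
      ∑ i, if i ∈ s.1.2 then (-q) ^ upperCard i (s.1.2.erase i) •
        extCoeff q a t.1.2 (s.1.2.erase i) * a i j * varOp A κ j (symCoeff κ a s.1.1) t.1.1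
        else 0 := by
    intro j
    have : ∀ i, (if i ∈ s.1.2 then (-q) ^ upperCard i (s.1.2.erase i) •
        extCoeff q a t.1.2 (s.1.2.erase i) * a i j * varOp A κ j (symCoeff κ a s.1.1) t.1.1
        else 0) = (if i ∈ s.1.2 then (-q) ^ upperCard i (s.1.2.erase i) •
        extCoeff q a t.1.2 (s.1.2.erase i) * a i j else 0) *
        varOp A κ j (symCoeff κ a s.1.1) t.1.1 := by
      intro i
      split_ifs <;> simp
    simp only [this]
    rw [← Finset.sum_mul, ← hcol, varOp_apply]
    by_cases hj : j ∈ t.1.2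
    · simp [hj]
    · by_cases hm : 0 < t.1.1 j
      · rw [dif_pos ⟨hj, hm⟩, if_neg hj, if_pos hm, smul_mul_smul_comm, koszulCoeff, koszulBack,
          mul_comm]
      · rw [dif_neg (by tauto), if_neg hm, mul_zero]
  have hR : ∀ i, (if h : i ∈ s.1.2 then koszulCoeff q κ i s.1.1 (s.1.2.erase i) •
      (extCoeff q a t.1.2 (koszulMove i s.1).2 * symCoeff κ a (koszulMove i s.1).1 t.1.1) else 0) =
      ∑ j, if i ∈ s.1.2 then (-q) ^ upperCard i (s.1.2.erase i) •
        extCoeff q a t.1.2 (s.1.2.erase i) * a i j * varOp A κ j (symCoeff κ a s.1.1) t.1.1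
        else 0 := by
    intro i
    split_ifs with hi
    · simp only [mul_assoc]
      rw [← Finset.mul_sum, ← hrow, smul_mul_smul_comm, koszulCoeff, koszulMove, mul_comm]
    · simp
  rw [Finset.sum_congr rfl fun j _ => hL j, Finset.sum_congr rfl fun i _ => hR i,
    Finset.sum_comm]

variable (κ) in
/-- The trace of the action of a matrix on the degree `d` part of the quantum symmetric algebra. -/
def symTrace (a : Matrix (Fin r) (Fin r) A) (d : ℕ) : A :=
  ∑ m ∈ Finset.piAntidiag Finset.univ d, symCoeff κ a m m

theorem symTrace_zero (a : Matrix (Fin r) (Fin r) A) : symTrace κ a 0 = 1 := by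
  simp [symTrace, symCoeff_zero]

/-- The quantum MacMahon master theorem in degree d: the vanishing supertrace on the degree d part
of the Koszul complex, grouped by the exterior component J. -/
theorem RightQuantum.master {a : Matrix (Fin r) (Fin r) A} (ha : RightQuantum κ a)
    (hq : q * κ = 1) {d : ℕ} (hd : 0 < d) :
    ∑ J : Finset (Fin r), (if J.card ≤ d then
      (-1 : ℤ) ^ J.card • (extCoeff q a J J * symTrace κ a (d - J.card)) else 0) = 0 := by
  have h := sum_sign_diag_eq_zero (koszulAct q κ a d) (koszulD q κ d) (koszulH κ d)
    (fun s => (-1) ^ s.1.2.card) (ha.koszulAct_comm hq d) (koszulD_homotopy hd hq) ?_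
  · refine Eq.trans ?_ ((Finset.sum_coe_sort (koszulBasis r d) fun s =>
      (-1 : ℤ) ^ s.2.card • (extCoeff q a s.2 s.2 * symCoeff κ a s.1 s.1)).symm.trans h)
    have hmaps : ∀ s ∈ koszulBasis r d, s.2 ∈ (Finset.univ : Finset (Finset (Fin r))) := by simp
    rw [← Finset.sum_fiberwise_of_maps_to hmaps]
    refine Finset.sum_congr rfl fun J _ => ?_
    split_ifs with hJ
    · rw [symTrace, Finset.mul_sum, Finset.smul_sum]
      refine Finset.sum_bij (fun m _ => (m, J)) ?_ ?_ ?_ ?_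
      · intro m hm
        simp only [Finset.mem_piAntidiag] at hm
        simp only [Finset.mem_filter, mem_koszulBasis, and_true, hm.1]
        omega
      · intro m _ m' _ h
        exact congrArg Prod.fst h
      · rintro ⟨m, J'⟩ hm
        simp only [Finset.mem_filter, mem_koszulBasis] at hm
        obtain ⟨hm, rfl⟩ := hm
        refine ⟨m, ?_, rfl⟩
        simp only [Finset.mem_piAntidiag, Finset.mem_univ, implies_true, and_true]
        exact Nat.eq_sub_of_add_eq hm
      · intros; rfl
    · symm
      refine Finset.sum_eq_zero fun s hs => ?_
      simp only [Finset.mem_filter, mem_koszulBasis] at hs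
      obtain ⟨hs, rfl⟩ := hs
      omega
  · intro s t hst
    have : ∃ i, i ∈ s.1.2 ∧ t.1 = koszulMove i s.1 := by
      by_contra hcon
      push Not at hcon
      refine hst ?_
      rw [koszulD, Matrix.of_apply]
      refine Finset.sum_eq_zero fun i _ => if_neg ?_
      rintro ⟨hi, h⟩
      exact hcon i hi h
    obtain ⟨i, hi, ht⟩ := this
    have hc : s.1.2.card = t.1.2.card + 1 := by
      rw [ht, koszulMove, Finset.card_erase_of_mem hi]
      have := Finset.card_pos.2 ⟨i, hi⟩
      omega
    rw [hc, pow_succ]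
    ring

end Koszul

end

section

/-! ### Words in the entries of a matrix -/

section Words

variable {R : Type*} [CommRing R] {A : Type*} [Ring A] [Algebra R A] {r : ℕ} {q κ : R}

/-- The product of the entries of `a` at the positions in the list `L`. -/
def wordVal (a : Matrix (Fin r) (Fin r) A) (L : List (Fin r × Fin r)) : A :=
  (L.map fun p => a p.1 p.2).prod

theorem wordVal_append (a : Matrix (Fin r) (Fin r) A) (L L' : List (Fin r × Fin r)) :
    wordVal a (L ++ L') = wordVal a L * wordVal a L' := by
  simp [wordVal]

variable (R) in
/-- The span of the words of length at least `d` whose row indices are a permutation of their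
column indices. -/
def balancedSpan (a : Matrix (Fin r) (Fin r) A) (d : ℕ) : Submodule R A :=
  Submodule.span R {x | ∃ L : List (Fin r × Fin r),
    (L.map Prod.fst).Perm (L.map Prod.snd) ∧ d ≤ L.length ∧ wordVal a L = x}

theorem balancedSpan_anti (a : Matrix (Fin r) (Fin r) A) {d e : ℕ} (h : d ≤ e) :
    balancedSpan R a e ≤ balancedSpan R a d :=
  Submodule.span_mono fun _ ⟨L, hp, hl, hx⟩ => ⟨L, hp, h.trans hl, hx⟩

theorem one_mem_balancedSpan (a : Matrix (Fin r) (Fin r) A) : (1 : A) ∈ balancedSpan R a 0 :=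
  Submodule.subset_span ⟨[], by simp, by simp, by simp [wordVal]⟩

theorem mul_mem_balancedSpan {a : Matrix (Fin r) (Fin r) A} {d e : ℕ} {x y : A}
    (hx : x ∈ balancedSpan R a d) (hy : y ∈ balancedSpan R a e) :
    x * y ∈ balancedSpan R a (d + e) := by
  have := Submodule.mul_mem_mul hx hy
  rw [balancedSpan, balancedSpan, Submodule.span_mul_span] at this
  refine Submodule.span_mono ?_ this
  rintro _ ⟨_, ⟨L, hp, hl, rfl⟩, _, ⟨L', hp', hl', rfl⟩, rfl⟩
  refine ⟨L ++ L', ?_, ?_, wordVal_append a L L'⟩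
  · simpa using hp.append hp'
  · simp; omega

theorem pow_mem_balancedSpan {a : Matrix (Fin r) (Fin r) A} {x : A}
    (hx : x ∈ balancedSpan R a 1) (n : ℕ) : x ^ n ∈ balancedSpan R a n := by
  induction n with
  | zero => simpa using one_mem_balancedSpan a
  | succ n ih => rw [pow_succ]; exact mul_mem_balancedSpan ih hx

theorem extCoeff_self_mem (a : Matrix (Fin r) (Fin r) A) (J : Finset (Fin r)) :
    extCoeff q a J J ∈ balancedSpan R a J.card := by
  rw [extCoeff_self]
  refine Submodule.sum_mem _ fun π _ => Submodule.smul_mem _ _ (Submodule.subset_span ?_)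
  refine ⟨List.ofFn fun l => (J.orderEmbOfFin rfl (π l), J.orderEmbOfFin rfl l), ?_, by simp, ?_⟩
  · rw [List.map_ofFn, List.map_ofFn]
    exact π.ofFn_comp_perm (J.orderEmbOfFin rfl)
  · rw [wordVal, List.map_ofFn]
    rfl

variable (R) in
/-- The span of the words with given row and column contents. -/
def contentSpan (a : Matrix (Fin r) (Fin r) A) (m m' : Fin r → ℕ) : Submodule R A :=
  Submodule.span R {x | ∃ L : List (Fin r × Fin r),
    (∀ p, (L.map Prod.fst).count p = m p) ∧ (∀ p, (L.map Prod.snd).count p = m' p) ∧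
      wordVal a L = x}

/-- Each replacement of X_i by a_ij X_j adds i to the row content and j to the column content. -/
theorem RightQuantum.symCoeff_mem {a : Matrix (Fin r) (Fin r) A} (ha : RightQuantum κ a)
    (m m' : Fin r → ℕ) : symCoeff κ a m m' ∈ contentSpan R a m m' := by
  induction m using ordInduction generalizing m' with
  | h0 =>
    rw [symCoeff_zero, Pi.single_apply]
    split_ifs with h
    · subst h
      exact Submodule.subset_span ⟨[], by simp, by simp, by simp [wordVal]⟩
    · exact Submodule.zero_mem _
  | hs m i hi ih =>
    rw [ha.symCoeff_add_single i m hi, rowOp_apply]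
    refine Submodule.sum_mem _ fun j _ => ?_
    rw [varOp_apply]
    split_ifs with hj
    · rw [mul_smul_comm]
      refine Submodule.smul_mem _ _ ?_
      have := ih (m' - Pi.single j 1)
      rw [contentSpan] at this
      refine Submodule.span_induction (p := fun x _ => a i j * x ∈ contentSpan R a _ m') ?_ ?_ ?_ ?_
        this
      · rintro _ ⟨L, h1, h2, rfl⟩
        refine Submodule.subset_span ⟨(i, j) :: L, fun p => ?_, fun p => ?_, by simp [wordVal]⟩
        · by_cases hp : p = i
          · subst hp; simp [h1]
          · simp [h1, hp, Ne.symm hp]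
        · by_cases hp : p = j
          · subst hp; simp [h2]; omega
          · simp [h2, hp, Ne.symm hp]
      · simp
      · intro x y _ _ hx hy
        rw [mul_add]
        exact Submodule.add_mem _ hx hy
      · intro t x _ hx
        rw [mul_smul_comm]
        exact Submodule.smul_mem _ _ hx
    · simp

theorem contentSpan_self_le (a : Matrix (Fin r) (Fin r) A) (m : Fin r → ℕ) :
    contentSpan R a m m ≤ balancedSpan R a (∑ p, m p) := by
  refine Submodule.span_mono ?_
  rintro _ ⟨L, h1, h2, rfl⟩
  refine ⟨L, List.perm_iff_count.2 fun p => (h1 p).trans (h2 p).symm, le_of_eq ?_, rfl⟩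
  rw [← Finset.sum_congr rfl fun p _ => h1 p]
  have := Multiset.sum_count_eq_card (s := Finset.univ) (m := (L.map Prod.fst : Multiset (Fin r)))
    (fun _ _ => Finset.mem_univ _)
  simpa using this

theorem RightQuantum.symTrace_mem {a : Matrix (Fin r) (Fin r) A} (ha : RightQuantum κ a) (d : ℕ) :
    symTrace κ a d ∈ balancedSpan R a d :=
  Submodule.sum_mem _ fun m hm => by
    have := contentSpan_self_le a m (ha.symCoeff_mem m m)
    rwa [(Finset.mem_piAntidiag.1 hm).1] at this

variable (q) in
/-- The alternating sum of the principal quantum minors of positive size. -/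
def minorAlt (a : Matrix (Fin r) (Fin r) A) : A :=
  ∑ J ∈ Finset.univ.filter fun J : Finset (Fin r) => J.Nonempty,
    (-1 : ℤ) ^ (J.card - 1) • extCoeff q a J J

theorem minorAlt_mem (a : Matrix (Fin r) (Fin r) A) : minorAlt q a ∈ balancedSpan R a 1 :=
  Submodule.sum_mem _ fun J hJ => zsmul_mem (balancedSpan_anti a
    (Finset.card_pos.2 (Finset.mem_filter.1 hJ).2) (extCoeff_self_mem a J)) _

/-- The empty set supplies the 1, so that 1 - C is the full alternating sum of the master theorem.
-/
theorem one_sub_minorAlt (a : Matrix (Fin r) (Fin r) A) :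
    1 - minorAlt q a = ∑ J : Finset (Fin r), (-1 : ℤ) ^ J.card • extCoeff q a J J := by
  rw [minorAlt, ← Finset.sum_filter_add_sum_filter_not Finset.univ
    (fun J : Finset (Fin r) => J.Nonempty) (fun J => (-1 : ℤ) ^ J.card • extCoeff q a J J)]
  have h1 : (Finset.univ.filter fun J : Finset (Fin r) => ¬ J.Nonempty) = {∅} := by
    ext J
    simp
  rw [h1, Finset.sum_singleton, extCoeff_empty]
  simp only [Finset.card_empty, pow_zero, Pi.single_eq_same, one_smul]
  rw [add_comm, sub_eq_add_neg, ← Finset.sum_neg_distrib]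
  congr 1
  refine Finset.sum_congr rfl fun J hJ => ?_
  obtain ⟨c, hc⟩ : ∃ c, J.card = c + 1 :=
    ⟨J.card - 1, by have := Finset.card_pos.2 (Finset.mem_filter.1 hJ).2; omega⟩
  rw [hc, add_tsub_cancel_right, pow_succ, mul_neg_one, neg_smul]

/-- Shifting a truncated sum by c loses exactly the terms with c + d > D, which are the error terms.
-/
theorem sum_range_sub_shift_mem (S : Submodule R A) (f : ℕ → A) (c D : ℕ)
    (hf : ∀ d, D < c + d → f d ∈ S) :
    ∑ d ∈ Finset.range (D + 1), f d -
      ∑ e ∈ Finset.range (D + 1), (if c ≤ e then f (e - c) else 0) ∈ S := by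
  have h : ∑ e ∈ Finset.range (D + 1), (if c ≤ e then f (e - c) else 0) =
      ∑ d ∈ Finset.range (D + 1), if c + d ≤ D then f d else 0 := by
    rw [← Finset.sum_filter, ← Finset.sum_filter]
    refine Finset.sum_nbij' (fun e => e - c) (fun d => c + d) ?_ ?_ ?_ ?_ ?_ <;>
      simp +contextual
    all_goals omega
  rw [h, ← Finset.sum_sub_distrib]
  refine Submodule.sum_mem _ fun d _ => ?_
  split_ifs with hd
  · simp
  · simpa using hf d (not_le.1 hd)

/-- The product is rearranged by total degree: the master theorem kills degrees 1 to D, degree 0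
gives 1, and what the truncation leaves over consists of words longer than D. -/
theorem RightQuantum.one_sub_minorAlt_mul_sub_one_mem {a : Matrix (Fin r) (Fin r) A}
    (ha : RightQuantum κ a) (hq : q * κ = 1) (D : ℕ) :
    (1 - minorAlt q a) * ∑ d ∈ Finset.range (D + 1), symTrace κ a d - 1 ∈
      balancedSpan R a (D + 1) := by
  have hone : ∑ J : Finset (Fin r), ∑ e ∈ Finset.range (D + 1), (if J.card ≤ e then
      (-1 : ℤ) ^ J.card • (extCoeff q a J J * symTrace κ a (e - J.card)) else 0) = 1 := by
    rw [Finset.sum_comm, Finset.sum_range_succ', Finset.sum_eq_zero fun e _ =>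
      ha.master hq (Nat.succ_pos e), zero_add, Finset.sum_eq_single ∅]
    · simp [symTrace_zero, extCoeff_empty]
    · intro J _ hJ
      rw [if_neg]
      simpa using hJ
    · simp
  rw [one_sub_minorAlt, ← hone, Finset.sum_mul, ← Finset.sum_sub_distrib]
  refine Submodule.sum_mem _ fun J _ => ?_
  rw [Finset.mul_sum]
  simp only [smul_mul_assoc]
  refine sum_range_sub_shift_mem _
    (fun d => (-1 : ℤ) ^ J.card • (extCoeff q a J J * symTrace κ a d)) J.card D fun d hd => ?_
  exact zsmul_mem (balancedSpan_anti a hd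
    (mul_mem_balancedSpan (extCoeff_self_mem a J) (ha.symTrace_mem d))) _

/-- Telescoping: multiplying the approximate identity (1 - C) B = 1 on the left by C^n adds one more
term of the geometric series. -/
theorem sub_sum_pow_sub_mem {a : Matrix (Fin r) (Fin r) A} {B C : A} {D : ℕ}
    (hC : C ∈ balancedSpan R a 1) (hx : (1 - C) * B - 1 ∈ balancedSpan R a (D + 1)) (n : ℕ) :
    B - ∑ i ∈ Finset.range n, C ^ i - C ^ n * B ∈ balancedSpan R a (D + 1) := by
  induction n with
  | zero => simp
  | succ n ih =>
    have h2 := balancedSpan_anti a (Nat.le_add_left (D + 1) n)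
      (mul_mem_balancedSpan (pow_mem_balancedSpan hC n) hx)
    have h3 := Submodule.add_mem _ ih h2
    have h4 : B - ∑ i ∈ Finset.range (n + 1), C ^ i - C ^ (n + 1) * B =
        B - ∑ i ∈ Finset.range n, C ^ i - C ^ n * B + C ^ n * ((1 - C) * B - 1) := by
      rw [Finset.sum_range_succ, pow_succ]
      generalize C ^ n = Y
      generalize ∑ i ∈ Finset.range n, C ^ i = Z
      simp only [mul_sub, sub_mul, mul_one, one_mul, mul_assoc]
      abel
    rwa [h4]

/-- This is the usable form of 1/(1 - C) = ∑ tr S^d: under a functional that kills balanced words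
longer than D, the remainder C^(D+1) B disappears as well. -/
theorem RightQuantum.sum_pow_minorAlt {a : Matrix (Fin r) (Fin r) A} (ha : RightQuantum κ a)
    (hq : q * κ = 1) (f : A →ₗ[R] R) (D : ℕ)
    (hf : ∀ x ∈ balancedSpan R a (D + 1), f x = 0) :
    ∑ i ∈ Finset.range (D + 1), f (minorAlt q a ^ i) =
      ∑ d ∈ Finset.range (D + 1), f (symTrace κ a d) := by
  have hCm : minorAlt q a ∈ balancedSpan R a 1 := minorAlt_mem a
  have hBm : ∑ d ∈ Finset.range (D + 1), symTrace κ a d ∈ balancedSpan R a 0 :=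
    Submodule.sum_mem _ fun d _ => balancedSpan_anti a (Nat.zero_le d) (ha.symTrace_mem d)
  have h1 := hf _ (sub_sum_pow_sub_mem hCm (ha.one_sub_minorAlt_mul_sub_one_mem hq D) (D + 1))
  have h2 := hf _ (balancedSpan_anti a (Nat.le_add_right _ 0)
    (mul_mem_balancedSpan (pow_mem_balancedSpan hCm (D + 1)) hBm))
  rw [map_sub, h2, sub_zero, map_sub, sub_eq_zero, map_sum, map_sum] at h1
  exact h1.symm

end Words

end

/-! ### The operator algebra of the letters: locality, evaluation, and the deformed Burau matrix. -/

section

variable {k : ℕ}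

/-! ### The elementary operators on monomials -/

theorem mulVar_single (i : Fin k × Var) (e : ℤ) (α : Fin k × Var → ℤ) (c : Rq) :
    mulVar i e (AddMonoidAlgebra.single α c) = AddMonoidAlgebra.single (Pi.single i e + α) c := by
  rw [mulVar, LinearMap.mulLeft_apply, AddMonoidAlgebra.single_mul_single, one_mul]

theorem shiftVar_single (i : Fin k × Var) (e : ℤ) (α : Fin k × Var → ℤ) (c : Rq) :
    shiftVar i e (AddMonoidAlgebra.single α c) =
      AddMonoidAlgebra.single α (LaurentPolynomial.T (e * α i) * c) := by
  rw [shiftVar, AlgHom.toLinearMap_apply, AddMonoidAlgebra.lift_single]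
  simp [mul_comm]

theorem shiftVar_mul (i : Fin k × Var) (e : ℤ) (f g : LaurentPoly k) :
    shiftVar i e (f * g) = shiftVar i e f * shiftVar i e g := by
  simp [shiftVar]

theorem shiftVar_one (i : Fin k × Var) (e : ℤ) : shiftVar i e (1 : LaurentPoly k) = 1 := by
  simp [shiftVar]

theorem op_ext {P Q : Op k} (h : ∀ α, P (AddMonoidAlgebra.single α 1) =
    Q (AddMonoidAlgebra.single α 1)) : P = Q := by
  apply LinearMap.ext
  intro f
  induction f using AddMonoidAlgebra.induction_linear with
  | zero => simp
  | add f g hf hg => rw [map_add, map_add, hf, hg]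
  | single α c =>
    have : AddMonoidAlgebra.single α c = c • (AddMonoidAlgebra.single α 1 : LaurentPoly k) := by
      rw [AddMonoidAlgebra.smul_single, smul_eq_mul, mul_one]
    rw [this, map_smul, map_smul, h]

/-! ### Operators that only involve some of the letters -/

/-- The Laurent polynomials in the variables of the letters in `s`. -/
def polyOn (s : Set (Fin k)) : Submodule Rq (LaurentPoly k) :=
  Submodule.span Rq {f | ∃ α : Fin k × Var → ℤ, (∀ i, i.1 ∉ s → α i = 0) ∧
    AddMonoidAlgebra.single α 1 = f}

theorem single_mem_polyOn {s : Set (Fin k)} {α : Fin k × Var → ℤ} (h : ∀ i, i.1 ∉ s → α i = 0)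
    (c : Rq) : (AddMonoidAlgebra.single α c : LaurentPoly k) ∈ polyOn s := by
  have : AddMonoidAlgebra.single α c = c • (AddMonoidAlgebra.single α 1 : LaurentPoly k) := by
    rw [AddMonoidAlgebra.smul_single, smul_eq_mul, mul_one]
  rw [this]
  exact Submodule.smul_mem _ _ (Submodule.subset_span ⟨α, h, rfl⟩)

theorem one_mem_polyOn (s : Set (Fin k)) : (1 : LaurentPoly k) ∈ polyOn s :=
  single_mem_polyOn (fun _ _ => rfl) 1

theorem mul_mem_polyOn {s : Set (Fin k)} {f g : LaurentPoly k} (hf : f ∈ polyOn s)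
    (hg : g ∈ polyOn s) : f * g ∈ polyOn s := by
  have := Submodule.mul_mem_mul hf hg
  rw [polyOn, Submodule.span_mul_span] at this
  refine Submodule.span_mono ?_ this
  rintro _ ⟨_, ⟨α, hα, rfl⟩, _, ⟨β, hβ, rfl⟩, rfl⟩
  refine ⟨α + β, fun i hi => by simp [hα i hi, hβ i hi], ?_⟩
  simp [AddMonoidAlgebra.single_mul_single]

theorem polyOn_mono {s t : Set (Fin k)} (h : s ⊆ t) : polyOn s ≤ polyOn t :=
  Submodule.span_mono fun _ ⟨α, hα, hf⟩ => ⟨α, fun i hi => hα i fun hs => hi (h hs), hf⟩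

/-- The operators that only involve the letters in `s`. -/
def localOp (s : Set (Fin k)) : Subalgebra Rq (Op k) where
  -- The first condition is linearity over the polynomials in the other variables; the second keeps
  -- results within the variables of `s`. Both are needed for commutation and for the
  -- multiplicativity of the evaluation.
  carrier := {P | (∀ g ∈ polyOn sᶜ, ∀ f, P (g * f) = g * P f) ∧ ∀ f ∈ polyOn s, P f ∈ polyOn s}
  mul_mem' := by
    rintro P Q ⟨hP, hP'⟩ ⟨hQ, hQ'⟩
    refine ⟨fun g hg f => ?_, fun f hf => hP' _ (hQ' _ hf)⟩
    rw [Module.End.mul_apply, hQ g hg, hP g hg, Module.End.mul_apply]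
  add_mem' := by
    rintro P Q ⟨hP, hP'⟩ ⟨hQ, hQ'⟩
    refine ⟨fun g hg f => ?_, fun f hf => Submodule.add_mem _ (hP' _ hf) (hQ' _ hf)⟩
    rw [LinearMap.add_apply, hQ g hg, hP g hg, LinearMap.add_apply, mul_add]
  algebraMap_mem' c := by
    refine ⟨fun g _ f => ?_, fun f hf => ?_⟩
    · rw [Module.algebraMap_end_apply, Module.algebraMap_end_apply, mul_smul_comm]
    · rw [Module.algebraMap_end_apply]
      exact Submodule.smul_mem _ _ hf

theorem mem_localOp_of_single {s : Set (Fin k)} {P : Op k}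
    (h1 : ∀ α : Fin k × Var → ℤ, (∀ i, i.1 ∈ s → α i = 0) → ∀ f,
      P (AddMonoidAlgebra.single α 1 * f) = AddMonoidAlgebra.single α 1 * P f)
    (h2 : ∀ α : Fin k × Var → ℤ, (∀ i, i.1 ∉ s → α i = 0) →
      P (AddMonoidAlgebra.single α 1) ∈ polyOn s) : P ∈ localOp s := by
  refine ⟨fun g hg f => ?_, fun f hf => ?_⟩
  · refine Submodule.span_induction (p := fun g _ => P (g * f) = g * P f) ?_ ?_ ?_ ?_ hg
    · rintro _ ⟨α, hα, rfl⟩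
      exact h1 α (fun i hi => hα i fun h => h hi) f
    · simp
    · intro x y _ _ hx hy
      rw [add_mul, map_add, hx, hy, add_mul]
    · intro c x _ hx
      rw [smul_mul_assoc, map_smul, hx, smul_mul_assoc]
  · refine Submodule.span_induction (p := fun f _ => P f ∈ polyOn s) ?_ ?_ ?_ ?_ hf
    · rintro _ ⟨α, hα, rfl⟩
      exact h2 α hα
    · simp
    · intro x y _ _ hx hy
      rw [map_add]
      exact Submodule.add_mem _ hx hy
    · intro c x _ hx
      rw [map_smul]
      exact Submodule.smul_mem _ _ hx

theorem mulVar_mem_localOp (j : Fin k) (w : Var) (e : ℤ) : mulVar (j, w) e ∈ localOp {j} := by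
  refine mem_localOp_of_single (fun α _ f => ?_) fun α hα => ?_
  · rw [mulVar, LinearMap.mulLeft_apply, LinearMap.mulLeft_apply, mul_left_comm]
  · rw [mulVar_single]
    refine single_mem_polyOn (fun i hi => ?_) _
    have hij : i ≠ (j, w) := by
      rintro rfl
      exact hi rfl
    simp [hα i hi, hij]

theorem shiftVar_mem_localOp (j : Fin k) (w : Var) (e : ℤ) : shiftVar (j, w) e ∈ localOp {j} := by
  refine mem_localOp_of_single (fun α hα f => ?_) fun α hα => ?_
  · rw [shiftVar_mul, shiftVar_single, hα (j, w) rfl]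
    simp
  · rw [shiftVar_single]
    exact single_mem_polyOn hα _

open Classical in
theorem exists_split (s : Set (Fin k)) (α : Fin k × Var → ℤ) : ∃ β γ : Fin k × Var → ℤ,
    (∀ i, i.1 ∉ s → β i = 0) ∧ (∀ i, i.1 ∉ sᶜ → γ i = 0) ∧
      (AddMonoidAlgebra.single α 1 : LaurentPoly k) =
        AddMonoidAlgebra.single β 1 * AddMonoidAlgebra.single γ 1 := by
  refine ⟨fun i => if i.1 ∈ s then α i else 0, fun i => if i.1 ∈ s then 0 else α i,
    fun i hi => if_neg hi, fun i hi => if_pos (not_not.1 hi), ?_⟩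
  rw [AddMonoidAlgebra.single_mul_single, mul_one]
  congr 1
  funext i
  simp only [Pi.add_apply]
  split_ifs <;> simp

theorem localOp_mono {s t : Set (Fin k)} (h : s ⊆ t) : localOp s ≤ localOp t := by
  intro P hP
  refine mem_localOp_of_single (fun α hα f => hP.1 _ (single_mem_polyOn (fun i hi => hα i (h
    (not_not.1 hi))) 1) f) fun α hα => ?_
  obtain ⟨β, γ, hβ, hγ, hs⟩ := exists_split s α
  have hγt : (AddMonoidAlgebra.single γ 1 : LaurentPoly k) ∈ polyOn t := by
    refine single_mem_polyOn (fun i hi => ?_) 1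
    have h0 := hα i hi
    have hmul : α = β + γ := by
      rw [AddMonoidAlgebra.single_mul_single, mul_one] at hs
      exact (Finsupp.single_left_inj one_ne_zero).1 (congrArg AddMonoidAlgebra.coeff hs)
    have hb := hβ i fun his => hi (h his)
    rw [hmul, Pi.add_apply, hb, zero_add] at h0
    exact h0
  rw [hs, mul_comm, hP.1 _ (single_mem_polyOn hγ 1)]
  exact mul_mem_polyOn hγt (polyOn_mono h (hP.2 _ (single_mem_polyOn hβ 1)))

/-- A monomial splits into a part in the variables of `s` and a part outside. `P` affects only the
first and `Q` only the second, so either order gives the product of the two images. -/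
theorem commute_of_localOp {s t : Set (Fin k)} (hst : Disjoint s t) {P Q : Op k}
    (hP : P ∈ localOp s) (hQ : Q ∈ localOp t) : Commute P Q := by
  have hQ' := localOp_mono (Set.subset_compl_iff_disjoint_left.2 hst) hQ
  refine op_ext fun α => ?_
  obtain ⟨β, γ, hβ, hγ, hs⟩ := exists_split s α
  have hβm := single_mem_polyOn hβ (1 : Rq)
  have hγm := single_mem_polyOn hγ (1 : Rq)
  have hss : polyOn s ≤ polyOn sᶜᶜ := by rw [compl_compl]
  rw [Module.End.mul_apply, Module.End.mul_apply, hs, hQ'.1 _ (hss hβm), mul_comm,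
    hP.1 _ (hQ'.2 _ hγm), mul_comm (AddMonoidAlgebra.single β 1), hP.1 _ hγm,
    mul_comm (AddMonoidAlgebra.single γ 1), hQ'.1 _ (hss (hP.2 _ hβm)), mul_comm]

/-! ### Evaluation -/

/-- Evaluation of a Laurent polynomial at `u_j = 1`, `x_j = y_j = q ^ (N - 1)`. -/
def evPoint (k N : ℕ) : LaurentPoly k →+* Rq :=
  (LaurentPolynomial.eval₂ (RingHom.id Rq) (qUnit ^ ((N : ℤ) - 1))).comp
    (substZ k : LaurentPoly k →+* Rq[T;T⁻¹])

theorem evalN_eq_evPoint (N : ℕ) (P : Op k) : evalN N P = evPoint k N (P 1) := rfl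

theorem evPoint_smul (N : ℕ) (c : Rq) (f : LaurentPoly k) :
    evPoint k N (c • f) = c * evPoint k N f := by
  simp only [evPoint, RingHom.comp_apply, RingHom.coe_coe, map_smul]
  rw [LaurentPolynomial.smul_eq_C_mul, map_mul, LaurentPolynomial.eval₂_C, RingHom.id_apply]

theorem qUnit_zpow (e : ℤ) : ((qUnit ^ e : Rqˣ) : Rq) = LaurentPolynomial.T e := by
  have hnat : ∀ n : ℕ, ((qUnit ^ n : Rqˣ) : Rq) = LaurentPolynomial.T n := by
    intro n
    rw [Units.val_pow_eq_pow_val, show (qUnit : Rq) = LaurentPolynomial.T 1 from rfl,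
      LaurentPolynomial.T_pow, mul_one]
  obtain ⟨n, rfl | rfl⟩ := e.eq_nat_or_neg
  · rw [zpow_natCast, hnat]
  · rw [zpow_neg, zpow_natCast]
    have h1 := Units.mul_inv (qUnit ^ n)
    rw [hnat] at h1
    have h2 : (LaurentPolynomial.T (n : ℤ) : Rq) * LaurentPolynomial.T (-(n : ℤ)) = 1 := by
      rw [← LaurentPolynomial.T_add, add_neg_cancel, LaurentPolynomial.T_zero]
    exact (isUnit_iff_exists_inv.2 ⟨_, h1⟩).mul_left_cancel (h1.trans h2.symm)

theorem evPoint_single (N : ℕ) (α : Fin k × Var → ℤ) (c : Rq) :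
    evPoint k N (AddMonoidAlgebra.single α c) =
      c * LaurentPolynomial.T (((N : ℤ) - 1) * ∑ j, (α (j, Var.x) + α (j, Var.y))) := by
  have : AddMonoidAlgebra.single α c = c • (AddMonoidAlgebra.single α 1 : LaurentPoly k) := by
    rw [AddMonoidAlgebra.smul_single, smul_eq_mul, mul_one]
  rw [this, evPoint_smul]
  congr 1
  simp only [evPoint, RingHom.comp_apply, RingHom.coe_coe, substZ, AddMonoidAlgebra.lift_single,
    one_smul, MonoidHom.coe_mk, OneHom.coe_mk, toAdd_ofAdd]
  rw [LaurentPolynomial.eval₂_T, ← zpow_mul, qUnit_zpow]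

/-- The map `P ↦ 𝓔_N(P)` as a linear map. -/
def evalLin (k N : ℕ) : Op k →ₗ[Rq] Rq where
  toFun P := evalN N P
  map_add' P Q := by simp [evalN_eq_evPoint]
  map_smul' c P := by simp [evalN_eq_evPoint, evPoint_smul]

theorem evalLin_apply (N : ℕ) (P : Op k) : evalLin k N P = evPoint k N (P 1) := rfl

theorem evalLin_one (N : ℕ) : evalLin k N 1 = 1 := by
  simp [evalLin_apply]

/-- `P` treats `Q 1` as a constant. Hence the evaluations, which are not multiplicative in general,
are so on operators of disjoint sets of letters. -/
theorem mul_apply_one_of_localOp {s t : Set (Fin k)} (hst : Disjoint s t) {P Q : Op k}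
    (hP : P ∈ localOp s) (hQ : Q ∈ localOp t) : (P * Q) 1 = P 1 * Q 1 := by
  have h := hP.1 (Q 1) (polyOn_mono (Set.subset_compl_iff_disjoint_left.2 hst)
    (hQ.2 _ (one_mem_polyOn t))) 1
  rw [Module.End.mul_apply, mul_comm, ← h, mul_one]

theorem evalLin_mul {s t : Set (Fin k)} (hst : Disjoint s t) {P Q : Op k} (N : ℕ)
    (hP : P ∈ localOp s) (hQ : Q ∈ localOp t) :
    evalLin k N (P * Q) = evalLin k N P * evalLin k N Q := by
  rw [evalLin_apply, mul_apply_one_of_localOp hst hP hQ, map_mul]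
  rfl

theorem evalZ_mul {s t : Set (Fin k)} (hst : Disjoint s t) {P Q : Op k}
    (hP : P ∈ localOp s) (hQ : Q ∈ localOp t) : evalZ (P * Q) = evalZ P * evalZ Q := by
  rw [evalZ, mul_apply_one_of_localOp hst hP hQ, map_mul]
  rfl

end

section

variable {n k : ℕ}

/-! ### The operators of a single letter -/

theorem sub_mem_localOp {s : Set (Fin k)} {P Q : Op k} (hP : P ∈ localOp s) (hQ : Q ∈ localOp s) :
    P - Q ∈ localOp s :=
  ⟨fun g hg f => by rw [LinearMap.sub_apply, hP.1 g hg, hQ.1 g hg, LinearMap.sub_apply, mul_sub],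
    fun f hf => Submodule.sub_mem _ (hP.2 f hf) (hQ.2 f hf)⟩

theorem aPlus_mem (j : Fin k) : aPlus j ∈ localOp {j} :=
  mul_mem (sub_mem_localOp (mulVar_mem_localOp _ _ _)
    (mul_mem (mulVar_mem_localOp _ _ _) (shiftVar_mem_localOp _ _ _))) (shiftVar_mem_localOp _ _ _)

theorem bPlus_mem (j : Fin k) : bPlus j ∈ localOp {j} := mulVar_mem_localOp _ _ _

theorem cPlus_mem (j : Fin k) : cPlus j ∈ localOp {j} :=
  mul_mem (mul_mem (mulVar_mem_localOp _ _ _) (shiftVar_mem_localOp _ _ _))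
    (shiftVar_mem_localOp _ _ _)

theorem aMinus_mem (j : Fin k) : aMinus j ∈ localOp {j} :=
  mul_mem (mul_mem (sub_mem_localOp (shiftVar_mem_localOp _ _ _) (mulVar_mem_localOp _ _ _))
    (shiftVar_mem_localOp _ _ _)) (shiftVar_mem_localOp _ _ _)

theorem bMinus_mem (j : Fin k) : bMinus j ∈ localOp {j} := mulVar_mem_localOp _ _ _

theorem cMinus_mem (j : Fin k) : cMinus j ∈ localOp {j} :=
  mul_mem (mul_mem (mulVar_mem_localOp _ _ _) (shiftVar_mem_localOp _ _ _))
    (shiftVar_mem_localOp _ _ _)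

theorem sBlock_mem (p : Bool) (j : Fin k) (x y : Fin 2) : sBlock p j x y ∈ localOp {j} := by
  unfold sBlock
  cases p <;> fin_cases x <;> fin_cases y <;>
    simp [aPlus_mem, bPlus_mem, cPlus_mem, aMinus_mem, bMinus_mem, cMinus_mem]

theorem blockSum_mem (i : Fin n) (p : Bool) (j : Fin k) (x y : Fin (n + 1)) :
    blockSum i (sBlock p j) x y ∈ localOp {j} := by
  simp only [blockSum, Matrix.of_apply]
  split_ifs <;> first | exact sBlock_mem _ _ _ _ | exact one_mem _ | exact zero_mem _

theorem aPlus_single (j : Fin k) (α : Fin k × Var → ℤ) (c : Rq) :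
    aPlus j (AddMonoidAlgebra.single α c) =
      AddMonoidAlgebra.single (Pi.single (j, .u) 1 + α) (LaurentPolynomial.T (-α (j, .y)) * c) -
      AddMonoidAlgebra.single (Pi.single (j, .y) 1 + α)
        (LaurentPolynomial.T (-α (j, .x) - α (j, .y)) * c) := by
  simp only [aPlus, Module.End.mul_apply, LinearMap.sub_apply, shiftVar_single, mulVar_single,
    ← mul_assoc, ← LaurentPolynomial.T_add]
  congr 3
  · ring_nf
  · ring_nf

theorem bPlus_single (j : Fin k) (α : Fin k × Var → ℤ) (c : Rq) :
    bPlus j (AddMonoidAlgebra.single α c) =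
      AddMonoidAlgebra.single (Pi.single (j, .u) 2 + α) c := by
  simp only [bPlus, mulVar_single]

theorem cPlus_single (j : Fin k) (α : Fin k × Var → ℤ) (c : Rq) :
    cPlus j (AddMonoidAlgebra.single α c) = AddMonoidAlgebra.single (Pi.single (j, .x) 1 + α)
        (LaurentPolynomial.T (-2 * α (j, .y) - α (j, .u)) * c) := by
  simp only [cPlus, Module.End.mul_apply, shiftVar_single, mulVar_single,
    ← mul_assoc, ← LaurentPolynomial.T_add]
  congr 3
  ring

theorem aMinus_single (j : Fin k) (α : Fin k × Var → ℤ) (c : Rq) :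
    aMinus j (AddMonoidAlgebra.single α c) =
      AddMonoidAlgebra.single α
        (LaurentPolynomial.T (α (j, .y) - α (j, .x) + α (j, .u)) * c) -
      AddMonoidAlgebra.single (Pi.single (j, .x) (-1) + α)
        (LaurentPolynomial.T (-α (j, .x) + α (j, .u)) * c) := by
  simp only [aMinus, Module.End.mul_apply, LinearMap.sub_apply, shiftVar_single, mulVar_single,
    ← mul_assoc, ← LaurentPolynomial.T_add]
  congr 3
  · ring_nf
  · ring_nf

theorem cMinus_single (j : Fin k) (α : Fin k × Var → ℤ) (c : Rq) :
    cMinus j (AddMonoidAlgebra.single α c) = AddMonoidAlgebra.single (Pi.single (j, .y) (-1) + α)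
        (LaurentPolynomial.T (-α (j, .x) + α (j, .u)) * c) := by
  simp only [cMinus, Module.End.mul_apply, shiftVar_single, mulVar_single,
    ← mul_assoc, ← LaurentPolynomial.T_add]
  congr 3
  ring

/-- This and the next five relations are checked on monomials, where multiplications and shifts only
add exponents and powers of q. They contain the right-quantum relations of the blocks, and they
allow every word in the three operators of a letter to be reordered up to a power of q. -/
theorem aPlus_mul_bPlus (j : Fin k) : aPlus j * bPlus j = bPlus j * aPlus j := by
  refine op_ext fun α => ?_
  simp only [Module.End.mul_apply, map_sub, aPlus_single, bPlus_single]
  simp [add_left_comm]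

theorem bPlus_mul_cPlus (j : Fin k) : bPlus j * cPlus j =
    (LaurentPolynomial.T 2 : Rq) • (cPlus j * bPlus j) := by
  refine op_ext fun α => ?_
  simp only [Module.End.mul_apply, LinearMap.smul_apply, bPlus_single, cPlus_single,
    AddMonoidAlgebra.smul_single, smul_eq_mul, ← mul_assoc, ← LaurentPolynomial.T_add]
  rw [add_left_comm]
  congr 3
  simp
  ring

theorem aPlus_mul_cPlus (j : Fin k) : aPlus j * cPlus j =
    (LaurentPolynomial.T 1 : Rq) • (cPlus j * aPlus j) := by
  refine op_ext fun α => ?_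
  simp only [Module.End.mul_apply, LinearMap.smul_apply, map_sub, aPlus_single,
    cPlus_single, AddMonoidAlgebra.smul_single, smul_sub, smul_eq_mul, ← mul_assoc,
    ← LaurentPolynomial.T_add]
  rw [add_left_comm (Pi.single (j, Var.x) 1), add_left_comm (Pi.single (j, Var.x) 1)]
  congr 4
  · simp
    ring
  · simp
    ring

theorem aMinus_mul_bMinus (j : Fin k) : aMinus j * bMinus j =
    (LaurentPolynomial.T 2 : Rq) • (bMinus j * aMinus j) := by
  refine op_ext fun α => ?_
  simp only [show bMinus j = bPlus j from rfl, Module.End.mul_apply, LinearMap.smul_apply, map_sub,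
    aMinus_single, bPlus_single, AddMonoidAlgebra.smul_single, smul_sub, smul_eq_mul, ← mul_assoc,
    ← LaurentPolynomial.T_add]
  rw [add_left_comm (Pi.single (j, Var.x) (-1))]
  congr 4
  · simp
    ring
  · simp
    ring

theorem cMinus_mul_bMinus (j : Fin k) : cMinus j * bMinus j =
    (LaurentPolynomial.T 2 : Rq) • (bMinus j * cMinus j) := by
  refine op_ext fun α => ?_
  simp only [show bMinus j = bPlus j from rfl, Module.End.mul_apply, LinearMap.smul_apply,
    cMinus_single, bPlus_single, AddMonoidAlgebra.smul_single, smul_eq_mul, ← mul_assoc,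
    ← LaurentPolynomial.T_add]
  rw [add_left_comm (Pi.single (j, Var.y) (-1))]
  congr 3
  simp
  ring

theorem cMinus_mul_aMinus (j : Fin k) : cMinus j * aMinus j =
    (LaurentPolynomial.T 1 : Rq) • (aMinus j * cMinus j) := by
  refine op_ext fun α => ?_
  simp only [Module.End.mul_apply, LinearMap.smul_apply, map_sub,
    cMinus_single, aMinus_single, AddMonoidAlgebra.smul_single, smul_sub, smul_eq_mul, ← mul_assoc,
    ← LaurentPolynomial.T_add]
  rw [add_left_comm (Pi.single (j, Var.y) (-1)) (Pi.single (j, Var.x) (-1))]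
  congr 4
  · simp
    ring
  · simp
    ring

/-! ### Evaluation of ordered monomials in the operators of a letter -/

theorem T_mul_T (a b : ℤ) : (LaurentPolynomial.T a * LaurentPolynomial.T b : Rq) =
    LaurentPolynomial.T (a + b) := (LaurentPolynomial.T_add a b).symm

/-- The operator `a_+` on a Laurent polynomial of the form `x^t * f`, where `f` does not
involve `x`. -/
theorem aPlus_apply (j : Fin k) (f : LaurentPoly k) :
    aPlus j f = AddMonoidAlgebra.single (Pi.single (j, .u) 1) 1 * shiftVar (j, .y) (-1) f -
      AddMonoidAlgebra.single (Pi.single (j, .y) 1) 1 *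
        shiftVar (j, .x) (-1) (shiftVar (j, .y) (-1) f) := by
  simp [aPlus, Module.End.mul_apply, mulVar]

theorem aMinus_apply (j : Fin k) (f : LaurentPoly k) :
    aMinus j f = shiftVar (j, .y) 1 (shiftVar (j, .x) (-1) (shiftVar (j, .u) 1 f)) -
      AddMonoidAlgebra.single (Pi.single (j, .x) (-1)) 1 *
        shiftVar (j, .x) (-1) (shiftVar (j, .u) 1 f) := by
  simp [aMinus, Module.End.mul_apply, mulVar]

theorem shiftVar_prod (i : Fin k × Var) (e : ℤ) (m : ℕ) (f : ℕ → LaurentPoly k) :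
    shiftVar i e (∏ l ∈ Finset.range m, f l) = ∏ l ∈ Finset.range m, shiftVar i e (f l) := by
  induction m with
  | zero => simp [shiftVar_one]
  | succ m ih => rw [Finset.prod_range_succ, Finset.prod_range_succ, shiftVar_mul, ih]

theorem bPlus_pow_single (j : Fin k) (l : ℕ) (α : Fin k × Var → ℤ) (c : Rq) :
    (bPlus j ^ l) (AddMonoidAlgebra.single α c) =
      AddMonoidAlgebra.single (Pi.single (j, .u) (2 * (l : ℤ)) + α) c := by
  induction l with
  | zero => simp
  | succ l ih =>
    rw [pow_succ', Module.End.mul_apply, ih, bPlus_single, ← add_assoc, ← Pi.single_add]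
    congr 3
    push_cast
    ring

theorem cPlus_pow_one (j : Fin k) (t : ℕ) :
    (cPlus j ^ t) (1 : LaurentPoly k) = AddMonoidAlgebra.single (Pi.single (j, .x) (t : ℤ)) 1 := by
  induction t with
  | zero =>
    rw [pow_zero, Nat.cast_zero, Pi.single_zero]
    rfl
  | succ t ih =>
    rw [pow_succ', Module.End.mul_apply, ih, cPlus_single, ← Pi.single_add]
    simp [add_comm]

/-- The monomial in the variables of the letter `j` with the given exponents. -/
def letterMono (j : Fin k) (x y u : ℤ) (c : Rq) : LaurentPoly k :=
  AddMonoidAlgebra.single (Pi.single (j, .x) x + Pi.single (j, .y) y + Pi.single (j, .u) u) c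

theorem letterMono_mul (j : Fin k) (x y u x' y' u' : ℤ) (c c' : Rq) :
    letterMono j x y u c * letterMono j x' y' u' c' =
      letterMono j (x + x') (y + y') (u + u') (c * c') := by
  rw [letterMono, letterMono, letterMono, AddMonoidAlgebra.single_mul_single]
  congr 1
  simp only [Pi.single_add]
  abel

theorem shiftVar_letterMono (j : Fin k) (x y u e : ℤ) (c : Rq) (w : Var) :
    shiftVar (j, w) e (letterMono j x y u c) = letterMono j x y u
      (LaurentPolynomial.T (e * match w with | .x => x | .y => y | .u => u) * c) := by
  rw [letterMono, shiftVar_single]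
  cases w <;> simp [letterMono]

/-- Each application of a_+ puts one more q⁻¹ in front of y in the factors already present, by
τ_y⁻¹, and contributes a new factor u - q^(-t) y, where q^(-t) comes from τ_x⁻¹ acting on x^t. -/
theorem aPlus_apply_one (j : Fin k) (m l t : ℕ) :
    (aPlus j ^ m * (bPlus j ^ l * cPlus j ^ t)) 1 = letterMono j t 0 (2 * l) 1 *
      ∏ i ∈ Finset.range m, (letterMono j 0 0 1 1 -
        letterMono j 0 1 0 (LaurentPolynomial.T (-(t : ℤ) - i))) := by
  induction m with
  | zero =>
    rw [pow_zero, one_mul, Module.End.mul_apply, cPlus_pow_one, bPlus_pow_single]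
    simp [letterMono, add_comm]
  | succ m ih =>
    have hu : (AddMonoidAlgebra.single (Pi.single (j, .u) 1) 1 : LaurentPoly k) =
        letterMono j 0 0 1 1 := by simp [letterMono]
    have hy : (AddMonoidAlgebra.single (Pi.single (j, .y) 1) 1 : LaurentPoly k) =
        letterMono j 0 1 0 1 := by simp [letterMono]
    have hfac : ∀ i ∈ Finset.range m, shiftVar (j, Var.y) (-1) (letterMono j 0 0 1 1 -
        letterMono j 0 1 0 (LaurentPolynomial.T (-(t : ℤ) - i))) = letterMono j 0 0 1 1 -
        letterMono j 0 1 0 (LaurentPolynomial.T (-(t : ℤ) - (i + 1 : ℕ))) := by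
      intro i _
      rw [map_sub, shiftVar_letterMono, shiftVar_letterMono]
      simp only [T_mul_T, mul_zero, LaurentPolynomial.T_zero, one_mul]
      congr 3
      push_cast
      ring
    have hfac' : ∀ i ∈ Finset.range m, shiftVar (j, Var.x) (-1) (letterMono j 0 0 1 1 -
        letterMono j 0 1 0 (LaurentPolynomial.T (-(t : ℤ) - (i + 1 : ℕ)))) =
        letterMono j 0 0 1 1 -
        letterMono j 0 1 0 (LaurentPolynomial.T (-(t : ℤ) - (i + 1 : ℕ))) := by
      intro i _
      rw [map_sub, shiftVar_letterMono, shiftVar_letterMono]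
      simp
    rw [pow_succ', mul_assoc, Module.End.mul_apply, ih, aPlus_apply, hu, hy, shiftVar_mul,
      shiftVar_prod, Finset.prod_congr rfl hfac, shiftVar_mul, shiftVar_prod,
      Finset.prod_congr rfl hfac', Finset.prod_range_succ', shiftVar_letterMono,
      shiftVar_letterMono]
    have h1 : letterMono j (t : ℤ) 0 (2 * (l : ℤ)) (LaurentPolynomial.T (-1 * (t : ℤ)) *
        (LaurentPolynomial.T (-1 * 0) * 1)) = letterMono j t 0 (2 * l) 1 *
        letterMono j 0 0 0 (LaurentPolynomial.T (-(t : ℤ))) := by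
      rw [letterMono_mul]
      simp
    have h2 : letterMono j 0 1 0 (LaurentPolynomial.T (-(t : ℤ) - (0 : ℕ))) =
        letterMono j 0 1 0 1 * letterMono j 0 0 0 (LaurentPolynomial.T (-(t : ℤ))) := by
      rw [letterMono_mul]
      simp
    have h3 : letterMono j (t : ℤ) 0 (2 * (l : ℤ)) (LaurentPolynomial.T (-1 * 0) * 1) =
        letterMono j t 0 (2 * l) 1 := by simp
    simp only
    rw [h1, h2, h3]
    ring

/-- The shift τ_x⁻¹ turns 1 - q^i x⁻¹ into 1 - q^(i+1) x⁻¹, and τ_y - x⁻¹ contributes the new factor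
1 - x⁻¹; the other shifts act trivially because neither y nor u occurs. -/
theorem aMinus_pow_one (j : Fin k) (m : ℕ) : (aMinus j ^ m) 1 =
    ∏ i ∈ Finset.range m, (1 - letterMono j (-1) 0 0 (LaurentPolynomial.T (i : ℤ))) := by
  induction m with
  | zero => simp
  | succ m ih =>
    have hx : (AddMonoidAlgebra.single (Pi.single (j, .x) (-1)) 1 : LaurentPoly k) =
        letterMono j (-1) 0 0 1 := by simp [letterMono]
    have h1 : ∀ i ∈ Finset.range m, shiftVar (j, Var.u) 1
        (1 - letterMono j (-1) 0 0 (LaurentPolynomial.T (i : ℤ))) =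
        1 - letterMono j (-1) 0 0 (LaurentPolynomial.T (i : ℤ)) := by
      intro i _
      rw [map_sub, shiftVar_letterMono, shiftVar_one]
      simp
    have h2 : ∀ i ∈ Finset.range m, shiftVar (j, Var.x) (-1)
        (1 - letterMono j (-1) 0 0 (LaurentPolynomial.T (i : ℤ))) =
        1 - letterMono j (-1) 0 0 (LaurentPolynomial.T ((i + 1 : ℕ) : ℤ)) := by
      intro i _
      rw [map_sub, shiftVar_letterMono, shiftVar_one, T_mul_T]
      congr 3
      push_cast
      ring
    have h3 : ∀ i ∈ Finset.range m, shiftVar (j, Var.y) 1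
        (1 - letterMono j (-1) 0 0 (LaurentPolynomial.T ((i + 1 : ℕ) : ℤ))) =
        1 - letterMono j (-1) 0 0 (LaurentPolynomial.T ((i + 1 : ℕ) : ℤ)) := by
      intro i _
      rw [map_sub, shiftVar_letterMono, shiftVar_one]
      simp
    rw [pow_succ', Module.End.mul_apply, ih, aMinus_apply, hx, shiftVar_prod,
      Finset.prod_congr rfl h1, shiftVar_prod, Finset.prod_congr rfl h2, shiftVar_prod,
      Finset.prod_congr rfl h3, Finset.prod_range_succ']
    simp only [Nat.cast_zero, LaurentPolynomial.T_zero]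
    ring

theorem cMinus_apply (j : Fin k) (f : LaurentPoly k) : cMinus j f =
    letterMono j 0 (-1) 0 1 * shiftVar (j, .x) (-1) (shiftVar (j, .u) 1 f) := by
  simp [cMinus, Module.End.mul_apply, mulVar, letterMono]

/-- Each c_- shifts the index of every factor by one through τ_x⁻¹ and picks up q^(2l) from τ_u
acting on u^(2l). -/
theorem cMinus_apply_one (j : Fin k) (s l m : ℕ) :
    (cMinus j ^ s * (bMinus j ^ l * aMinus j ^ m)) 1 =
      letterMono j 0 (-s) (2 * l) (LaurentPolynomial.T (2 * l * s)) *
      ∏ i ∈ Finset.range m, (1 - letterMono j (-1) 0 0 (LaurentPolynomial.T ((s : ℤ) + i))) := by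
  induction s with
  | zero =>
    have hb : ∀ f : LaurentPoly k, (bMinus j ^ l) f = letterMono j 0 0 (2 * l) 1 * f := by
      intro f
      induction l with
      | zero => simp [letterMono, ← AddMonoidAlgebra.one_def]
      | succ l ih =>
        have : bMinus j ((bMinus j ^ l) f) = letterMono j 0 0 2 1 * (bMinus j ^ l) f := by
          simp [bMinus, mulVar, letterMono]
        rw [pow_succ', Module.End.mul_apply, this, ih, ← mul_assoc, letterMono_mul]
        congr 2
        · push_cast; ring
        · simp
    rw [pow_zero, one_mul, Module.End.mul_apply, aMinus_pow_one, hb]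
    simp
  | succ s ih =>
    have h1 : ∀ i ∈ Finset.range m, shiftVar (j, Var.u) 1
        (1 - letterMono j (-1) 0 0 (LaurentPolynomial.T ((s : ℤ) + i))) =
        1 - letterMono j (-1) 0 0 (LaurentPolynomial.T ((s : ℤ) + i)) := by
      intro i _
      rw [map_sub, shiftVar_letterMono, shiftVar_one]
      simp
    have h2 : ∀ i ∈ Finset.range m, shiftVar (j, Var.x) (-1)
        (1 - letterMono j (-1) 0 0 (LaurentPolynomial.T ((s : ℤ) + i))) =
        1 - letterMono j (-1) 0 0 (LaurentPolynomial.T (((s + 1 : ℕ) : ℤ) + i)) := by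
      intro i _
      rw [map_sub, shiftVar_letterMono, shiftVar_one, T_mul_T]
      congr 3
      push_cast
      ring
    rw [pow_succ', mul_assoc, Module.End.mul_apply, ih, cMinus_apply, shiftVar_mul, shiftVar_prod,
      Finset.prod_congr rfl h1, shiftVar_mul, shiftVar_prod, Finset.prod_congr rfl h2,
      shiftVar_letterMono, shiftVar_letterMono, ← mul_assoc, letterMono_mul]
    simp only [T_mul_T, one_mul]
    congr 2
    · simp
    · ring
    · push_cast
      congr 1
      ring

theorem evPoint_letterMono (N : ℕ) (j : Fin k) (x y u : ℤ) (c : Rq) :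
    evPoint k N (letterMono j x y u c) =
      c * LaurentPolynomial.T (((N : ℤ) - 1) * (x + y)) := by
  rw [letterMono, evPoint_single, Finset.sum_eq_single j]
  · simp
  · intro i _ hi
    simp [hi]
  · simp

/-- The value of an ordered monomial in the operators of a positive letter. -/
theorem evalLin_plus (N : ℕ) (j : Fin k) (m l t : ℕ) :
    evalLin k N (aPlus j ^ m * (bPlus j ^ l * cPlus j ^ t)) =
      LaurentPolynomial.T (((N : ℤ) - 1) * t) *
        ∏ i ∈ Finset.range m, (1 - LaurentPolynomial.T ((N : ℤ) - 1 - t - i)) := by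
  rw [evalLin_apply, aPlus_apply_one, map_mul, map_prod, evPoint_letterMono, add_zero, one_mul]
  congr 1
  refine Finset.prod_congr rfl fun i _ => ?_
  rw [map_sub, evPoint_letterMono, evPoint_letterMono, T_mul_T]
  simp only [add_zero, mul_zero, LaurentPolynomial.T_zero, mul_one]
  congr 2
  ring

/-- The value of an ordered monomial in the operators of a negative letter. -/
theorem evalLin_minus (N : ℕ) (j : Fin k) (s l m : ℕ) :
    evalLin k N (cMinus j ^ s * (bMinus j ^ l * aMinus j ^ m)) =
      LaurentPolynomial.T (2 * l * s - ((N : ℤ) - 1) * s) *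
        ∏ i ∈ Finset.range m, (1 - LaurentPolynomial.T ((s : ℤ) + i - ((N : ℤ) - 1))) := by
  rw [evalLin_apply, cMinus_apply_one, map_mul, map_prod, evPoint_letterMono, T_mul_T]
  congr 1
  · congr 1
    ring
  refine Finset.prod_congr rfl fun i _ => ?_
  rw [map_sub, evPoint_letterMono, map_one, T_mul_T]
  congr 2
  ring

end

section

variable {n k : ℕ}

/-! ### Right-quantum block sums -/

section BlockSum

variable {R : Type*} [CommRing R] {A : Type*} [Ring A] [Algebra R A] {κ : R}

theorem blockSum_castSucc_castSucc (i : Fin n) (S : Matrix (Fin 2) (Fin 2) A) :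
    blockSum i S i.castSucc i.castSucc = S 0 0 := by simp [blockSum]

theorem blockSum_castSucc_succ (i : Fin n) (S : Matrix (Fin 2) (Fin 2) A) :
    blockSum i S i.castSucc i.succ = S 0 1 := by
  simp [blockSum, (Fin.castSucc_lt_succ (i := i)).ne']

theorem blockSum_succ_castSucc (i : Fin n) (S : Matrix (Fin 2) (Fin 2) A) :
    blockSum i S i.succ i.castSucc = S 1 0 := by
  simp [blockSum, (Fin.castSucc_lt_succ (i := i)).ne']

theorem blockSum_succ_succ (i : Fin n) (S : Matrix (Fin 2) (Fin 2) A) :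
    blockSum i S i.succ i.succ = S 1 1 := by
  simp [blockSum, (Fin.castSucc_lt_succ (i := i)).ne']

theorem blockSum_castSucc_of_ne (i : Fin n) (S : Matrix (Fin 2) (Fin 2) A) {c : Fin (n + 1)}
    (h : c ≠ i.castSucc) (h' : c ≠ i.succ) : blockSum i S i.castSucc c = 0 := by
  simp [blockSum, h, h']

theorem blockSum_succ_of_ne (i : Fin n) (S : Matrix (Fin 2) (Fin 2) A) {c : Fin (n + 1)}
    (h : c ≠ i.castSucc) (h' : c ≠ i.succ) : blockSum i S i.succ c = 0 := by
  simp [blockSum, h, h', (Fin.castSucc_lt_succ (i := i)).ne']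

theorem blockSum_of_ne (i : Fin n) (S : Matrix (Fin 2) (Fin 2) A) {p : Fin (n + 1)}
    (h : p ≠ i.castSucc) (h' : p ≠ i.succ) (c : Fin (n + 1)) :
    blockSum i S p c = if p = c then 1 else 0 := by
  simp [blockSum, h, h']

/-- Needed when an identity row x lies above a row p in the cross relation: row x is non-zero only
in column x, and then the entries of row p to the left of x have to vanish. The next lemma is the
mirror case. -/
theorem blockSum_eq_zero_of_lt_left (i : Fin n) (S : Matrix (Fin 2) (Fin 2) A)
    {p x c : Fin (n + 1)} (h : x ≠ i.castSucc) (h' : x ≠ i.succ) (hx : x < p) (hc : c < x) :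
    blockSum i S p c = 0 := by
  by_cases h1 : p = i.castSucc
  · subst h1
    exact blockSum_castSucc_of_ne _ _ (hc.trans hx).ne
      ((hc.trans hx).trans Fin.castSucc_lt_succ).ne
  · by_cases h2 : p = i.succ
    · subst h2
      have hxi : x < i.castSucc := by
        rw [Fin.lt_def] at hx ⊢
        rw [Ne, Fin.ext_iff] at h h'
        simp at *
        omega
      exact blockSum_succ_of_ne _ _ (hc.trans hxi).ne (hc.trans hx).ne
    · rw [blockSum_of_ne _ _ h1 h2, if_neg (hc.trans hx).ne']

theorem blockSum_eq_zero_of_lt_right (i : Fin n) (S : Matrix (Fin 2) (Fin 2) A)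
    {p x c : Fin (n + 1)} (h' : x ≠ i.succ) (hx : p < x) (hc : x < c) :
    blockSum i S p c = 0 := by
  by_cases h1 : p = i.castSucc
  · subst h1
    have hxi : i.succ < x := by
      rw [Fin.lt_def] at hx ⊢
      rw [Ne, Fin.ext_iff] at h'
      simp at *
      omega
    exact blockSum_castSucc_of_ne _ _ (hx.trans hc).ne' (hxi.trans hc).ne'
  · by_cases h2 : p = i.succ
    · subst h2
      exact blockSum_succ_of_ne _ _ ((Fin.castSucc_lt_succ.trans hx).trans hc).ne'
        (hx.trans hc).ne'
    · rw [blockSum_of_ne _ _ h1 h2, if_neg (hx.trans hc).ne]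

/-- Two block rows reduce to the relations of `S`. A relation with an identity row is trivial or
reduces to the vanishing of the entries on the far side of that row's diagonal entry. -/
theorem RightQuantum.blockSum {S : Matrix (Fin 2) (Fin 2) A} (hS : RightQuantum κ S) (i : Fin n) :
    RightQuantum κ (blockSum i S) := by
  have hblock : ∀ x y : Fin (n + 1), x < y → (x = i.castSucc ∨ x = i.succ) →
      (y = i.castSucc ∨ y = i.succ) → x = i.castSucc ∧ y = i.succ := by
    rintro x y hxy (rfl | rfl) (rfl | rfl)
    · exact absurd hxy (lt_irrefl _)
    · exact ⟨rfl, rfl⟩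
    · exact absurd hxy Fin.castSucc_lt_succ.not_gt
    · exact absurd hxy (lt_irrefl _)
  constructor
  · intro x y c hxy
    by_cases hx : x = i.castSucc ∨ x = i.succ
    · by_cases hy : y = i.castSucc ∨ y = i.succ
      · obtain ⟨rfl, rfl⟩ := hblock x y hxy hx hy
        by_cases h1 : c = i.castSucc
        · subst h1
          rw [blockSum_castSucc_castSucc, blockSum_succ_castSucc]
          exact hS.col 0 1 0 Fin.zero_lt_one
        · by_cases h2 : c = i.succ
          · subst h2
            rw [blockSum_castSucc_succ, blockSum_succ_succ]
            exact hS.col 0 1 1 Fin.zero_lt_one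
          · rw [blockSum_succ_of_ne _ _ h1 h2, blockSum_castSucc_of_ne _ _ h1 h2]
            simp
      · push Not at hy
        rw [blockSum_of_ne _ _ hy.1 hy.2]
        split_ifs with h
        · subst h
          have : ColoredJones.blockSum i S x y = 0 := by
            rcases hx with rfl | rfl
            · exact blockSum_castSucc_of_ne _ _ hy.1 hy.2
            · exact blockSum_succ_of_ne _ _ hy.1 hy.2
          rw [this]
          simp
        · simp
    · push Not at hx
      rw [blockSum_of_ne i S hx.1 hx.2]
      split_ifs with h
      · subst h
        have : ColoredJones.blockSum i S y x = 0 := by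
          by_cases hy1 : y = i.castSucc
          · subst hy1
            exact blockSum_castSucc_of_ne _ _ hx.1 hx.2
          · by_cases hy2 : y = i.succ
            · subst hy2
              exact blockSum_succ_of_ne _ _ hx.1 hx.2
            · rw [blockSum_of_ne _ _ hy1 hy2, if_neg hxy.ne']
        rw [this]
        simp
      · simp
  · intro x y c c' hxy hc
    by_cases hx : x = i.castSucc ∨ x = i.succ
    · by_cases hy : y = i.castSucc ∨ y = i.succ
      · obtain ⟨rfl, rfl⟩ := hblock x y hxy hx hy
        by_cases h1 : c = i.castSucc ∨ c = i.succ
        · by_cases h2 : c' = i.castSucc ∨ c' = i.succ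
          · obtain ⟨rfl, rfl⟩ := hblock c c' hc h1 h2
            rw [blockSum_castSucc_castSucc, blockSum_succ_castSucc, blockSum_castSucc_succ,
              blockSum_succ_succ]
            exact hS.cross 0 1 0 1 Fin.zero_lt_one Fin.zero_lt_one
          · push Not at h2
            rw [blockSum_castSucc_of_ne _ _ h2.1 h2.2, blockSum_succ_of_ne _ _ h2.1 h2.2]
            simp
        · push Not at h1
          rw [blockSum_castSucc_of_ne _ _ h1.1 h1.2, blockSum_succ_of_ne _ _ h1.1 h1.2]
          simp
      · push Not at hy
        rw [blockSum_of_ne _ _ hy.1 hy.2, blockSum_of_ne _ _ hy.1 hy.2]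
        by_cases h1 : y = c
        · subst h1
          rw [blockSum_eq_zero_of_lt_right i S hy.2 hxy hc, if_neg hc.ne]
          simp
        · simp [h1]
    · push Not at hx
      rw [blockSum_of_ne i S hx.1 hx.2, blockSum_of_ne i S hx.1 hx.2]
      by_cases h1 : x = c'
      · subst h1
        rw [blockSum_eq_zero_of_lt_left i S hx.1 hx.2 hxy hc, if_neg hc.ne']
        simp
      · simp [h1]

end BlockSum

/-- The inverse of the deformation parameter. -/
def qInv : Rq := LaurentPolynomial.T (-1)

theorem q_mul_qInv : (LaurentPolynomial.T 1 : Rq) * qInv = 1 := by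
  rw [qInv, T_mul_T, add_neg_cancel, LaurentPolynomial.T_zero]

theorem eq_qInv_smul {P Q : Op k} (h : P = (LaurentPolynomial.T 1 : Rq) • Q) :
    Q = qInv • P := by
  rw [h, smul_smul, mul_comm, q_mul_qInv, one_smul]

/-- Because of the zero entry in each block, one column relation is trivial, the other is
q-commutation of a and c, and the cross relation is the q²-commutation of b and c. -/
theorem rightQuantum_sBlock (p : Bool) (j : Fin k) : RightQuantum qInv (sBlock p j) := by
  have h01 : ∀ x y : Fin 2, x < y → x = 0 ∧ y = 1 := by decide
  have h2 : qInv * LaurentPolynomial.T 2 = (LaurentPolynomial.T 1 : Rq) := by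
    rw [qInv, T_mul_T]; rfl
  have h3 : qInv * LaurentPolynomial.T 1 = (1 : Rq) := by rw [mul_comm, q_mul_qInv]
  cases p
  · have e00 : sBlock false j 0 0 = 0 := rfl
    have e01 : sBlock false j 0 1 = cMinus j := rfl
    have e10 : sBlock false j 1 0 = bMinus j := rfl
    have e11 : sBlock false j 1 1 = aMinus j := rfl
    constructor
    · intro x y c hxy
      obtain ⟨rfl, rfl⟩ := h01 x y hxy
      fin_cases c
      · simp [e00, e10]
      · simp only [Fin.mk_one, e01, e11]
        exact eq_qInv_smul (cMinus_mul_aMinus j)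
    · intro x y c c' hxy hc
      obtain ⟨rfl, rfl⟩ := h01 x y hxy
      obtain ⟨rfl, rfl⟩ := h01 c c' hc
      simp only [e00, e01, e10, e11, zero_mul, mul_zero, smul_zero, add_zero, zero_add]
      rw [cMinus_mul_bMinus, smul_smul, smul_smul, mul_assoc, h2, h3, one_smul]
  · have e00 : sBlock true j 0 0 = aPlus j := rfl
    have e01 : sBlock true j 0 1 = bPlus j := rfl
    have e10 : sBlock true j 1 0 = cPlus j := rfl
    have e11 : sBlock true j 1 1 = 0 := rfl
    constructor
    · intro x y c hxy
      obtain ⟨rfl, rfl⟩ := h01 x y hxy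
      fin_cases c
      · simp only [Fin.zero_eta, e00, e10]
        exact eq_qInv_smul (aPlus_mul_cPlus j)
      · simp [e01, e11]
    · intro x y c c' hxy hc
      obtain ⟨rfl, rfl⟩ := h01 x y hxy
      obtain ⟨rfl, rfl⟩ := h01 c c' hc
      simp only [e00, e01, e10, e11, zero_mul, mul_zero, smul_zero, add_zero, zero_add]
      rw [bPlus_mul_cPlus, smul_smul, smul_smul, mul_assoc, h2, h3, one_smul]

/-! ### Products over lists of letters -/

/-- The factor of the deformed Burau matrix for the letter number `j`. -/
def letterMatrix (γ : BraidWord n k) (j : Fin k) : Matrix (Fin (n + 1)) (Fin (n + 1)) (Op k) :=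
  blockSum (γ j).1 (sBlock (γ j).2 j)

/-- The product of the factors of the deformed Burau matrix over a list of letters. -/
def rhoList (γ : BraidWord n k) (l : List (Fin k)) : Matrix (Fin (n + 1)) (Fin (n + 1)) (Op k) :=
  (l.map (letterMatrix γ)).prod

theorem rho_eq_rhoList (γ : BraidWord n k) : rho γ = rhoList γ (List.finRange k) := by
  rw [rho, rhoList, ← List.ofFn_eq_map]
  rfl

theorem rhoList_cons (γ : BraidWord n k) (j : Fin k) (l : List (Fin k)) :
    rhoList γ (j :: l) = letterMatrix γ j * rhoList γ l := by
  simp [rhoList]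

theorem letterMatrix_mem (γ : BraidWord n k) (j : Fin k) (x y : Fin (n + 1)) :
    letterMatrix γ j x y ∈ localOp {j} := blockSum_mem _ _ _ _ _

theorem rhoList_mem (γ : BraidWord n k) (l : List (Fin k)) (x y : Fin (n + 1)) :
    rhoList γ l x y ∈ localOp {j | j ∈ l} := by
  induction l generalizing x y with
  | nil =>
    rw [rhoList, List.map_nil, List.prod_nil, Matrix.one_apply]
    split_ifs
    · exact one_mem _
    · exact zero_mem _
  | cons j l ih =>
    rw [rhoList_cons, Matrix.mul_apply]
    refine sum_mem fun z _ => mul_mem ?_ ?_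
    · exact localOp_mono (by simp) (letterMatrix_mem γ j x z)
    · exact localOp_mono (fun _ h => List.mem_cons_of_mem _ h) (ih z y)

theorem disjoint_letter {j : Fin k} {l : List (Fin k)} (h : (j :: l).Nodup) :
    Disjoint ({j} : Set (Fin k)) {i | i ∈ l} :=
  Set.disjoint_singleton_left.2 (List.nodup_cons.1 h).1

theorem rightQuantum_letterMatrix (γ : BraidWord n k) (j : Fin k) :
    RightQuantum qInv (letterMatrix γ j) := (rightQuantum_sBlock _ _).blockSum _

theorem rightQuantum_rhoList (γ : BraidWord n k) {l : List (Fin k)} (hl : l.Nodup) :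
    RightQuantum qInv (rhoList γ l) := by
  induction l with
  | nil => exact RightQuantum.one
  | cons j l ih =>
    rw [rhoList_cons]
    exact (rightQuantum_letterMatrix γ j).mul (ih (List.nodup_cons.1 hl).2) fun x y z w =>
      commute_of_localOp (disjoint_letter hl) (letterMatrix_mem γ j x y) (rhoList_mem γ l z w)

theorem RightQuantum.symCoeff_mem_subalgebra {R : Type*} [CommRing R] {A : Type*} [Ring A]
    [Algebra R A] {κ : R} {r : ℕ} {a : Matrix (Fin r) (Fin r) A} (ha : RightQuantum κ a)
    {S : Subalgebra R A} (hS : ∀ x y, a x y ∈ S) (m m' : Fin r → ℕ) : symCoeff κ a m m' ∈ S := by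
  induction m using ordInduction generalizing m' with
  | h0 =>
    rw [symCoeff_zero, Pi.single_apply]
    split_ifs
    · exact one_mem _
    · exact zero_mem _
  | hs m i hi ih =>
    rw [ha.symCoeff_add_single i m hi, rowOp_apply]
    refine sum_mem fun j _ => mul_mem (hS i j) ?_
    rw [varOp_apply]
    split_ifs
    · exact S.smul_mem (ih _) _
    · exact zero_mem _

/-- The evaluated coefficients of the action of the product over the list `l` on the quantum
symmetric algebra. -/
def numCoeff (N : ℕ) (γ : BraidWord n k) (l : List (Fin k)) (m m' : Fin (n + 1) → ℕ) : Rq :=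
  evalLin k N (symCoeff qInv (rhoList γ l) m m')

theorem numCoeff_nil (N : ℕ) (γ : BraidWord n k) (m m' : Fin (n + 1) → ℕ) :
    numCoeff N γ [] m m' = if m = m' then 1 else 0 := by
  have h : ∀ m : Fin (n + 1) → ℕ,
      symCoeff qInv (1 : Matrix (Fin (n + 1)) (Fin (n + 1)) (Op k)) m = Pi.single m 1 := by
    intro m
    induction m using ordInduction with
    | h0 => exact symCoeff_zero _
    | hs m i hi ih =>
      rw [RightQuantum.one.symCoeff_add_single i m hi, ih]
      funext m'
      rw [rowOp_apply, Finset.sum_eq_single i]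
      · rw [Matrix.one_apply_eq, one_mul, varOp_single, lowerSum_eq_zero hi, pow_zero, one_smul]
      · intro j _ hj
        rw [Matrix.one_apply_ne hj.symm, zero_mul]
      · simp
  rw [numCoeff, rhoList, List.map_nil, List.prod_nil, h, Pi.single_apply]
  simp only [eq_comm (a := m')]
  split_ifs
  · exact evalLin_one N
  · exact map_zero _

/-- Functoriality on the symmetric algebra combined with multiplicativity of the evaluation on
disjoint letters: after evaluation the product of operator matrices acts as a product of scalar
matrices. -/
theorem numCoeff_cons (N : ℕ) (γ : BraidWord n k) {j : Fin k} {l : List (Fin k)}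
    (hl : (j :: l).Nodup) (m m' : Fin (n + 1) → ℕ) :
    numCoeff N γ (j :: l) m m' = ∑ m₁ ∈ Finset.piAntidiag Finset.univ (∑ p, m p),
      evalLin k N (symCoeff qInv (letterMatrix γ j) m m₁) * numCoeff N γ l m₁ m' := by
  have hj := rightQuantum_letterMatrix γ j
  have hR := rightQuantum_rhoList γ (List.nodup_cons.1 hl).2
  have hd := disjoint_letter hl
  have hmem := fun m m' => hj.symCoeff_mem_subalgebra (letterMatrix_mem γ j) m m'
  rw [numCoeff, rhoList_cons, hj.symCoeff_mul hR (fun x y z w => commute_of_localOp hd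
    (letterMatrix_mem γ j x y) (rhoList_mem γ l z w)) m m' (fun m m' x y => commute_of_localOp hd
    (hmem m m') (rhoList_mem γ l x y)), map_sum]
  exact Finset.sum_congr rfl fun m₁ _ => evalLin_mul hd N (hmem m m₁)
    (hR.symCoeff_mem_subalgebra (rhoList_mem γ l) m₁ m')

/-! ### Restriction and scaling -/

section Restrict

variable {R : Type*} [CommRing R] {A : Type*} [Ring A] [Algebra R A] {κ : R} {r : ℕ}

/-- Once X_0 has been produced it never disappears, so column 0 cannot contribute to a target
monomial without X_0; row 0 is absent because the source has no X_0. -/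
theorem RightQuantum.symCoeff_submatrix_succ {a : Matrix (Fin (r + 1)) (Fin (r + 1)) A}
    (ha : RightQuantum κ a) (m m' : Fin r → ℕ) :
    symCoeff κ (a.submatrix Fin.succ Fin.succ) m m' =
      symCoeff κ a (Fin.cons 0 m : Fin (r + 1) → ℕ) (Fin.cons 0 m' : Fin (r + 1) → ℕ) := by
  have ha' := ha.submatrix (Fin.strictMono_succ (n := r))
  have hadd : ∀ (m : Fin r → ℕ) (i : Fin r), (Fin.cons 0 (m + Pi.single i 1) : Fin (r + 1) → ℕ) =
      (Fin.cons 0 m : Fin (r + 1) → ℕ) + Pi.single i.succ 1 := by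
    intro m i
    funext p
    refine Fin.cases ?_ (fun p => ?_) p
    · simp
    · by_cases hp : p = i
      · subst hp; simp
      · simp [hp]
  have hsub : ∀ (m : Fin r → ℕ) (i : Fin r), (Fin.cons 0 (m - Pi.single i 1) : Fin (r + 1) → ℕ) =
      (Fin.cons 0 m : Fin (r + 1) → ℕ) - Pi.single i.succ 1 := by
    intro m i
    funext p
    refine Fin.cases ?_ (fun p => ?_) p
    · simp
    · by_cases hp : p = i
      · subst hp; simp
      · simp [hp]
  have hcons0 : (Fin.cons 0 0 : Fin (r + 1) → ℕ) = 0 := by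
    funext p
    refine Fin.cases ?_ (fun p => ?_) p <;> simp
  induction m using ordInduction generalizing m' with
  | h0 =>
    rw [hcons0, symCoeff_zero, symCoeff_zero, Pi.single_apply, Pi.single_apply]
    congr 1
    rw [← hcons0, Fin.cons_right_injective (α := fun _ => ℕ) 0 |>.eq_iff]
  | hs m i hi ih =>
    rw [ha'.symCoeff_add_single i m hi, hadd, ha.symCoeff_add_single i.succ _ ?_, rowOp_apply,
      rowOp_apply, Fin.sum_univ_succ]
    · rw [varOp_apply (j := (0 : Fin (r + 1))), if_neg (by simp), mul_zero, zero_add]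
      refine Finset.sum_congr rfl fun j _ => ?_
      rw [Matrix.submatrix_apply, varOp_apply, varOp_apply, ih, Fin.cons_succ, ← hsub,
        lowerSum_succ_index]
      simp
      rfl
    · intro p
      refine Fin.cases (fun _ => rfl) (fun p hp => ?_) p
      rw [Fin.cons_succ]
      exact hi p (Fin.succ_lt_succ_iff.1 hp)

theorem RightQuantum.symCoeff_smul {a : Matrix (Fin r) (Fin r) A} (ha : RightQuantum κ a) (t : R)
    (m m' : Fin r → ℕ) : symCoeff κ (t • a) m m' = t ^ (∑ p, m p) • symCoeff κ a m m' := by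
  induction m using ordInduction generalizing m' with
  | h0 => simp [symCoeff_zero]
  | hs m i hi ih =>
    rw [(ha.smul t).symCoeff_add_single i m hi, ha.symCoeff_add_single i m hi, rowOp_apply,
      rowOp_apply, Finset.smul_sum]
    refine Finset.sum_congr rfl fun j _ => ?_
    rw [varOp_apply, varOp_apply]
    split_ifs
    · rw [ih, Matrix.smul_apply, smul_mul_assoc, mul_smul_comm, mul_smul_comm, mul_smul_comm,
        smul_smul, smul_smul, smul_smul]
      congr 1
      simp only [Pi.add_apply, Finset.sum_add_distrib, Finset.sum_pi_single', Finset.mem_univ,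
        if_true, pow_succ]
      ring
    · simp

end Restrict

end

/-! ### Vanishing of the evaluation on long balanced words when the closure is a knot. -/

section

variable {n k : ℕ}

/-! ### Vanishing of the evaluation on words -/

/-- The factor with index N - 1 - t is 1 - q⁰. The same happens for the negative letter below, with
s in place of t. -/
theorem evalLin_plus_eq_zero {N : ℕ} (j : Fin k) {m l t : ℕ} (ht : t < N) (hm : N ≤ t + m) :
    evalLin k N (aPlus j ^ m * (bPlus j ^ l * cPlus j ^ t)) = 0 := by
  rw [evalLin_plus, Finset.prod_eq_zero (Finset.mem_range.2 (show N - 1 - t < m by omega)),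
    mul_zero]
  rw [show (N : ℤ) - 1 - t - (N - 1 - t : ℕ) = 0 by omega, LaurentPolynomial.T_zero, sub_self]

theorem evalLin_minus_eq_zero {N : ℕ} (j : Fin k) {s l m : ℕ} (hs : s < N) (hm : N ≤ s + m) :
    evalLin k N (cMinus j ^ s * (bMinus j ^ l * aMinus j ^ m)) = 0 := by
  rw [evalLin_minus, Finset.prod_eq_zero (Finset.mem_range.2 (show N - 1 - s < m by omega)),
    mul_zero]
  rw [show (s : ℤ) + (N - 1 - s : ℕ) - (N - 1) = 0 by omega, LaurentPolynomial.T_zero, sub_self]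

/-- `P` is an integral power of `q` times `Q`. -/
def QAssoc (P Q : Op k) : Prop := ∃ e : ℤ, P = (LaurentPolynomial.T e : Rq) • Q

theorem QAssoc.refl (P : Op k) : QAssoc P P := ⟨0, by simp⟩

theorem QAssoc.symm {P Q : Op k} (h : QAssoc P Q) : QAssoc Q P := by
  obtain ⟨e, rfl⟩ := h
  exact ⟨-e, by rw [smul_smul, T_mul_T, neg_add_cancel, LaurentPolynomial.T_zero, one_smul]⟩

theorem QAssoc.trans {P Q S : Op k} (h : QAssoc P Q) (h' : QAssoc Q S) : QAssoc P S := by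
  obtain ⟨e, rfl⟩ := h
  obtain ⟨e', rfl⟩ := h'
  exact ⟨e + e', by rw [smul_smul, T_mul_T]⟩

theorem QAssoc.mul {P Q P' Q' : Op k} (h : QAssoc P Q) (h' : QAssoc P' Q') :
    QAssoc (P * P') (Q * Q') := by
  obtain ⟨e, rfl⟩ := h
  obtain ⟨e', rfl⟩ := h'
  exact ⟨e + e', by rw [smul_mul_smul_comm, T_mul_T]⟩

theorem QAssoc.mul_pow {P Q : Op k} (h : QAssoc (P * Q) (Q * P)) (m : ℕ) :
    QAssoc (P * Q ^ m) (Q ^ m * P) := by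
  induction m with
  | zero => simpa using QAssoc.refl P
  | succ m ih =>
    rw [pow_succ, ← mul_assoc, mul_assoc (Q ^ m)]
    exact (ih.mul (.refl Q)).trans (by rw [mul_assoc]; exact (QAssoc.refl _).mul h)

/-- Multiplying an ordered monomial on the left by its last factor. -/
theorem QAssoc.mul_last {P Q S : Op k} (hSP : QAssoc (S * P) (P * S))
    (hSQ : QAssoc (S * Q) (Q * S)) (x y z : ℕ) :
    QAssoc (S * (P ^ x * (Q ^ y * S ^ z))) (P ^ x * (Q ^ y * S ^ (z + 1))) := by
  rw [← mul_assoc]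
  refine ((hSP.mul_pow x).mul (.refl _)).trans ?_
  rw [mul_assoc]
  refine (QAssoc.refl _).mul ?_
  rw [← mul_assoc]
  refine ((hSQ.mul_pow y).mul (.refl _)).trans ?_
  rw [mul_assoc, ← pow_succ']
  exact .refl _

/-- Multiplying an ordered monomial on the left by its middle factor. -/
theorem QAssoc.mul_middle {P Q S : Op k} (hQP : QAssoc (Q * P) (P * Q)) (x y z : ℕ) :
    QAssoc (Q * (P ^ x * (Q ^ y * S ^ z))) (P ^ x * (Q ^ (y + 1) * S ^ z)) := by
  rw [← mul_assoc]
  refine ((hQP.mul_pow x).mul (.refl _)).trans ?_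
  rw [mul_assoc, ← mul_assoc Q, ← pow_succ']
  exact .refl _

theorem QAssoc.mul_first {P Q S : Op k} (x y z : ℕ) :
    QAssoc (P * (P ^ x * (Q ^ y * S ^ z))) (P ^ (x + 1) * (Q ^ y * S ^ z)) := by
  rw [← mul_assoc, ← pow_succ']
  exact .refl _

theorem QAssoc.mul_ite {P Q S : Op k} (h : QAssoc (P * Q) S) {c : Prop} [Decidable c] :
    QAssoc (P * if c then Q else 0) (if c then S else 0) := by
  split_ifs
  · exact h
  · rw [mul_zero]; exact .refl 0

/-- The content condition for a word in the letter matrix of a crossing at `i`: apart from the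
strands `i` and `i + 1` the contents agree. -/
def AgreeOff (i : Fin n) (L : List (Fin (n + 1) × Fin (n + 1))) : Prop :=
  ∀ p, p ≠ i.castSucc → p ≠ i.succ → (L.map Prod.fst).count p = (L.map Prod.snd).count p

theorem castSucc_ne_succ (i : Fin n) : i.castSucc ≠ i.succ := (Fin.castSucc_lt_succ (i := i)).ne

/-- Words in the entries of a block sum, in terms of ordered monomials `P`, `Q`, `S`, where the
entries of the block are `S'`. -/
theorem wordVal_blockSum (i : Fin n) (S : Matrix (Fin 2) (Fin 2) (Op k))
    (W : ℕ → ℕ → ℕ → ℕ → Op k) (h0 : QAssoc 1 (W 0 0 0 0))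
    (h00 : ∀ a b c d, S 0 0 = 0 ∨ QAssoc (S 0 0 * W a b c d) (W (a + 1) b c d))
    (h01 : ∀ a b c d, S 0 1 = 0 ∨ QAssoc (S 0 1 * W a b c d) (W a (b + 1) c d))
    (h10 : ∀ a b c d, S 1 0 = 0 ∨ QAssoc (S 1 0 * W a b c d) (W a b (c + 1) d))
    (h11 : ∀ a b c d, S 1 1 = 0 ∨ QAssoc (S 1 1 * W a b c d) (W a b c (d + 1)))
    (L : List (Fin (n + 1) × Fin (n + 1))) :
    wordVal (blockSum i S) L = 0 ∨ ∃ a b c d, QAssoc (wordVal (blockSum i S) L) (W a b c d) ∧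
      (L.map Prod.fst).count i.castSucc = a + b ∧ (L.map Prod.fst).count i.succ = c + d ∧
      (L.map Prod.snd).count i.castSucc = a + c ∧ (L.map Prod.snd).count i.succ = b + d ∧
      AgreeOff i L := by
  have hne := castSucc_ne_succ i
  induction L with
  | nil => exact Or.inr ⟨0, 0, 0, 0, by simpa [wordVal] using h0, by simp [AgreeOff]⟩
  | cons p L ih =>
    have hcons : wordVal (blockSum i S) (p :: L) = blockSum i S p.1 p.2 *
        wordVal (blockSum i S) L := by simp [wordVal]
    rcases ih with ih | ⟨a, b, c, d, hW, e1, e2, e3, e4, hoff⟩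
    · left; rw [hcons, ih, mul_zero]
    obtain ⟨x, y⟩ := p
    rw [hcons]
    by_cases hx1 : x = i.castSucc
    · subst hx1
      by_cases hy1 : y = i.castSucc
      · subst hy1
        rw [blockSum_castSucc_castSucc]
        rcases h00 a b c d with h | h
        · left; rw [h, zero_mul]
        · refine Or.inr ⟨_, _, _, _, ((QAssoc.refl _).mul hW).trans h, ?_, ?_, ?_, ?_, ?_⟩
          · simp [e1]; omega
          · simp [e2, hne]
          · simp [e3]; omega
          · simp [e4, hne]
          · intro p h1 h2; simp [hoff p h1 h2, h1.symm]
      · by_cases hy2 : y = i.succ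
        · subst hy2
          rw [blockSum_castSucc_succ]
          rcases h01 a b c d with h | h
          · left; rw [h, zero_mul]
          · refine Or.inr ⟨_, _, _, _, ((QAssoc.refl _).mul hW).trans h, ?_, ?_, ?_, ?_, ?_⟩
            · simp [e1]; omega
            · simp [e2, hne]
            · simp [e3, hne.symm]
            · simp [e4]; omega
            · intro p h1 h2; simp [hoff p h1 h2, h1.symm, h2.symm]
        · left; rw [blockSum_castSucc_of_ne _ _ hy1 hy2, zero_mul]
    · by_cases hx2 : x = i.succ
      · subst hx2
        by_cases hy1 : y = i.castSucc
        · subst hy1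
          rw [blockSum_succ_castSucc]
          rcases h10 a b c d with h | h
          · left; rw [h, zero_mul]
          · refine Or.inr ⟨_, _, _, _, ((QAssoc.refl _).mul hW).trans h, ?_, ?_, ?_, ?_, ?_⟩
            · simp [e1, hne.symm]
            · simp [e2]; omega
            · simp [e3]; omega
            · simp [e4, hne]
            · intro p h1 h2; simp [hoff p h1 h2, h1.symm, h2.symm]
        · by_cases hy2 : y = i.succ
          · subst hy2
            rw [blockSum_succ_succ]
            rcases h11 a b c d with h | h
            · left; rw [h, zero_mul]
            · refine Or.inr ⟨_, _, _, _, ((QAssoc.refl _).mul hW).trans h, ?_, ?_, ?_, ?_, ?_⟩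
              · simp [e1, hne.symm]
              · simp [e2]; omega
              · simp [e3, hne.symm]
              · simp [e4]; omega
              · intro p h1 h2; simp [hoff p h1 h2, h2.symm]
          · left; rw [blockSum_succ_of_ne _ _ hy1 hy2, zero_mul]
      · rw [blockSum_of_ne _ _ hx1 hx2]
        split_ifs with hxy
        · subst hxy
          refine Or.inr ⟨a, b, c, d, by simpa using hW, ?_, ?_, ?_, ?_, ?_⟩
          · simp [e1, hx1]
          · simp [e2, hx2]
          · simp [e3, hx1]
          · simp [e4, hx2]
          · intro p h1 h2
            simp only [List.map_cons, List.count_cons, hoff p h1 h2]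
        · left; rw [zero_mul]

theorem QAssoc.evalLin_ne_zero {N : ℕ} {P Q : Op k} (h : QAssoc P Q) (hP : evalLin k N P ≠ 0) :
    evalLin k N Q ≠ 0 := by
  obtain ⟨e, rfl⟩ := h
  rw [map_smul] at hP
  exact fun hQ => hP (by rw [hQ, smul_zero])

/-- The transposition of strands at the letter number `j`. -/
def letterSwap (γ : BraidWord n k) (j : Fin k) : Equiv.Perm (Fin (n + 1)) :=
  Equiv.swap (γ j).1.castSucc (γ j).1.succ

/-- The strands of content less than `N` keep a content less than `N`. -/
theorem content_lt_of_letter (γ : BraidWord n k) (j : Fin k) (N : ℕ)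
    (L : List (Fin (n + 1) × Fin (n + 1)))
    (hL : evalLin k N (wordVal (letterMatrix γ j) L) ≠ 0) (p : Fin (n + 1))
    (hp : (L.map Prod.fst).count p < N) : (L.map Prod.snd).count (letterSwap γ j p) < N := by
  have hoffcase : AgreeOff (γ j).1 L → p ≠ (γ j).1.castSucc → p ≠ (γ j).1.succ →
      (L.map Prod.snd).count (letterSwap γ j p) < N := by
    intro hoff h1 h2
    rw [letterSwap, Equiv.swap_apply_of_ne_of_ne h1 h2, ← hoff p h1 h2]
    exact hp
  have h0 : wordVal (letterMatrix γ j) L ≠ 0 := fun h => hL (by rw [h, map_zero])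
  rw [letterMatrix] at hL h0
  rcases hb : (γ j).2 with _ | _
  · rw [hb] at hL h0
    have hba : QAssoc (aMinus j * bMinus j) (bMinus j * aMinus j) := ⟨2, aMinus_mul_bMinus j⟩
    have hbc : QAssoc (bMinus j * cMinus j) (cMinus j * bMinus j) :=
      QAssoc.symm ⟨2, cMinus_mul_bMinus j⟩
    have hac : QAssoc (aMinus j * cMinus j) (cMinus j * aMinus j) :=
      QAssoc.symm ⟨1, cMinus_mul_aMinus j⟩
    have := wordVal_blockSum (γ j).1 (sBlock false j)
      (fun a b c d => if a = 0 then cMinus j ^ b * (bMinus j ^ c * aMinus j ^ d) else 0)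
      (by simpa using QAssoc.refl (1 : Op k)) (fun a b c d => Or.inl rfl)
      (fun a b c d => Or.inr (QAssoc.mul_ite (QAssoc.mul_first b c d)))
      (fun a b c d => Or.inr (QAssoc.mul_ite (QAssoc.mul_middle hbc b c d)))
      (fun a b c d => Or.inr (QAssoc.mul_ite (QAssoc.mul_last hac hba b c d))) L
    rcases this with h | ⟨a, b, c, d, hW, e1, e2, e3, e4, hoff⟩
    · exact absurd h h0
    · have hne := hW.evalLin_ne_zero hL
      split_ifs at hne with ha
      swap
      · exact absurd (map_zero _) hne
      -- Here s = b and m = d. The left strand enters with content b and leaves on the right with b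
      -- + d, which the vanishing factor keeps below N. The right strand enters with c + d and
      -- leaves with c, which is no larger.
      by_cases hp1 : p = (γ j).1.castSucc
      · subst hp1
        rw [letterSwap, Equiv.swap_apply_left, e4]
        by_contra hcon
        exact hne (evalLin_minus_eq_zero j (by omega) (by omega))
      · by_cases hp2 : p = (γ j).1.succ
        · subst hp2
          rw [letterSwap, Equiv.swap_apply_right, e3]
          omega
        · exact hoffcase hoff hp1 hp2
  · rw [hb] at hL h0
    have hba : QAssoc (bMinus j * aPlus j) (aPlus j * bMinus j) := by
      rw [show bMinus j = bPlus j from rfl, aPlus_mul_bPlus]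
      exact .refl _
    have hbc : QAssoc (cPlus j * bPlus j) (bPlus j * cPlus j) :=
      QAssoc.symm ⟨2, bPlus_mul_cPlus j⟩
    have hac : QAssoc (cPlus j * aPlus j) (aPlus j * cPlus j) :=
      QAssoc.symm ⟨1, aPlus_mul_cPlus j⟩
    have := wordVal_blockSum (γ j).1 (sBlock true j)
      (fun a b c d => if d = 0 then aPlus j ^ a * (bPlus j ^ b * cPlus j ^ c) else 0)
      (by simpa using QAssoc.refl (1 : Op k))
      (fun a b c d => Or.inr (QAssoc.mul_ite (QAssoc.mul_first a b c)))
      (fun a b c d => Or.inr (QAssoc.mul_ite (QAssoc.mul_middle hba a b c)))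
      (fun a b c d => Or.inr (QAssoc.mul_ite (QAssoc.mul_last hac hbc a b c)))
      (fun a b c d => Or.inl rfl) L
    rcases this with h | ⟨a, b, c, d, hW, e1, e2, e3, e4, hoff⟩
    · exact absurd h h0
    · have hne := hW.evalLin_ne_zero hL
      split_ifs at hne with hd
      swap
      · exact absurd (map_zero _) hne
      by_cases hp1 : p = (γ j).1.castSucc
      · subst hp1
        rw [letterSwap, Equiv.swap_apply_left, e4]
        omega
      · by_cases hp2 : p = (γ j).1.succ
        · subst hp2
          rw [letterSwap, Equiv.swap_apply_right, e3]
          -- Here t = c and m = a: the right strand enters with content c and leaves on the left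
          -- with a + c, and a + c ≥ N would make a factor vanish.
          by_contra hcon
          exact hne (evalLin_plus_eq_zero j (by omega) (by omega))
        · exact hoffcase hoff hp1 hp2

end

section

variable {n k : ℕ}

/-! ### Finiteness of the expansion -/

/-- Expanding every entry of the product inserts an intermediate index, and the factors from `b`
move to the right of those from `a`. The result is an `a`-word followed by a `b`-word that meet in
the same intermediate indices. -/
theorem exists_wordVal_mul {R : Type*} [CommRing R] {A : Type*} [Ring A] [Algebra R A] {r : ℕ}
    {a b : Matrix (Fin r) (Fin r) A} (hab : ∀ i j k l, Commute (a i j) (b k l))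
    (L : List (Fin r × Fin r)) :
    wordVal (a * b) L ∈ Submodule.span R {x | ∃ L₁ L₂ : List (Fin r × Fin r),
      L₁.map Prod.fst = L.map Prod.fst ∧ L₁.map Prod.snd = L₂.map Prod.fst ∧
      L₂.map Prod.snd = L.map Prod.snd ∧ wordVal a L₁ * wordVal b L₂ = x} := by
  induction L with
  | nil => exact Submodule.subset_span ⟨[], [], by simp [wordVal]⟩
  | cons p L ih =>
    have hcons : wordVal (a * b) (p :: L) = ∑ j, a p.1 j * b j p.2 * wordVal (a * b) L := by
      rw [← Finset.sum_mul, ← Matrix.mul_apply]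
      simp [wordVal]
    rw [hcons]
    refine Submodule.sum_mem _ fun j _ => ?_
    refine Submodule.span_induction (p := fun x _ => a p.1 j * b j p.2 * x ∈ _) ?_ ?_ ?_ ?_ ih
    · rintro _ ⟨L₁, L₂, h1, h2, h3, rfl⟩
      refine Submodule.subset_span ⟨(p.1, j) :: L₁, (j, p.2) :: L₂, by simp [h1], by simp [h2],
        by simp [h3], ?_⟩
      have hc : Commute (b j p.2) (wordVal a L₁) := by
        rw [wordVal]
        exact Commute.list_prod_right _ _ fun x hx => by
          obtain ⟨y, -, rfl⟩ := List.mem_map.1 hx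
          exact (hab _ _ _ _).symm
      have e1 : wordVal a ((p.1, j) :: L₁) = a p.1 j * wordVal a L₁ := by simp [wordVal]
      have e2 : wordVal b ((j, p.2) :: L₂) = b j p.2 * wordVal b L₂ := by simp [wordVal]
      rw [e1, e2, mul_assoc, ← mul_assoc _ (b j p.2), ← hc.eq]
      simp only [mul_assoc]
    · rw [mul_zero]; exact Submodule.zero_mem _
    · intro x y _ _ hx hy
      rw [mul_add]
      exact Submodule.add_mem _ hx hy
    · intro t x _ hx
      rw [mul_smul_comm]
      exact Submodule.smul_mem _ _ hx

theorem exists_ne_zero_of_mem_span {R A : Type*} [CommRing R] [Ring A] [Algebra R A]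
    (f : A →ₗ[R] R) {S : Set A} {x : A} (hx : x ∈ Submodule.span R S) (hf : f x ≠ 0) :
    ∃ y ∈ S, f y ≠ 0 := by
  by_contra! h
  exact hf ((Submodule.span_le (p := LinearMap.ker f)).2 h hx)

theorem wordVal_mem {R : Type*} [CommRing R] {A : Type*} [Ring A] [Algebra R A] {r : ℕ}
    {a : Matrix (Fin r) (Fin r) A} {S : Subalgebra R A} (hS : ∀ x y, a x y ∈ S)
    (L : List (Fin r × Fin r)) : wordVal a L ∈ S :=
  Subalgebra.list_prod_mem _ fun x hx => by
    obtain ⟨p, -, rfl⟩ := List.mem_map.1 hx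
    exact hS _ _

theorem wordVal_one_ne_zero {A : Type*} [Ring A] {r : ℕ}
    {L : List (Fin r × Fin r)} (h : wordVal (1 : Matrix (Fin r) (Fin r) A) L ≠ 0) :
    L.map Prod.fst = L.map Prod.snd := by
  induction L with
  | nil => rfl
  | cons p L ih =>
    have hcons : wordVal (1 : Matrix (Fin r) (Fin r) A) (p :: L) =
      (1 : Matrix (Fin r) (Fin r) A) p.1 p.2 * wordVal 1 L := by simp [wordVal]
    rw [hcons] at h
    have h1 : p.1 = p.2 := by
      by_contra hp
      exact h (by rw [Matrix.one_apply_ne hp, zero_mul])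
    rw [List.map_cons, List.map_cons, h1, ih (right_ne_zero_of_mul h)]

/-- A non-zero evaluation forces some split with both factors non-zero, so the bound travels along
the strand letter by letter. The permutation is inverted because the leftmost letter is crossed
first. -/
theorem content_lt_of_list (γ : BraidWord n k) (N : ℕ) {l : List (Fin k)} (hl : l.Nodup)
    (L : List (Fin (n + 1) × Fin (n + 1)))
    (hL : evalLin k N (wordVal (rhoList γ l) L) ≠ 0) (p : Fin (n + 1))
    (hp : (L.map Prod.fst).count p < N) :
    (L.map Prod.snd).count ((l.map (letterSwap γ)).prod⁻¹ p) < N := by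
  induction l generalizing L p with
  | nil =>
    have : wordVal (1 : Matrix (Fin (n + 1)) (Fin (n + 1)) (Op k)) L ≠ 0 := by
      intro h
      apply hL
      rw [rhoList, List.map_nil, List.prod_nil, h, map_zero]
    simpa [← wordVal_one_ne_zero this] using hp
  | cons j l ih =>
    have hd := disjoint_letter hl
    rw [rhoList_cons] at hL
    obtain ⟨_, ⟨L₁, L₂, h1, h2, h3, rfl⟩, hne⟩ := exists_ne_zero_of_mem_span (R := Rq) (A := Op k) (evalLin k N)
      (exists_wordVal_mul (R := Rq) (fun x y z w => commute_of_localOp hd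
        (letterMatrix_mem γ j x y) (rhoList_mem γ l z w)) L) hL
    have hm₁ : wordVal (letterMatrix γ j) L₁ ∈ localOp {j} :=
      wordVal_mem (R := Rq) (A := Op k) (letterMatrix_mem γ j) L₁
    have hm₂ : wordVal (rhoList γ l) L₂ ∈ localOp {i | i ∈ l} :=
      wordVal_mem (R := Rq) (A := Op k) (rhoList_mem γ l) L₂
    rw [evalLin_mul hd N hm₁ hm₂] at hne
    rw [← h1] at hp
    have h4 := content_lt_of_letter γ j N L₁ (left_ne_zero_of_mul hne) p hp
    rw [h2] at h4
    have h5 := ih (List.nodup_cons.1 hl).2 L₂ (right_ne_zero_of_mul hne) _ h4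
    rw [h3] at h5
    rw [List.map_cons, List.prod_cons, mul_inv_rev, Equiv.Perm.mul_apply]
    have : (letterSwap γ j)⁻¹ = letterSwap γ j := Equiv.swap_inv _ _
    rwa [this]

theorem braidPerm_eq (γ : BraidWord n k) :
    braidPerm γ = ((List.finRange k).map (letterSwap γ)).prod := by
  rw [braidPerm, ← List.ofFn_eq_map]
  rfl

/-- A permutation with a single cycle carries the bound from strand 0 to every strand. -/
theorem lt_of_closureIsKnot {γ : BraidWord n k} (hK : ClosureIsKnot γ) {N : ℕ}
    {c : Fin (n + 1) → ℕ} (h0 : c 0 < N) (h : ∀ p, c p < N → c ((braidPerm γ)⁻¹ p) < N)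
    (p : Fin (n + 1)) : c p < N := by
  obtain ⟨i, hi⟩ := hK.inv.exists_pow_eq' Set.finite_univ (Set.mem_univ 0) (Set.mem_univ p)
  rw [← hi]
  have key : ∀ i : ℕ, c (((braidPerm γ)⁻¹ ^ i) 0) < N := by
    intro i
    induction i with
    | zero => simpa using h0
    | succ i ih => rw [pow_succ', Equiv.Perm.mul_apply]; exact h _ ih
  exact key i

/-- For a balanced word the outgoing contents equal the incoming ones, so the bound can be iterated
around the closure. -/
theorem content_lt_of_balanced {γ : BraidWord n k} (hK : ClosureIsKnot γ) {N : ℕ}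
    {L : List (Fin (n + 1) × Fin (n + 1))} (hb : (L.map Prod.fst).Perm (L.map Prod.snd))
    (hL : evalLin k N (wordVal (rho γ) L) ≠ 0) (h0 : (L.map Prod.fst).count 0 < N)
    (p : Fin (n + 1)) : (L.map Prod.fst).count p < N := by
  refine lt_of_closureIsKnot hK (c := fun p => (L.map Prod.fst).count p) h0 (fun p hp => ?_) p
  rw [rho_eq_rhoList] at hL
  have := content_lt_of_list γ N (List.nodup_finRange k) L hL p hp
  rw [← braidPerm_eq, ← hb.count_eq] at this
  exact this

theorem wordVal_submatrix {A : Type*} [Ring A] {r s : ℕ} (a : Matrix (Fin r) (Fin r) A)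
    (e : Fin s → Fin r) (L : List (Fin s × Fin s)) :
    wordVal (a.submatrix e e) L = wordVal a (L.map (Prod.map e e)) := by
  simp [wordVal, Function.comp_def]

theorem wordVal_smul {R : Type*} [CommRing R] {A : Type*} [Ring A] [Algebra R A] {r : ℕ} (t : R)
    (a : Matrix (Fin r) (Fin r) A) (L : List (Fin r × Fin r)) :
    wordVal (t • a) L = t ^ L.length • wordVal a L := by
  induction L with
  | nil => simp [wordVal]
  | cons p L ih =>
    have hcons : ∀ a : Matrix (Fin r) (Fin r) A, wordVal a (p :: L) = a p.1 p.2 * wordVal a L :=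
      fun a => by simp [wordVal]
    rw [hcons, hcons, ih, Matrix.smul_apply, smul_mul_smul_comm, List.length_cons, pow_succ']

/-- This is where deleting the first row and column matters: strand 0 does not occur in the word, so
its content 0 < N starts the propagation. -/
theorem content_lt_of_evalLin_ne_zero {γ : BraidWord n k} (hK : ClosureIsKnot γ) {N : ℕ} (hN : 0 < N)
    {t : Rq} {L : List (Fin n × Fin n)} (hb : (L.map Prod.fst).Perm (L.map Prod.snd))
    (hL : evalLin k N (wordVal (t • rho' γ) L) ≠ 0) (p : Fin n) :
    (L.map Prod.fst).count p < N := by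
  rw [wordVal_smul, map_smul, rho', wordVal_submatrix] at hL
  have hL' := right_ne_zero_of_smul hL
  have e1 : (L.map (Prod.map Fin.succ Fin.succ)).map Prod.fst = (L.map Prod.fst).map Fin.succ := by
    simp [Function.comp_def]
  have e2 : (L.map (Prod.map Fin.succ Fin.succ)).map Prod.snd = (L.map Prod.snd).map Fin.succ := by
    simp [Function.comp_def]
  have h := content_lt_of_balanced hK (by rw [e1, e2]; exact hb.map _) hL' (by
    rw [e1, List.count_eq_zero_of_not_mem]
    · exact hN
    · simp [Fin.succ_ne_zero]) p.succ
  rwa [e1, List.count_map_of_injective _ _ (Fin.succ_injective n)] at h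

theorem sum_count_fst {r : ℕ} (L : List (Fin r × Fin r)) :
    ∑ p, (L.map Prod.fst).count p = L.length := by
  have := Multiset.sum_count_eq_card (s := Finset.univ) (m := (L.map Prod.fst : Multiset (Fin r)))
    (fun _ _ => Finset.mem_univ _)
  simpa using this

/-- The length of a word is the sum of the contents of the n remaining strands, each at most N - 1
when the evaluation is non-zero. -/
theorem evalLin_balancedSpan {γ : BraidWord n k} (hK : ClosureIsKnot γ) {N : ℕ} (hN : 0 < N)
    {t : Rq} {x : Op k} (hx : x ∈ balancedSpan Rq (t • rho' γ) (n * (N - 1) + 1)) :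
    evalLin k N x = 0 := by
  by_contra hne
  obtain ⟨_, ⟨L, hb, hlen, rfl⟩, h⟩ := exists_ne_zero_of_mem_span (R := Rq) (A := Op k) (evalLin k N) hx hne
  have hlt := content_lt_of_evalLin_ne_zero hK hN hb h
  have : ∑ p, (L.map Prod.fst).count p ≤ ∑ _p : Fin n, (N - 1) :=
    Finset.sum_le_sum fun p _ => by have := hlt p; omega
  rw [sum_count_fst, Finset.sum_const, Finset.card_univ, Fintype.card_fin, smul_eq_mul] at this
  omega

theorem rightQuantum_rho' (γ : BraidWord n k) : RightQuantum qInv (rho' γ) := by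
  rw [rho', rho_eq_rhoList]
  exact (rightQuantum_rhoList γ (List.nodup_finRange k)).submatrix Fin.strictMono_succ

theorem one_sub_qDetOneSub {r : ℕ} (A : Matrix (Fin r) (Fin r) (Op k)) :
    1 - qDetOneSub A = minorAlt (LaurentPolynomial.T 1 : Rq) A := by
  have h : ∀ x : Op k, 1 - (1 - x) = x := fun x => by abel
  rw [qDetOneSub, h, minorSum, minorAlt]
  refine Finset.sum_congr rfl fun J _ => ?_
  rw [extCoeff_self]
  rfl

theorem evalLin_symCoeff_eq_zero {γ : BraidWord n k} (hK : ClosureIsKnot γ) {N : ℕ} (hN : 0 < N)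
    {t : Rq} {m : Fin n → ℕ} (hm : ¬ ∀ p, m p < N) :
    evalLin k N (symCoeff qInv (t • rho' γ) m m) = 0 := by
  by_contra hne
  obtain ⟨_, ⟨L, h1, h2, rfl⟩, h⟩ := exists_ne_zero_of_mem_span (R := Rq) (A := Op k) (evalLin k N)
    (((rightQuantum_rho' γ).smul t).symCoeff_mem m m) hne
  refine hm fun p => ?_
  rw [← h1]
  exact content_lt_of_evalLin_ne_zero hK hN
    (List.perm_iff_count.2 fun p => (h1 p).trans (h2 p).symm) h p

/-- The expansion of the inverse of the quantum determinant, as a trace on the quantum symmetric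
algebra. -/
theorem finsum_evalN_pow {γ : BraidWord n k} (hK : ClosureIsKnot γ) {N : ℕ} (hN : 0 < N) :
    {i : ℕ | evalN N ((1 - qDetOneSub ((LaurentPolynomial.T 1 : Rq) • rho' γ)) ^ i) ≠ 0}.Finite ∧
    ∑ᶠ i : ℕ, evalN N ((1 - qDetOneSub ((LaurentPolynomial.T 1 : Rq) • rho' γ)) ^ i) =
      ∑ m : Fin n → Fin N, (LaurentPolynomial.T 1 : Rq) ^ (∑ p, (m p : ℕ)) *
        numCoeff N γ (List.finRange k) (Fin.cons 0 fun p => (m p : ℕ) : Fin (n + 1) → ℕ)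
          (Fin.cons 0 fun p => (m p : ℕ) : Fin (n + 1) → ℕ) := by
  -- The largest length of a balanced word with non-zero evaluation.
  set D := n * (N - 1)
  have hz : ∀ i, D + 1 ≤ i → evalN N ((1 - qDetOneSub ((LaurentPolynomial.T 1 : Rq) • rho' γ)) ^ i)
      = 0 := by
    intro i hi
    rw [one_sub_qDetOneSub]
    exact evalLin_balancedSpan hK hN
      (balancedSpan_anti _ hi (pow_mem_balancedSpan (minorAlt_mem _) i))
  have hsub : {i : ℕ | evalN N ((1 - qDetOneSub ((LaurentPolynomial.T 1 : Rq) • rho' γ)) ^ i) ≠ 0} ⊆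
      (Finset.range (D + 1) : Set ℕ) := by
    intro i hi
    rw [Finset.coe_range, Set.mem_Iio]
    by_contra h
    exact hi (hz i (not_lt.1 h))
  refine ⟨(Finset.finite_toSet _).subset hsub, ?_⟩
  rw [finsum_eq_sum_of_support_subset _ hsub, one_sub_qDetOneSub]
  have ha := (rightQuantum_rho' γ).smul (LaurentPolynomial.T 1 : Rq)
  refine (ha.sum_pow_minorAlt q_mul_qInv (evalLin k N) D
    fun x hx => evalLin_balancedSpan hK hN hx).trans ?_
  have hR := rightQuantum_rhoList γ (List.nodup_finRange k)
  have hterm : ∀ m : Fin n → ℕ,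
      evalLin k N (symCoeff qInv ((LaurentPolynomial.T 1 : Rq) • rho' γ) m m) =
      (LaurentPolynomial.T 1 : Rq) ^ (∑ p, m p) * numCoeff N γ (List.finRange k)
        (Fin.cons 0 m : Fin (n + 1) → ℕ) (Fin.cons 0 m : Fin (n + 1) → ℕ) := by
    intro m
    rw [(rightQuantum_rho' γ).symCoeff_smul, map_smul, smul_eq_mul, numCoeff, rho', rho_eq_rhoList,
      hR.symCoeff_submatrix_succ]
  simp only [symTrace, map_sum]
  rw [Finset.sum_sigma']
  symm
  -- Diagonal coefficients at monomials with an exponent ≥ N evaluate to 0, and all remaining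
  -- monomials have degree at most D.
  refine Finset.sum_of_injOn (fun m : Fin n → Fin N =>
    (⟨∑ p, (m p : ℕ), fun p => (m p : ℕ)⟩ : (_ : ℕ) × (Fin n → ℕ))) ?_ ?_ ?_ ?_
  · intro m _ m' _ h
    rw [Sigma.mk.injEq] at h
    funext p
    exact Fin.ext (congrFun (eq_of_heq h.2) p)
  · intro m _
    simp only [Finset.coe_sigma, Set.mem_sigma_iff, Finset.mem_coe, Finset.mem_range,
      Finset.mem_piAntidiag, Finset.mem_univ]
    refine ⟨?_, by simp⟩
    have : ∑ p, (m p : ℕ) ≤ ∑ _p : Fin n, (N - 1) :=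
      Finset.sum_le_sum fun p _ => by have := (m p).2; omega
    rw [Finset.sum_const, Finset.card_univ, Fintype.card_fin, smul_eq_mul] at this
    omega
  · rintro ⟨d, m⟩ hm hm'
    refine evalLin_symCoeff_eq_zero hK hN fun hlt => hm' ?_
    simp only [Finset.mem_sigma, Finset.mem_piAntidiag] at hm
    refine ⟨fun p => ⟨m p, hlt p⟩, by simp, ?_⟩
    simp [hm.2.1]
  · intro m _
    exact (hterm _).symm

end

/-! ### The evaluated action of a single crossing, in closed form. -/

section

variable {n k : ℕ}

/-! ### The action of a block sum on the quantum symmetric algebra -/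

section BlockAction

variable {R : Type*} [CommRing R] {A : Type*} [Ring A] [Algebra R A] {κ : R}

/-- The states `m` and `m'` agree away from the strands of the letter at `i`. -/
def SameOff {X : Type*} (i : Fin n) (m m' : Fin (n + 1) → X) : Prop :=
  ∀ p, p ≠ i.castSucc → p ≠ i.succ → m p = m' p

theorem lt_succ_of_ne {i : Fin n} {p : Fin (n + 1)} (hp : p < i.succ) (h : p ≠ i.castSucc) :
    p < i.castSucc :=
  lt_of_le_of_ne (Fin.le_castSucc_iff.2 hp) h

/-- `G s t x y` plays the coefficient of X₁^x X₂^y in (S₀₀X₁ + S₀₁X₂)^s (S₁₀X₁ + S₁₁X₂)^t. The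
hypotheses are its initial value and the recursions that peel off the leftmost factor; κ^x arises
when X₂ crosses X₁^x. The other variables are left alone and, being added in order, cause no further
powers of κ. -/
theorem symCoeff_blockSum (i : Fin n) {S : Matrix (Fin 2) (Fin 2) A} (hS : RightQuantum κ S)
    (G : ℕ → ℕ → ℕ → ℕ → A)
    (h0 : ∀ x y, G 0 0 x y = if x = 0 ∧ y = 0 then 1 else 0)
    (h1 : ∀ s t x y, G (s + 1) t x y = (S 0 0 * if 0 < x then G s t (x - 1) y else 0) +
      S 0 1 * if 0 < y then κ ^ x • G s t x (y - 1) else 0)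
    (h2 : ∀ t x y, G 0 (t + 1) x y = (S 1 0 * if 0 < x then G 0 t (x - 1) y else 0) +
      S 1 1 * if 0 < y then κ ^ x • G 0 t x (y - 1) else 0)
    (m m' : Fin (n + 1) → ℕ) [Decidable (SameOff i m m')] :
    symCoeff κ (blockSum i S) m m' = if SameOff i m m' then
      G (m i.castSucc) (m i.succ) (m' i.castSucc) (m' i.succ) else 0 := by
  classical
  have hB := hS.blockSum i
  have hne := castSucc_ne_succ i
  induction m using ordInduction generalizing m' with
  | h0 =>
    rw [symCoeff_zero, Pi.single_apply, Pi.zero_apply, Pi.zero_apply, h0]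
    by_cases hm : m' = 0
    · subst hm
      simp [SameOff]
    · rw [if_neg hm]
      symm
      by_cases hs : SameOff i 0 m'
      · rw [if_pos hs, if_neg]
        rintro ⟨e1, e2⟩
        apply hm
        funext p
        by_cases p1 : p = i.castSucc
        · rw [p1, e1]; rfl
        · by_cases p2 : p = i.succ
          · rw [p2, e2]; rfl
          · exact (hs p p1 p2).symm
      · rw [if_neg hs]
  | hs m r hr ih =>
    have ih' : ∀ m', symCoeff κ (ColoredJones.blockSum i S) m m' = if SameOff i m m' then
      G (m i.castSucc) (m i.succ) (m' i.castSucc) (m' i.succ) else 0 := fun m' => ih m'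
    rw [hB.symCoeff_add_single r m hr, rowOp_apply]
    have hoff : ∀ x : Fin (n + 1), (x = i.castSucc ∨ x = i.succ) →
        (SameOff i m (m' - Pi.single x 1) ↔ SameOff i m m') := by
      intro x hx
      refine forall_congr' fun p => forall_congr' fun p1 => forall_congr' fun p2 => ?_
      have : p ≠ x := by rcases hx with rfl | rfl <;> assumption
      simp [this]
    have hoff' : ∀ x : Fin (n + 1), (x = i.castSucc ∨ x = i.succ) →
        (SameOff i (m + Pi.single x 1) m' ↔ SameOff i m m') := by
      intro x hx
      refine forall_congr' fun p => forall_congr' fun p1 => forall_congr' fun p2 => ?_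
      have : p ≠ x := by rcases hx with rfl | rfl <;> assumption
      simp [this]
    have hlow : ∀ x : Fin (n + 1), SameOff i m m' → (x = i.castSucc ∨ x = i.succ) →
        (r = i.castSucc ∨ r = i.succ) → lowerSum i.castSucc (m' - Pi.single x 1) = 0 := by
      intro x hs hx hr'
      refine lowerSum_eq_zero fun p hp => ?_
      have p1 : p ≠ i.castSucc := hp.ne
      have p2 : p ≠ i.succ := (hp.trans Fin.castSucc_lt_succ).ne
      have hpr : p < r := by
        rcases hr' with rfl | rfl
        · exact hp
        · exact hp.trans Fin.castSucc_lt_succ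
      rw [Pi.sub_apply, ← hs p p1 p2, hr p hpr, zero_tsub]
    have hlow' : SameOff i m m' → (r = i.castSucc ∨ r = i.succ) →
        lowerSum i.succ (m' - Pi.single i.succ 1) = m' i.castSucc := by
      intro hs hr'
      have h := hlow i.succ hs (Or.inr rfl) hr'
      rw [lowerSum] at h ⊢
      rw [Finset.sum_eq_single i.castSucc]
      · rw [if_pos Fin.castSucc_lt_succ]
        simp [hne]
      · intro p _ p1
        split_ifs with hp
        · have := Finset.sum_eq_zero_iff.1 h p (Finset.mem_univ p)
          rwa [if_pos (lt_succ_of_ne hp p1)] at this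
        · rfl
      · simp
    by_cases hr1 : r = i.castSucc
    · subst hr1
      rw [Fintype.sum_eq_add i.castSucc i.succ hne (fun x hx => by
        rw [blockSum_castSucc_of_ne i S hx.1 hx.2, zero_mul]), blockSum_castSucc_castSucc,
        blockSum_castSucc_succ, varOp_apply, varOp_apply, ih', ih']
      simp only [hoff _ (Or.inl rfl), hoff _ (Or.inr rfl), hoff' _ (Or.inl rfl)]
      by_cases hs : SameOff i m m'
      · rw [if_pos hs, if_pos hs, if_pos hs, hlow _ hs (Or.inl rfl) (Or.inl rfl),
          hlow' hs (Or.inl rfl)]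
        simp [hne, hne.symm, h1]
      · simp [hs]
    · by_cases hr2 : r = i.succ
      · subst hr2
        have hm0 : m i.castSucc = 0 := hr _ Fin.castSucc_lt_succ
        rw [Fintype.sum_eq_add i.castSucc i.succ hne (fun x hx => by
          rw [blockSum_succ_of_ne i S hx.1 hx.2, zero_mul]), blockSum_succ_castSucc,
          blockSum_succ_succ, varOp_apply, varOp_apply, ih', ih']
        simp only [hoff _ (Or.inl rfl), hoff _ (Or.inr rfl), hoff' _ (Or.inr rfl)]
        by_cases hs : SameOff i m m'
        · rw [if_pos hs, if_pos hs, if_pos hs, hlow _ hs (Or.inl rfl) (Or.inr rfl),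
            hlow' hs (Or.inr rfl)]
          simp [hne, hne.symm, h2, hm0]
        · simp [hs]
      · rw [Finset.sum_eq_single r (fun x _ hx => by
          rw [blockSum_of_ne i S hr1 hr2, if_neg hx.symm, zero_mul]) (by simp),
          blockSum_of_ne i S hr1 hr2, if_pos rfl, one_mul, varOp_apply, ih']
        have hre : (m + Pi.single r 1 : Fin (n + 1) → ℕ) i.castSucc = m i.castSucc := by
          simp [Ne.symm hr1]
        have hre' : (m + Pi.single r 1 : Fin (n + 1) → ℕ) i.succ = m i.succ := by
          simp [Ne.symm hr2]
        have hle : (m' - Pi.single r 1 : Fin (n + 1) → ℕ) i.castSucc = m' i.castSucc := by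
          simp [Ne.symm hr1]
        have hle' : (m' - Pi.single r 1 : Fin (n + 1) → ℕ) i.succ = m' i.succ := by
          simp [Ne.symm hr2]
        rw [hre, hre', hle, hle']
        by_cases hs : SameOff i (m + Pi.single r 1) m'
        · have hpos : 0 < m' r := by
            have := hs r hr1 hr2
            simp at this
            omega
          have hs' : SameOff i m (m' - Pi.single r 1) := by
            intro p p1 p2
            have := hs p p1 p2
            simp only [Pi.add_apply, Pi.sub_apply] at this ⊢
            omega
          rw [if_pos hs, if_pos hpos, if_pos hs']
          by_cases hlt : r < i.castSucc
          · rw [lowerSum_eq_zero, pow_zero, one_smul]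
            intro p hp
            have p1 := (hp.trans hlt).ne
            have p2 := (hp.trans (hlt.trans Fin.castSucc_lt_succ)).ne
            rw [← hs' p p1 p2, hr p hp]
          · have hgt : i.succ < r := by
              rcases lt_or_ge i.succ r with h | h
              · exact h
              · exact absurd (lt_succ_of_ne (lt_of_le_of_ne h hr2) hr1) hlt
            have hgt' := (Fin.castSucc_lt_succ (i := i)).trans hgt
            -- Since r is the smallest index in use and lies above the two strands, both incoming
            -- contents are 0; a non-zero coefficient needs both outgoing contents to be 0 as well,
            -- so nothing lies below r.
            rw [hr _ hgt, hr _ hgt', h0]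
            split_ifs with hz
            · rw [lowerSum_eq_zero, pow_zero, one_smul]
              intro p hp
              by_cases p1 : p = i.castSucc
              · rw [p1, hle, hz.1]
              · by_cases p2 : p = i.succ
                · rw [p2, hle', hz.2]
                · rw [← hs' p p1 p2, hr p hp]
            · rw [smul_zero]
        · rw [if_neg hs]
          split_ifs with hpos hs'
          · exfalso
            apply hs
            intro p p1 p2
            have := hs' p p1 p2
            by_cases hpr : p = r
            · subst hpr
              simp at this ⊢
              omega
            · simp [hpr] at this ⊢
              omega
          · rw [smul_zero]
          · rfl

end BlockAction

/-! ### Quantum binomial coefficients -/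

/-- The quantum binomial coefficients. -/
def gaussBinom {R : Type*} [CommRing R] (κ : R) : ℕ → ℕ → R
  | _, 0 => 1
  | 0, _ + 1 => 0
  | s + 1, l + 1 => gaussBinom κ s l + κ ^ (l + 1) * gaussBinom κ s (l + 1)

section Gauss

variable {R : Type*} [CommRing R] (κ : R)

theorem gaussBinom_zero_right (s : ℕ) : gaussBinom κ s 0 = 1 := by cases s <;> rfl

theorem gaussBinom_succ_succ (s l : ℕ) :
    gaussBinom κ (s + 1) (l + 1) = gaussBinom κ s l + κ ^ (l + 1) * gaussBinom κ s (l + 1) := rfl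

theorem gaussBinom_eq_zero {s l : ℕ} (h : s < l) : gaussBinom κ s l = 0 := by
  induction s generalizing l with
  | zero => obtain ⟨l, rfl⟩ := Nat.exists_eq_succ_of_ne_zero h.ne'; rfl
  | succ s ih =>
    obtain ⟨l, rfl⟩ := Nat.exists_eq_succ_of_ne_zero (Nat.ne_zero_of_lt h)
    rw [Nat.succ_eq_add_one, gaussBinom_succ_succ, ih (by omega), ih (by omega)]
    ring

theorem gaussBinom_self (s : ℕ) : gaussBinom κ s s = 1 := by
  induction s with
  | zero => rfl
  | succ s ih => rw [gaussBinom_succ_succ, ih, gaussBinom_eq_zero κ (Nat.lt_succ_self s)]; ring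

/-- The product `(1 - κ) (1 - κ²) ⋯ (1 - κ^m)`. -/
def qPoch (m : ℕ) : R := ∏ i ∈ Finset.range m, (1 - κ ^ (i + 1))

theorem qPoch_succ (m : ℕ) : qPoch κ (m + 1) = qPoch κ m * (1 - κ ^ (m + 1)) :=
  Finset.prod_range_succ _ _

/-- The quotient formula for κ-binomials, cleared of denominators so that it holds over any
commutative ring. -/
theorem gaussBinom_mul_qPoch (l n : ℕ) :
    gaussBinom κ (l + n) l * (qPoch κ l * qPoch κ n) = qPoch κ (l + n) := by
  induction l generalizing n with
  | zero => simp [gaussBinom_zero_right, qPoch]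
  | succ l ihl =>
    induction n with
    | zero => simp [gaussBinom_self, qPoch]
    | succ n ihn =>
      rw [show l + 1 + (n + 1) = (l + 1 + n) + 1 by ring, gaussBinom_succ_succ, qPoch_succ _ (l + 1 + n)]
      have h1 := ihl (n + 1)
      rw [show l + (n + 1) = l + 1 + n by ring] at h1
      have h2 := ihn
      rw [qPoch_succ κ n] at h1 ⊢
      rw [qPoch_succ κ l] at h2 ⊢
      linear_combination (1 - κ ^ (l + 1)) * h1 + κ ^ (l + 1) * (1 - κ ^ (n + 1)) * h2

end Gauss

end

section

variable {n k : ℕ}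

/-! ### The weights of a crossing -/

/-- The coefficient of the positive crossing, from the state `(s, t)` to the state `(x, y)`. -/
def posWeight {R : Type*} [CommRing R] (κ z : R) (s t x y : ℕ) : R :=
  if x + y = s + t ∧ t ≤ x then
    κ ^ (t * y) * gaussBinom κ s (x - t) * (z ^ t * ∏ i ∈ Finset.range (x - t), (1 - z * κ ^ (t + i)))
  else 0

/-- The coefficient of the negative crossing, from the state `(s, t)` to the state `(x, y)`;
here `q` and `w` are the inverses of the parameters of the positive crossing. -/
def negWeight {R : Type*} [CommRing R] (q w : R) (s t x y : ℕ) : R :=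
  if x + y = s + t ∧ s ≤ y then
    q ^ (s * x) * gaussBinom q t x * (w ^ s * ∏ i ∈ Finset.range (y - s), (1 - w * q ^ (s + i)))
  else 0

section Operators

/-- The coefficients of the positive crossing with values in operators. -/
def posOp (j : Fin k) (s t x y : ℕ) : Op k :=
  if x + y = s + t ∧ t ≤ x then
    (qInv ^ (t * y) * gaussBinom qInv s (x - t)) • (aPlus j ^ (x - t) * (bPlus j ^ y * cPlus j ^ t))
  else 0

/-- The coefficients of the negative crossing with values in operators. -/
def negOp (j : Fin k) (s t x y : ℕ) : Op k :=
  if x + y = s + t ∧ s ≤ y then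
    (qInv ^ (s * x) * gaussBinom (LaurentPolynomial.T 1) t x) •
      (cMinus j ^ s * (bMinus j ^ x * aMinus j ^ (y - s)))
  else 0

theorem posOp_zero (j : Fin k) (t x y : ℕ) :
    posOp j 0 t x y = if x = t ∧ y = 0 then cPlus j ^ t else 0 := by
  rw [posOp]
  by_cases h : x = t ∧ y = 0
  · obtain ⟨rfl, rfl⟩ := h
    simp [gaussBinom]
  · rw [if_neg h, if_neg (by omega)]

/-- Peeling off a X₁ + b X₂: b commutes with a, and X₂ crosses X₁^x at the cost of κ^x, so the
coefficients obey the κ-Pascal rule. -/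
theorem posOp_succ (j : Fin k) (s t x y : ℕ) :
    posOp j (s + 1) t x y = (aPlus j * if 0 < x then posOp j s t (x - 1) y else 0) +
      bPlus j * if 0 < y then qInv ^ x • posOp j s t x (y - 1) else 0 := by
  by_cases h : x + y = s + 1 + t ∧ t ≤ x
  · obtain ⟨h1, h2⟩ := h
    obtain ⟨m, rfl⟩ := Nat.exists_eq_add_of_le h2
    have hb : ∀ l, 0 < l → bPlus j * (aPlus j ^ m * (bPlus j ^ (l - 1) * cPlus j ^ t)) =
        aPlus j ^ m * (bPlus j ^ l * cPlus j ^ t) := by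
      intro l hl
      have hc : Commute (bPlus j) (aPlus j ^ m) :=
        (show Commute (bPlus j) (aPlus j) from (aPlus_mul_bPlus j).symm).pow_right m
      rw [← mul_assoc, hc.eq, mul_assoc, ← mul_assoc (bPlus j), ← pow_succ',
        Nat.sub_add_cancel hl]
    rcases Nat.eq_zero_or_pos m with rfl | hm
    · have hy : y = s + 1 := by omega
      subst hy
      have hz : posOp j s t (t + 0 - 1) (s + 1) = 0 ∨ t + 0 = 0 := by
        by_cases ht : t = 0
        · exact Or.inr ht
        · left; rw [posOp, if_neg (by omega)]
      have hfirst : (aPlus j * if 0 < t + 0 then posOp j s t (t + 0 - 1) (s + 1) else 0) = 0 := by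
        split_ifs with ht
        · rcases hz with hz | hz
          · rw [hz, mul_zero]
          · omega
        · rw [mul_zero]
      rw [hfirst, zero_add, if_pos (Nat.succ_pos s), posOp, posOp, if_pos (by omega),
        if_pos (by omega)]
      have := hb (s + 1) (Nat.succ_pos s)
      simp only [Nat.add_sub_cancel, add_zero, Nat.sub_self, gaussBinom_zero_right, mul_one,
        mul_smul_comm, smul_smul, pow_zero, one_mul] at this ⊢
      rw [this, ← pow_add]
      congr 2
      ring
    · obtain ⟨m, rfl⟩ : ∃ m', m = m' + 1 := ⟨m - 1, by omega⟩
      rw [if_pos (by omega), posOp, posOp, if_pos (by omega), if_pos (by omega),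
        show t + (m + 1) - t = m + 1 by omega, show t + (m + 1) - 1 - t = m by omega,
        gaussBinom_succ_succ, mul_smul_comm, ← mul_assoc (aPlus j), ← pow_succ', mul_add, add_smul]
      congr 1
      rcases Nat.eq_zero_or_pos y with rfl | hy
      · rw [gaussBinom_eq_zero _ (show s < m + 1 by omega)]
        simp
      · rw [if_pos hy, posOp, if_pos (by omega), show t + (m + 1) - t = m + 1 by omega,
          mul_smul_comm, mul_smul_comm, hb y hy, smul_smul]
        congr 1
        obtain ⟨y, rfl⟩ : ∃ y', y = y' + 1 := ⟨y - 1, by omega⟩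
        rw [Nat.add_sub_cancel]
        ring
  · rw [posOp, if_neg h]
    have e1 : (if 0 < x then posOp j s t (x - 1) y else 0) = 0 := by
      split_ifs
      · rw [posOp, if_neg (by omega)]
      · rfl
    have e2 : (if 0 < y then qInv ^ x • posOp j s t x (y - 1) else 0) = 0 := by
      split_ifs
      · rw [posOp, if_neg (by omega), smul_zero]
      · rfl
    rw [e1, e2, mul_zero, mul_zero, add_zero]

theorem negOp_succ_left (j : Fin k) (s t x y : ℕ) :
    negOp j (s + 1) t x y = cMinus j * if 0 < y then qInv ^ x • negOp j s t x (y - 1) else 0 := by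
  by_cases h : x + y = s + 1 + t ∧ s + 1 ≤ y
  · rw [negOp, if_pos h, if_pos (by omega), negOp, if_pos (by omega), mul_smul_comm, mul_smul_comm,
      ← mul_assoc (cMinus j), ← pow_succ', smul_smul, show y - (s + 1) = y - 1 - s by omega]
    congr 1
    ring
  · rw [negOp, if_neg h]
    split_ifs
    · rw [negOp, if_neg (by omega), smul_zero, mul_zero]
    · rw [mul_zero]

theorem aMinus_mul_bMinus_pow (j : Fin k) (x : ℕ) :
    aMinus j * bMinus j ^ x = (LaurentPolynomial.T 2 : Rq) ^ x • (bMinus j ^ x * aMinus j) := by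
  induction x with
  | zero => simp
  | succ x ih =>
    rw [pow_succ, ← mul_assoc, ih, smul_mul_assoc, mul_assoc, aMinus_mul_bMinus, mul_smul_comm,
      smul_smul, ← mul_assoc, pow_succ]

/-- Moving a past b^x gives q^(2x) while moving X₂ past X₁^x gives q^(-x). The net q^x explains why
this binomial coefficient is taken at q and the one of the positive letter at q⁻¹. -/
theorem negOp_succ_right (j : Fin k) (t x y : ℕ) :
    negOp j 0 (t + 1) x y = (bMinus j * if 0 < x then negOp j 0 t (x - 1) y else 0) +
      aMinus j * if 0 < y then qInv ^ x • negOp j 0 t x (y - 1) else 0 := by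
  have hq2 : ∀ x : ℕ, qInv ^ x * (LaurentPolynomial.T 2 : Rq) ^ x = LaurentPolynomial.T 1 ^ x := by
    intro x
    rw [← mul_pow, qInv, T_mul_T]
    rfl
  by_cases h : x + y = t + 1
  · have ha : 0 < y → aMinus j * (qInv ^ x • negOp j 0 t x (y - 1)) =
        ((LaurentPolynomial.T 1 : Rq) ^ x * gaussBinom (LaurentPolynomial.T 1) t x) •
          (bMinus j ^ x * aMinus j ^ y) := by
      intro hy
      rw [negOp, if_pos (by omega), smul_smul, mul_smul_comm]
      simp only [zero_mul, pow_zero, one_mul, Nat.sub_zero]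
      rw [← mul_assoc (aMinus j), aMinus_mul_bMinus_pow, smul_mul_assoc, smul_smul,
        mul_assoc (bMinus j ^ x), ← pow_succ', Nat.sub_add_cancel hy]
      congr 1
      rw [← hq2]
      ring
    rcases Nat.eq_zero_or_pos x with rfl | hx
    · rw [if_neg (lt_irrefl 0), mul_zero, zero_add, if_pos (by omega), ha (by omega), negOp,
        if_pos (by omega)]
      simp [gaussBinom_zero_right]
    · obtain ⟨x, rfl⟩ : ∃ x', x = x' + 1 := ⟨x - 1, by omega⟩
      rw [if_pos hx, negOp, negOp, if_pos (by omega), if_pos (by omega), Nat.add_sub_cancel,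
        gaussBinom_succ_succ]
      simp only [zero_mul, pow_zero, one_mul, Nat.sub_zero]
      rw [mul_smul_comm, ← mul_assoc (bMinus j), ← pow_succ', add_smul]
      congr 1
      rcases Nat.eq_zero_or_pos y with rfl | hy
      · rw [gaussBinom_eq_zero _ (show t < x + 1 by omega)]
        simp
      · rw [if_pos hy, ha hy]
  · rw [negOp, if_neg (by omega)]
    have e1 : (if 0 < x then negOp j 0 t (x - 1) y else 0) = 0 := by
      split_ifs
      · rw [negOp, if_neg (by omega)]
      · rfl
    have e2 : (if 0 < y then qInv ^ x • negOp j 0 t x (y - 1) else 0) = 0 := by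
      split_ifs
      · rw [negOp, if_neg (by omega), smul_zero]
      · rfl
    rw [e1, e2, mul_zero, mul_zero, add_zero]

end Operators

/-- The coefficient of a letter with the given sign. -/
def crossingWeight (N : ℕ) (positive : Bool) (s t x y : ℕ) : Rq :=
  if positive then posWeight qInv (LaurentPolynomial.T ((N : ℤ) - 1)) s t x y
  else negWeight (LaurentPolynomial.T 1) (LaurentPolynomial.T (-((N : ℤ) - 1))) s t x y

theorem evalLin_posOp (N : ℕ) (j : Fin k) (s t x y : ℕ) :
    evalLin k N (posOp j s t x y) =
      posWeight qInv (LaurentPolynomial.T ((N : ℤ) - 1)) s t x y := by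
  rw [posOp, posWeight]
  split_ifs
  · rw [map_smul, evalLin_plus, smul_eq_mul]
    congr 2
    · rw [LaurentPolynomial.T_pow, mul_comm]
    · refine Finset.prod_congr rfl fun i _ => ?_
      rw [qInv, LaurentPolynomial.T_pow, T_mul_T]
      congr 2
      push_cast
      ring
  · exact map_zero _

/-- The evaluation of the ordered monomial contributes q^(2sx), which turns the prefactor q^(-sx)
into q^(sx). -/
theorem evalLin_negOp (N : ℕ) (j : Fin k) (s t x y : ℕ) :
    evalLin k N (negOp j s t x y) =
      negWeight (LaurentPolynomial.T 1) (LaurentPolynomial.T (-((N : ℤ) - 1))) s t x y := by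
  rw [negOp, negWeight]
  split_ifs
  · rw [map_smul, evalLin_minus, smul_eq_mul, ← mul_assoc, ← mul_assoc]
    congr 1
    · rw [mul_right_comm, mul_right_comm (LaurentPolynomial.T 1 ^ _), qInv,
        LaurentPolynomial.T_pow, LaurentPolynomial.T_pow, LaurentPolynomial.T_pow, T_mul_T, T_mul_T]
      congr 2
      push_cast
      ring
    · refine Finset.prod_congr rfl fun i _ => ?_
      rw [LaurentPolynomial.T_pow, T_mul_T]
      congr 2
      push_cast
      ring
  · exact map_zero _

theorem evalLin_letter (N : ℕ) (γ : BraidWord n k) (j : Fin k) (m m' : Fin (n + 1) → ℕ)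
    [Decidable (SameOff (γ j).1 m m')] :
    evalLin k N (symCoeff qInv (letterMatrix γ j) m m') = if SameOff (γ j).1 m m' then
      crossingWeight N (γ j).2 (m (γ j).1.castSucc) (m (γ j).1.succ) (m' (γ j).1.castSucc)
        (m' (γ j).1.succ) else 0 := by
  rw [letterMatrix]
  rcases hb : (γ j).2 with _ | _
  · rw [symCoeff_blockSum (γ j).1 (rightQuantum_sBlock false j) (negOp j)]
    · split_ifs
      · rw [evalLin_negOp]; rfl
      · exact map_zero _
    · intro x y
      rw [negOp]
      by_cases h : x = 0 ∧ y = 0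
      · obtain ⟨rfl, rfl⟩ := h
        simp [gaussBinom]
      · rw [if_neg h, if_neg (by omega)]
    · intro s t x y
      rw [negOp_succ_left, show sBlock false j 0 0 = 0 from rfl, zero_mul, zero_add]
      rfl
    · exact negOp_succ_right j
  · rw [symCoeff_blockSum (γ j).1 (rightQuantum_sBlock true j) (posOp j)]
    · split_ifs
      · rw [evalLin_posOp]; rfl
      · exact map_zero _
    · intro x y
      rw [posOp_zero]
      simp
    · exact posOp_succ j
    · intro t x y
      rw [show sBlock true j 1 1 = 0 from rfl, zero_mul, add_zero, posOp_zero]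
      have e : sBlock true j 1 0 = cPlus j := rfl
      rw [e]
      by_cases h : x = t + 1 ∧ y = 0
      · obtain ⟨rfl, rfl⟩ := h
        rw [if_pos ⟨rfl, rfl⟩, if_pos (Nat.succ_pos t), posOp_zero, if_pos ⟨by omega, rfl⟩, pow_succ']
      · rw [if_neg h]
        split_ifs
        · rw [posOp_zero, if_neg (by omega), mul_zero]
        · rw [mul_zero]

end

section

/-! ### Identities between the weights of crossings -/

section Weights

variable {F : Type*} [Field F] {κ z : F}

theorem map_gaussBinom {R S : Type*} [CommRing R] [CommRing S] (f : R →+* S) (κ : R) (s l : ℕ) :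
    f (gaussBinom κ s l) = gaussBinom (f κ) s l := by
  induction s generalizing l with
  | zero => cases l <;> simp [gaussBinom]
  | succ s ih =>
    cases l with
    | zero => simp [gaussBinom]
    | succ l => simp [gaussBinom_succ_succ, ih]

theorem map_posWeight {R S : Type*} [CommRing R] [CommRing S] (f : R →+* S) (κ z : R)
    (s t x y : ℕ) : f (posWeight κ z s t x y) = posWeight (f κ) (f z) s t x y := by
  rw [posWeight, posWeight]
  split_ifs <;> simp [map_gaussBinom, map_prod]

theorem map_negWeight {R S : Type*} [CommRing R] [CommRing S] (f : R →+* S) (κ z : R)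
    (s t x y : ℕ) : f (negWeight κ z s t x y) = negWeight (f κ) (f z) s t x y := by
  rw [negWeight, negWeight]
  split_ifs <;> simp [map_gaussBinom, map_prod]

theorem qPoch_ne_zero (hκ : ∀ m : ℕ, κ ^ (m + 1) ≠ 1) (m : ℕ) : qPoch κ m ≠ 0 :=
  Finset.prod_ne_zero_iff.2 fun i _ => sub_ne_zero.2 (hκ i).symm

/-- The finite q-binomial theorem: the Pascal rule splits the sum for r + 1 at x into 1 - x times
the sum for r at xκ. It is used at x = 1, where the product vanishes unless r = 0. -/
theorem sum_gaussBinom_alternating {R : Type*} [CommRing R] (κ : R) (r : ℕ) (x : R) :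
    ∑ m ∈ Finset.range (r + 1), (-1) ^ m * κ ^ (m.choose 2) * gaussBinom κ r m * x ^ m =
      ∏ i ∈ Finset.range r, (1 - x * κ ^ i) := by
  induction r generalizing x with
  | zero => simp [gaussBinom]
  | succ r ih =>
    rw [Finset.prod_range_succ', pow_zero, mul_one, Finset.sum_range_succ']
    have hp : ∏ i ∈ Finset.range r, (1 - x * κ ^ (i + 1)) =
        ∏ i ∈ Finset.range r, (1 - x * κ * κ ^ i) :=
      Finset.prod_congr rfl fun i _ => by ring
    rw [hp, ← ih (x * κ), mul_sub, mul_one, sub_eq_add_neg, add_comm]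
    have e1 : ∑ m ∈ Finset.range (r + 1), (-1) ^ (m + 1) * κ ^ ((m + 1).choose 2) *
        gaussBinom κ (r + 1) (m + 1) * x ^ (m + 1) =
        (∑ m ∈ Finset.range (r + 1), (-1) ^ (m + 1) * κ ^ ((m + 1).choose 2) *
          gaussBinom κ r (m + 1) * (x * κ) ^ (m + 1)) +
        ∑ m ∈ Finset.range (r + 1), (-1) ^ m * κ ^ (m.choose 2) *
          gaussBinom κ r m * (x * κ) ^ m * (-x) := by
      rw [← Finset.sum_add_distrib]
      refine Finset.sum_congr rfl fun m _ => ?_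
      rw [gaussBinom_succ_succ, Nat.choose_succ_succ' m 1, Nat.choose_one_right]
      ring
    rw [e1, ← Finset.sum_mul]
    have e2 : ∑ m ∈ Finset.range (r + 1), (-1) ^ m * κ ^ (m.choose 2) *
        gaussBinom κ r m * (x * κ) ^ m =
        (∑ m ∈ Finset.range (r + 1), (-1) ^ (m + 1) * κ ^ ((m + 1).choose 2) *
          gaussBinom κ r (m + 1) * (x * κ) ^ (m + 1)) + 1 := by
      rw [Finset.sum_range_succ', Finset.sum_range_succ _ r, gaussBinom_eq_zero κ (Nat.lt_succ_self r)]
      simp [gaussBinom_zero_right]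
    rw [gaussBinom_zero_right]
    simp only [Nat.choose_zero_succ, pow_zero, mul_one]
    linear_combination (-1) * e2

/-- Both sides are the κ-trinomial coefficient of (p, j, m); the denominators may be cancelled
because κ is not a root of unity. -/
theorem gaussBinom_mul_gaussBinom (hκ : ∀ m : ℕ, κ ^ (m + 1) ≠ 1) (p j m : ℕ) :
    gaussBinom κ (p + j + m) m * gaussBinom κ (p + j) p =
      gaussBinom κ (p + j + m) p * gaussBinom κ (j + m) m := by
  have h1 := gaussBinom_mul_qPoch κ m (p + j)
  have h2 := gaussBinom_mul_qPoch κ p j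
  have h3 := gaussBinom_mul_qPoch κ p (j + m)
  have h4 := gaussBinom_mul_qPoch κ m j
  rw [show m + (p + j) = p + j + m by ring] at h1
  rw [show p + (j + m) = p + j + m by ring] at h3
  rw [show m + j = j + m by ring] at h4
  have n1 := qPoch_ne_zero hκ m
  have n2 := qPoch_ne_zero hκ j
  have n3 := qPoch_ne_zero hκ p
  have n4 := qPoch_ne_zero hκ (p + j)
  have n5 := qPoch_ne_zero hκ (j + m)
  apply mul_right_cancel₀ (mul_ne_zero (mul_ne_zero n1 n2) n3)
  apply mul_right_cancel₀ (mul_ne_zero n4 n5)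
  linear_combination (gaussBinom κ (p + j) p * qPoch κ j * qPoch κ p * qPoch κ (j + m)) * h1 +
    qPoch κ (p + j + m) * qPoch κ (j + m) * h2
    - gaussBinom κ (j + m) m * (qPoch κ m * qPoch κ j * qPoch κ (p + j)) * h3
    - qPoch κ (p + j + m) * qPoch κ (p + j) * h4

theorem qPoch_inv (hκ0 : κ ≠ 0) (m : ℕ) :
    (-1) ^ m * κ ^ ((m + 1).choose 2) * qPoch κ⁻¹ m = qPoch κ m := by
  induction m with
  | zero => simp [qPoch]
  | succ m ih =>
    rw [qPoch_succ, qPoch_succ, ← ih, Nat.choose_succ_succ' (m + 1) 1, Nat.choose_one_right]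
    have : κ ^ (m + 1) * κ⁻¹ ^ (m + 1) = 1 := by rw [← mul_pow, mul_inv_cancel₀ hκ0, one_pow]
    rw [pow_add κ (m + 1), pow_succ (-1 : F)]
    linear_combination (((-1 : F) ^ m) * κ ^ ((m + 1).choose 2) * qPoch κ⁻¹ m) * this

theorem gaussBinom_inv (hκ0 : κ ≠ 0) (hκ : ∀ m : ℕ, κ ^ (m + 1) ≠ 1) (a b : ℕ) :
    κ ^ (a * b) * gaussBinom κ⁻¹ (a + b) a = gaussBinom κ (a + b) a := by
  have h1 := gaussBinom_mul_qPoch κ a b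
  have h2 := gaussBinom_mul_qPoch κ⁻¹ a b
  have n1 := qPoch_ne_zero hκ a
  have n2 := qPoch_ne_zero hκ b
  apply mul_right_cancel₀ (mul_ne_zero n1 n2)
  rw [h1, ← qPoch_inv hκ0 a, ← qPoch_inv hκ0 b, ← qPoch_inv hκ0 (a + b), ← h2]
  have hc : (a + b + 1).choose 2 = (a + 1).choose 2 + (b + 1).choose 2 + a * b := by
    rw [show a + b + 1 = (a + 1) + b by ring]
    induction b with
    | zero => simp
    | succ b ih =>
      rw [show a + 1 + (b + 1) = (a + 1 + b) + 1 by ring, Nat.choose_succ_succ' (a + 1 + b) 1,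
        Nat.choose_succ_succ' (b + 1) 1, Nat.choose_one_right, Nat.choose_one_right,
        ih (gaussBinom_mul_qPoch κ a b) (gaussBinom_mul_qPoch κ⁻¹ a b) (qPoch_ne_zero hκ b)]
      ring
  rw [hc]
  ring

theorem prod_reverse_sign (hκ0 : κ ≠ 0) (hz0 : z ≠ 0) (t m : ℕ) :
    ∏ i ∈ Finset.range m, (1 - z * κ ^ (t + i)) =
      (-z) ^ m * κ ^ (t * m + m.choose 2) *
        ∏ i ∈ Finset.range m, (1 - z⁻¹ * κ⁻¹ ^ (t + i)) := by
  induction m with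
  | zero => simp
  | succ m ih =>
    rw [Finset.prod_range_succ, Finset.prod_range_succ, ih, Nat.choose_succ_succ' m 1,
      Nat.choose_one_right]
    have h1 : κ ^ (t + m) * κ⁻¹ ^ (t + m) = 1 := by rw [← mul_pow, mul_inv_cancel₀ hκ0, one_pow]
    have h2 : z * z⁻¹ = 1 := mul_inv_cancel₀ hz0
    have h3 : 1 - z * κ ^ (t + m) = -z * κ ^ (t + m) * (1 - z⁻¹ * κ⁻¹ ^ (t + m)) := by
      linear_combination (-(κ ^ (t + m) * κ⁻¹ ^ (t + m))) * h2 - h1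
    rw [h3]
    ring

/-- The positive product is rewritten in z⁻¹ and κ⁻¹ so that it concatenates with the negative one
into a product of length j + m. What remains depends on m at fixed j + m only through a term of the
q-binomial theorem at x = 1. -/
theorem posWeight_mul_negWeight (hκ0 : κ ≠ 0) (hz0 : z ≠ 0) (hκ : ∀ m : ℕ, κ ^ (m + 1) ≠ 1)
    (p j m t : ℕ) :
    posWeight κ z (p + j + m) t (t + m) (p + j) *
        negWeight κ⁻¹ z⁻¹ (t + m) (p + j) p (t + (j + m)) =
      gaussBinom κ (p + j + m) p * (∏ i ∈ Finset.range (j + m), (1 - z⁻¹ * κ⁻¹ ^ (t + i))) *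
        κ ^ (t * (j + m)) * κ⁻¹ ^ (p * (j + m)) *
        ((-1) ^ m * κ ^ (m.choose 2) * gaussBinom κ (j + m) m * 1 ^ m) := by
  rw [posWeight, negWeight, if_pos (by omega), if_pos (by omega), Nat.add_sub_cancel_left,
    show t + (j + m) - (t + m) = j by omega, prod_reverse_sign hκ0 hz0, add_comm j m,
    Finset.prod_range_add]
  have h1 := gaussBinom_mul_gaussBinom hκ p j m
  have h2 := gaussBinom_inv hκ0 hκ p j
  have hκκ : ∀ e : ℕ, κ ^ e * κ⁻¹ ^ e = 1 := fun e => by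
    rw [← mul_pow, mul_inv_cancel₀ hκ0, one_pow]
  have hzz : z ^ (t + m) * z⁻¹ ^ (t + m) = 1 := by rw [← mul_pow, mul_inv_cancel₀ hz0, one_pow]
  rw [← h2] at h1
  rw [add_comm m j]
  simp only [add_assoc] at *
  generalize ∏ i ∈ Finset.range m, (1 - z⁻¹ * κ⁻¹ ^ (t + i)) = P1
  generalize ∏ i ∈ Finset.range j, (1 - z⁻¹ * κ⁻¹ ^ (t + (m + i))) = P2
  have e1 : κ⁻¹ ^ ((t + m) * p) = κ ^ (p * j) * κ⁻¹ ^ (p * (j + m)) * κ⁻¹ ^ (t * p) := by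
    rw [show (t + m) * p = t * p + m * p by ring, show p * (j + m) = p * j + m * p by ring, pow_add,
      pow_add]
    linear_combination (-(κ⁻¹ ^ (t * p) * κ⁻¹ ^ (m * p))) * hκκ (p * j)
  have e2 : κ ^ (t * (p + j)) * κ ^ (t * m + m.choose 2) =
      κ ^ (t * p) * κ ^ (t * (j + m)) * κ ^ m.choose 2 := by
    rw [← pow_add, ← pow_add, ← pow_add]
    ring
  have e3 : z ^ t * (-z) ^ m * z⁻¹ ^ (t + m) = (-1) ^ m := by
    rw [neg_pow]
    rw [pow_add z] at hzz
    linear_combination (-1) ^ m * hzz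
  calc _ = (κ ^ (t * (p + j)) * κ ^ (t * m + m.choose 2)) * (z ^ t * (-z) ^ m * z⁻¹ ^ (t + m)) *
        κ⁻¹ ^ ((t + m) * p) * (gaussBinom κ (p + (j + m)) m * gaussBinom κ⁻¹ (p + j) p) *
        P1 * P2 := by ring
    _ = (κ ^ (t * p) * κ⁻¹ ^ (t * p)) * (κ ^ (t * (j + m)) * κ ^ m.choose 2) * (-1) ^ m *
        κ⁻¹ ^ (p * (j + m)) * (gaussBinom κ (p + (j + m)) m * (κ ^ (p * j) *
          gaussBinom κ⁻¹ (p + j) p)) * P1 * P2 := by rw [e1, e2, e3]; ring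
    _ = _ := by rw [hκκ, h1]; ring

/-- The weights of the negative crossing are inverse to those of the positive crossing. -/
theorem sum_posWeight_mul_negWeight (hκ0 : κ ≠ 0) (hz0 : z ≠ 0)
    (hκ : ∀ m : ℕ, κ ^ (m + 1) ≠ 1) (s t x y : ℕ) :
    ∑ l ∈ Finset.range (s + 1), posWeight κ z s t (s + t - l) l *
        negWeight κ⁻¹ z⁻¹ (s + t - l) l x y = if s = x ∧ t = y then 1 else 0 := by
  by_cases hxy : x + y = s + t
  swap
  · rw [if_neg (by omega)]
    refine Finset.sum_eq_zero fun l hl => ?_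
    rw [Finset.mem_range] at hl
    rw [negWeight, if_neg (by omega), mul_zero]
  by_cases hxs : x ≤ s
  swap
  · rw [if_neg (by omega)]
    refine Finset.sum_eq_zero fun l hl => ?_
    rw [Finset.mem_range] at hl
    rw [negWeight, if_neg (by omega), mul_zero]
  obtain ⟨r, rfl⟩ := Nat.exists_eq_add_of_le hxs
  obtain rfl : y = t + r := by omega
  -- After the reflection l = s - m, where m is the excess of the intermediate first content over t;
  -- only m ≤ r contributes.
  rw [← Finset.sum_range_reflect]
  have hsub : Finset.range (r + 1) ⊆ Finset.range (x + r + 1) :=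
    Finset.range_subset_range.2 (by omega)
  rw [← Finset.sum_subset hsub]
  · have hterm : ∀ m ∈ Finset.range (r + 1), posWeight κ z (x + r) t
        (x + r + t - (x + r + 1 - 1 - m)) (x + r + 1 - 1 - m) *
        negWeight κ⁻¹ z⁻¹ (x + r + t - (x + r + 1 - 1 - m)) (x + r + 1 - 1 - m) x (t + r) =
        gaussBinom κ (x + r) x * (∏ i ∈ Finset.range r, (1 - z⁻¹ * κ⁻¹ ^ (t + i))) *
        κ ^ (t * r) * κ⁻¹ ^ (x * r) *
        ((-1) ^ m * κ ^ (m.choose 2) * gaussBinom κ r m * 1 ^ m) := by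
      intro m hm
      rw [Finset.mem_range] at hm
      obtain ⟨j, rfl⟩ : ∃ j, r = j + m := ⟨r - m, by omega⟩
      have := posWeight_mul_negWeight hκ0 hz0 hκ x j m t
      rw [show x + (j + m) + t - (x + (j + m) + 1 - 1 - m) = t + m by omega,
        show x + (j + m) + 1 - 1 - m = x + j by omega, ← add_assoc x j m, this]
    rw [Finset.sum_congr rfl hterm, ← Finset.mul_sum, sum_gaussBinom_alternating]
    rcases Nat.eq_zero_or_pos r with rfl | hr
    · simp [gaussBinom_self]
    · rw [if_neg (by omega), Finset.prod_eq_zero (f := fun i => 1 - 1 * κ ^ i)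
        (Finset.mem_range.2 hr) (by simp), mul_zero]
  · intro m hm hm'
    rw [Finset.mem_range] at hm hm'
    rw [negWeight, if_neg (by omega), mul_zero]

/-- The commutation of the weights of the positive crossing with the lowering operator. -/
theorem posWeight_lower (hκ : ∀ m : ℕ, κ ^ (m + 1) ≠ 1) (s t x y : ℕ) :
    (1 - κ ^ s) * posWeight κ z (s - 1) t x y + z * κ ^ s * (1 - κ ^ t) * posWeight κ z s (t - 1) x y =
      posWeight κ z s t (x + 1) y * (1 - κ ^ (x + 1)) +
        posWeight κ z s t x (y + 1) * (z * κ ^ x * (1 - κ ^ (y + 1))) := by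
  by_cases hs : x + y + 1 = s + t
  swap
  · have e1 : posWeight κ z s t (x + 1) y = 0 := if_neg (by omega)
    have e2 : posWeight κ z s t x (y + 1) = 0 := if_neg (by omega)
    rw [e1, e2]
    have e3 : (1 - κ ^ s) * posWeight κ z (s - 1) t x y = 0 := by
      cases s with
      | zero => simp
      | succ s => rw [posWeight, if_neg (by omega), mul_zero]
    have e4 : z * κ ^ s * (1 - κ ^ t) * posWeight κ z s (t - 1) x y = 0 := by
      cases t with
      | zero => simp
      | succ s => rw [posWeight, if_neg (by omega), mul_zero]
    rw [e3, e4]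
    ring
  by_cases htx : t ≤ x + 1
  swap
  · have e1 : posWeight κ z s t (x + 1) y = 0 := if_neg (by omega)
    have e2 : posWeight κ z s t x (y + 1) = 0 := if_neg (by omega)
    have e3 : posWeight κ z (s - 1) t x y = 0 := if_neg (by omega)
    have e4 : posWeight κ z s (t - 1) x y = 0 := if_neg (by omega)
    rw [e1, e2, e3, e4]
    ring
  obtain ⟨m, hm⟩ := Nat.exists_eq_add_of_le htx
  obtain rfl : s = y + m := by omega
  rcases Nat.eq_zero_or_pos m with rfl | hm0
  · obtain rfl : t = x + 1 := by omega
    have e2 : posWeight κ z (y + 0) (x + 1) x (y + 1) = 0 := if_neg (by omega)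
    have e3 : posWeight κ z (y + 0 - 1) (x + 1) x y = 0 := if_neg (by omega)
    rw [e2, e3, posWeight, posWeight, if_pos (by omega), if_pos (by omega)]
    simp only [add_zero, Nat.add_sub_cancel, Nat.sub_self, Finset.prod_range_zero,
      gaussBinom_zero_right]
    ring
  · obtain ⟨m, rfl⟩ : ∃ m', m = m' + 1 := ⟨m - 1, by omega⟩
    obtain rfl : x = t + m := by omega
    have n1 := qPoch_ne_zero hκ m
    have n2 := qPoch_ne_zero hκ y
    have b0 := gaussBinom_mul_qPoch κ (m + 1) y
    -- Absorption identities: b1 and b2 reduce all the binomials of the relation to a single one.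
    have b1 : (1 - κ ^ (y + (m + 1))) * gaussBinom κ (y + m) m =
        (1 - κ ^ (m + 1)) * gaussBinom κ (y + (m + 1)) (m + 1) := by
      have h := gaussBinom_mul_qPoch κ m y
      apply mul_right_cancel₀ (mul_ne_zero n1 n2)
      rw [show m + 1 + y = y + m + 1 by ring, qPoch_succ, qPoch_succ] at b0
      rw [show m + y = y + m by ring] at h
      rw [← add_assoc]
      linear_combination (1 - κ ^ (y + m + 1)) * h - b0
    have b2 : (1 - κ ^ (y + 1)) * gaussBinom κ (y + (m + 1)) m =
        (1 - κ ^ (m + 1)) * gaussBinom κ (y + (m + 1)) (m + 1) := by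
      have h := gaussBinom_mul_qPoch κ m (y + 1)
      apply mul_right_cancel₀ (mul_ne_zero n1 n2)
      rw [show m + 1 + y = y + (m + 1) by ring, qPoch_succ κ m] at b0
      rw [show m + (y + 1) = y + (m + 1) by ring, qPoch_succ κ y] at h
      linear_combination h - b0
    have e1 : posWeight κ z (y + (m + 1) - 1) t (t + m) y = κ ^ (t * y) * gaussBinom κ (y + m) m *
        (z ^ t * ∏ i ∈ Finset.range m, (1 - z * κ ^ (t + i))) := by
      rw [posWeight, if_pos (by omega), Nat.add_sub_cancel_left]
      rfl
    have e2 : posWeight κ z (y + (m + 1)) t (t + m + 1) y =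
        κ ^ (t * y) * gaussBinom κ (y + (m + 1)) (m + 1) *
        (z ^ t * ((∏ i ∈ Finset.range m, (1 - z * κ ^ (t + i))) * (1 - z * κ ^ (t + m)))) := by
      rw [posWeight, if_pos (by omega), show t + m + 1 - t = m + 1 by omega, Finset.prod_range_succ]
    have e3 : posWeight κ z (y + (m + 1)) t (t + m) (y + 1) =
        κ ^ (t * (y + 1)) * gaussBinom κ (y + (m + 1)) m *
        (z ^ t * ∏ i ∈ Finset.range m, (1 - z * κ ^ (t + i))) := by
      rw [posWeight, if_pos (by omega), Nat.add_sub_cancel_left]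
    rw [e1, e2, e3]
    cases t with
    | zero =>
      simp only [pow_zero, sub_self, mul_zero, zero_mul, add_zero, zero_add, one_mul]
      linear_combination (∏ i ∈ Finset.range m, (1 - z * κ ^ i)) * b1 -
        (∏ i ∈ Finset.range m, (1 - z * κ ^ i)) * z * κ ^ m * b2
    | succ t =>
      have e4 : posWeight κ z (y + (m + 1)) (t + 1 - 1) (t + 1 + m) y =
          κ ^ (t * y) * gaussBinom κ (y + (m + 1)) (m + 1) *
          (z ^ t * ((∏ i ∈ Finset.range m, (1 - z * κ ^ (t + 1 + i))) * (1 - z * κ ^ t))) := by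
        rw [Nat.add_sub_cancel, posWeight, if_pos (by omega), show t + 1 + m - t = m + 1 by omega,
          Finset.prod_range_succ', add_zero]
        simp only [add_assoc, add_comm 1]
      rw [e4]
      generalize ∏ i ∈ Finset.range m, (1 - z * κ ^ (t + 1 + i)) = P
      linear_combination κ ^ ((t + 1) * y) * z ^ (t + 1) * P * b1 -
        κ ^ ((t + 1) * (y + 1)) * z ^ (t + 1) * P * z * κ ^ (t + 1 + m) * b2

end Weights

end

section

/-! ### The matrices of the crossings on two strands -/

section Bounded

/-- The relation z κ^(N-1) = 1 makes the factor at t + i = N - 1 vanish. Thus the states with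
contents below N are stable. -/
theorem posWeight_eq_zero {R : Type*} [CommRing R] {κ z : R} {N s t x y : ℕ}
    (hz : z * κ ^ (N - 1) = 1) (ht : t < N) (hx : N ≤ x) : posWeight κ z s t x y = 0 := by
  rw [posWeight]
  split_ifs with h
  · rw [Finset.prod_eq_zero (Finset.mem_range.2 (show N - 1 - t < x - t by omega)), mul_zero,
      mul_zero]
    rw [show t + (N - 1 - t) = N - 1 by omega, hz, sub_self]
  · rfl

theorem negWeight_eq_zero {R : Type*} [CommRing R] {q w : R} {N s t x y : ℕ}
    (hw : w * q ^ (N - 1) = 1) (hs : s < N) (hy : N ≤ y) : negWeight q w s t x y = 0 := by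
  rw [negWeight]
  split_ifs with h
  · rw [Finset.prod_eq_zero (Finset.mem_range.2 (show N - 1 - s < y - s by omega)), mul_zero,
      mul_zero]
    rw [show s + (N - 1 - s) = N - 1 by omega, hw, sub_self]
  · rfl

theorem posWeight_eq_zero_right {R : Type*} [CommRing R] {κ z : R} {s t x y : ℕ}
    (h : s < y) : posWeight κ z s t x y = 0 := if_neg (by omega)

theorem negWeight_eq_zero_left {R : Type*} [CommRing R] {q w : R} {s t x y : ℕ}
    (h : t < x) : negWeight q w s t x y = 0 := if_neg (by omega)

end Bounded

section TwoStrands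

variable {F : Type*} [Field F] {κ z : F} {N : ℕ}

/-- The matrix of a positive crossing. -/
def posMat (N : ℕ) (κ z : F) : Matrix (Fin N × Fin N) (Fin N × Fin N) F :=
  Matrix.of fun a b => posWeight κ z a.1 a.2 b.1 b.2

/-- The matrix of a negative crossing. -/
def negMat (N : ℕ) (κ z : F) : Matrix (Fin N × Fin N) (Fin N × Fin N) F :=
  Matrix.of fun a b => negWeight κ⁻¹ z⁻¹ a.1 a.2 b.1 b.2

/-- The inversion formula for weights restricts to contents below N, because intermediate contents
at or above N have weight 0. -/
theorem posMat_mul_negMat (hκ0 : κ ≠ 0) (hz : z * κ ^ (N - 1) = 1)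
    (hκ : ∀ m : ℕ, κ ^ (m + 1) ≠ 1) : posMat N κ z * negMat N κ z = 1 := by
  ext ⟨s, t⟩ ⟨x, y⟩
  have hz0 : z ≠ 0 := left_ne_zero_of_mul (hz.symm ▸ one_ne_zero)
  have h := sum_posWeight_mul_negWeight hκ0 hz0 hκ s t x y
  rw [Matrix.mul_apply, Matrix.one_apply]
  have e : (if ((s, t) : Fin N × Fin N) = (x, y) then (1 : F) else 0) =
      if (s : ℕ) = x ∧ (t : ℕ) = y then 1 else 0 := by
    simp only [Prod.mk.injEq, Fin.ext_iff]
  rw [e, ← h]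
  symm
  rw [← Finset.sum_filter_of_ne (p := fun l => (s : ℕ) + t - l < N)]
  · refine Finset.sum_bij_ne_zero (fun l hl _ => (⟨s + t - l, (Finset.mem_filter.1 hl).2⟩,
      ⟨l, by have := Finset.mem_range.1 (Finset.mem_filter.1 hl).1; omega⟩)) ?_ ?_ ?_ ?_
    · intro l hl _
      exact Finset.mem_univ _
    · intro l hl _ l' hl' _ heq
      simpa using congrArg (fun a : Fin N × Fin N => (a.2 : ℕ)) heq
    · rintro ⟨a, b⟩ _ hne
      have hp : posWeight κ z s t a b ≠ 0 := left_ne_zero_of_mul hne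
      have hcond : (a : ℕ) + b = s + t ∧ (t : ℕ) ≤ a := by
        by_contra hcon
        exact hp (if_neg hcon)
      have ha : (s : ℕ) + t - b = a := by omega
      refine ⟨b, ?_, ?_, ?_⟩
      · rw [Finset.mem_filter, Finset.mem_range]
        exact ⟨by omega, by omega⟩
      · rw [ha]
        exact hne
      · simp only [ha]
    · intro l hl _
      rfl
  · intro l _ hne
    by_contra hcon
    exact hne (by rw [posWeight_eq_zero hz t.2 (not_lt.1 hcon), zero_mul])

/-- The lowering operator on one strand, acting on rows. -/
def lowMat (N : ℕ) (κ : F) : Matrix (Fin N) (Fin N) F :=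
  Matrix.of fun a b => if (b : ℕ) + 1 = a then 1 - κ ^ (a : ℕ) else 0

/-- The group-like operator on one strand. -/
def cartMat (N : ℕ) (κ z : F) : Matrix (Fin N) (Fin N) F :=
  Matrix.diagonal fun a => z * κ ^ (a : ℕ)

theorem sum_lowMat_mul (s : Fin N) (f : ℕ → F) :
    ∑ a, lowMat N κ s a * f a = (1 - κ ^ (s : ℕ)) * f (s - 1) := by
  rcases Nat.eq_zero_or_pos (s : ℕ) with hs | hs
  · rw [hs, pow_zero, sub_self, zero_mul]
    refine Finset.sum_eq_zero fun a _ => ?_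
    rw [lowMat, Matrix.of_apply, if_neg (by omega), zero_mul]
  · rw [Finset.sum_eq_single ⟨s - 1, by omega⟩]
    · rw [lowMat, Matrix.of_apply, if_pos (Nat.sub_add_cancel hs)]
    · intro a _ ha
      rw [lowMat, Matrix.of_apply, if_neg, zero_mul]
      intro h
      apply ha
      rw [Fin.ext_iff]
      simp only
      omega
    · simp

theorem sum_mul_lowMat (x : Fin N) (f : ℕ → F) (hf : f N = 0) :
    ∑ a : Fin N, f a * lowMat N κ a x = f (x + 1) * (1 - κ ^ ((x : ℕ) + 1)) := by
  by_cases hx : (x : ℕ) + 1 < N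
  · rw [Finset.sum_eq_single ⟨x + 1, hx⟩]
    · rw [lowMat, Matrix.of_apply, if_pos rfl]
    · intro a _ ha
      rw [lowMat, Matrix.of_apply, if_neg, mul_zero]
      intro h
      exact ha (Fin.ext h.symm)
    · simp
  · have hxN : (x : ℕ) + 1 = N := by omega
    rw [hxN, hf, zero_mul]
    refine Finset.sum_eq_zero fun a _ => ?_
    rw [lowMat, Matrix.of_apply, if_neg (by omega), mul_zero]

/-- The lowering operator on two strands. -/
def lowMat₂ (N : ℕ) (κ z : F) : Matrix (Fin N × Fin N) (Fin N × Fin N) F :=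
  lowMat N κ ⊗ₖ 1 + cartMat N κ z ⊗ₖ lowMat N κ

/-- The matrix form of `posWeight_lower`. The values at content N that the truncated sums would miss
are zero. -/
theorem posMat_commute_lowMat₂ (hz : z * κ ^ (N - 1) = 1) (hκ : ∀ m : ℕ, κ ^ (m + 1) ≠ 1) :
    Commute (posMat N κ z) (lowMat₂ N κ z) := by
  ext ⟨s, t⟩ ⟨x, y⟩
  have h := posWeight_lower (z := z) hκ s t x y
  rw [Matrix.mul_apply, Matrix.mul_apply, Fintype.sum_prod_type, Fintype.sum_prod_type]
  have e1 : ∀ a b, posMat N κ z (s, t) (a, b) * lowMat₂ N κ z (a, b) (x, y) =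
      (posWeight κ z s t a b * lowMat N κ a x) * (if b = y then 1 else 0) +
      (posWeight κ z s t a b * lowMat N κ b y) * (if a = x then z * κ ^ (x : ℕ) else 0) := by
    intro a b
    rw [lowMat₂, Matrix.add_apply, Matrix.kroneckerMap_apply, Matrix.kroneckerMap_apply,
      Matrix.one_apply, cartMat, Matrix.diagonal_apply, posMat, Matrix.of_apply]
    split_ifs with h1 h2 h2 <;> simp_all <;> ring
  have e2 : ∀ a b, lowMat₂ N κ z (s, t) (a, b) * posMat N κ z (a, b) (x, y) =
      (lowMat N κ s a * posWeight κ z a b x y) * (if b = t then 1 else 0) +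
      (lowMat N κ t b * posWeight κ z a b x y) * (if a = s then z * κ ^ (s : ℕ) else 0) := by
    intro a b
    rw [lowMat₂, Matrix.add_apply, Matrix.kroneckerMap_apply, Matrix.kroneckerMap_apply,
      Matrix.one_apply, cartMat, Matrix.diagonal_apply, posMat, Matrix.of_apply]
    simp only [eq_comm (a := b), eq_comm (a := a)]
    split_ifs with h1 h2 h2 <;> simp_all <;> ring
  simp only [e1, e2, Finset.sum_add_distrib, mul_ite, mul_one, mul_zero, Finset.sum_ite_eq',
    Finset.mem_univ, if_true]
  rw [Finset.sum_comm (f := fun (a b : Fin N) => if a = x then posWeight κ z s t a b * lowMat N κ b y *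
      (z * κ ^ (x : ℕ)) else 0), Finset.sum_comm (f := fun (a b : Fin N) => if a = s then lowMat N κ t b *
      posWeight κ z a b x y * (z * κ ^ (s : ℕ)) else 0)]
  simp only [Finset.sum_ite_eq', Finset.mem_univ, if_true, ← Finset.sum_mul]
  rw [sum_lowMat_mul s (fun a => posWeight κ z a t x y),
    sum_lowMat_mul t (fun b => posWeight κ z s b x y),
    sum_mul_lowMat x (fun a => posWeight κ z s t a y) (posWeight_eq_zero hz t.2 le_rfl),
    sum_mul_lowMat y (fun b => posWeight κ z s t x b) (posWeight_eq_zero_right s.2)]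
  linear_combination -h

theorem posMat_commute_cartMat : Commute (posMat N κ z) (cartMat N κ z ⊗ₖ cartMat N κ z) := by
  ext ⟨s, t⟩ ⟨x, y⟩
  rw [cartMat, Matrix.diagonal_kronecker_diagonal, Matrix.mul_diagonal, Matrix.diagonal_mul, posMat,
    Matrix.of_apply, posWeight]
  split_ifs with h
  · simp only at h ⊢
    have : κ ^ (x : ℕ) * κ ^ (y : ℕ) = κ ^ (s : ℕ) * κ ^ (t : ℕ) := by
      rw [← pow_add, ← pow_add, h.1]
    linear_combination (κ ^ ((t : ℕ) * y) * gaussBinom κ s (x - t) *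
      (z ^ (t : ℕ) * ∏ i ∈ Finset.range (x - t), (1 - z * κ ^ ((t : ℕ) + i)))) * z * z * this
  · ring

theorem negMat_commute_of_posMat (hκ0 : κ ≠ 0) (hz : z * κ ^ (N - 1) = 1)
    (hκ : ∀ m : ℕ, κ ^ (m + 1) ≠ 1) {M : Matrix (Fin N × Fin N) (Fin N × Fin N) F}
    (h : Commute (posMat N κ z) M) : Commute (negMat N κ z) M := by
  have h1 := posMat_mul_negMat hκ0 hz hκ
  have h2 := mul_eq_one_comm.1 h1
  calc negMat N κ z * M = negMat N κ z * M * (posMat N κ z * negMat N κ z) := by rw [h1, mul_one]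
    _ = negMat N κ z * (posMat N κ z * M) * negMat N κ z := by rw [h.eq]; simp only [mul_assoc]
    _ = M * negMat N κ z := by rw [← mul_assoc, h2, one_mul]

end TwoStrands

end

/-! ### Commutation with the lowering operator and independence of the partial trace. -/

section

/-! ### The lowering operator on all strands and partial traces -/

section Lowering

variable {n N : ℕ} {κ z : Kv}

/-- The decomposition of a state into the first strand and the others. -/
def headTail (n N : ℕ) : (Fin (n + 1) → Fin N) ≃ Fin N × (Fin n → Fin N) :=
  (Fin.consEquiv fun _ => Fin N).symm

theorem headTail_apply (s : Fin (n + 1) → Fin N) : headTail n N s = (s 0, Fin.tail s) := rfl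

/-- The decomposition of a state into the first two strands and the others. -/
def headTail₂ (n N : ℕ) : (Fin (n + 2) → Fin N) ≃ (Fin N × Fin N) × (Fin n → Fin N) :=
  ((headTail (n + 1) N).trans (Equiv.prodCongr (Equiv.refl _) (headTail n N))).trans
    (Equiv.prodAssoc _ _ _).symm

theorem headTail₂_apply (s : Fin (n + 2) → Fin N) :
    headTail₂ n N s = ((s 0, s 1), Fin.tail (Fin.tail s)) := rfl

/-- The lowering operator on `n` strands. -/
def lowOp (N : ℕ) (κ z : Kv) : (n : ℕ) → Matrix (Fin n → Fin N) (Fin n → Fin N) Kv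
  | 0 => 0
  | n + 1 => (lowMat N κ ⊗ₖ 1 + cartMat N κ z ⊗ₖ lowOp N κ z n).submatrix (headTail n N)
      (headTail n N)

theorem lowOp_succ (n : ℕ) : lowOp N κ z (n + 1) =
    (lowMat N κ ⊗ₖ 1 + cartMat N κ z ⊗ₖ lowOp N κ z n).submatrix (headTail n N) (headTail n N) :=
  rfl

theorem lowOp_degree {s t : Fin n → Fin N} (h : lowOp N κ z n s t ≠ 0) :
    ∑ p, (s p : ℕ) = ∑ p, (t p : ℕ) + 1 := by
  induction n with
  | zero => exact absurd rfl h
  | succ n ih =>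
    rw [Fin.sum_univ_succ, Fin.sum_univ_succ]
    rw [lowOp_succ, Matrix.submatrix_apply, Matrix.add_apply, headTail_apply, headTail_apply,
      Matrix.kroneckerMap_apply, Matrix.kroneckerMap_apply] at h
    by_cases h1 : lowMat N κ (s 0) (t 0) * (1 : Matrix (Fin n → Fin N) (Fin n → Fin N) Kv)
        (Fin.tail s) (Fin.tail t) = 0
    · rw [h1, zero_add] at h
      have h2 := ih (right_ne_zero_of_mul h)
      have h3 : s 0 = t 0 := by
        by_contra hne
        exact left_ne_zero_of_mul h (Matrix.diagonal_apply_ne _ hne)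
      simp only [Fin.tail] at h2
      rw [h2, h3, add_assoc]
    · have h2 : Fin.tail s = Fin.tail t := by
        by_contra hne
        exact right_ne_zero_of_mul h1 (Matrix.one_apply_ne hne)
      have h3 : (t 0 : ℕ) + 1 = s 0 := by
        by_contra hne
        exact left_ne_zero_of_mul h1 (if_neg hne)
      have h4 : ∀ p : Fin n, s p.succ = t p.succ := fun p => congrFun h2 p
      simp only [h4]
      omega

/-- Coassociativity of the iterated coproduct: with two strands split off at once, a crossing on
them meets only `lowMat₂` and the product of the two group-like factors. -/
theorem lowOp_succ_succ (n : ℕ) : lowOp N κ z (n + 2) =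
    (lowMat₂ N κ z ⊗ₖ 1 + (cartMat N κ z ⊗ₖ cartMat N κ z) ⊗ₖ lowOp N κ z n).submatrix
      (headTail₂ n N) (headTail₂ n N) := by
  ext s t
  have htail : (Fin.tail s = Fin.tail t) ↔ s 1 = t 1 ∧ Fin.tail (Fin.tail s) = Fin.tail (Fin.tail t) := by
    constructor
    · intro h
      exact ⟨congrFun h 0, by rw [h]⟩
    · rintro ⟨h1, h2⟩
      funext p
      exact Fin.cases h1 (fun p => congrFun h2 p) p
  rw [lowOp_succ, lowOp_succ, Matrix.submatrix_apply, Matrix.submatrix_apply]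
  simp only [headTail_apply, headTail₂_apply, Matrix.add_apply, Matrix.kroneckerMap_apply,
    Matrix.submatrix_apply, lowMat₂, Matrix.one_apply, htail]
  have e : Fin.tail s 0 = s 1 := rfl
  have e' : Fin.tail t 0 = t 1 := rfl
  rw [e, e']
  by_cases h1 : s 1 = t 1 <;> by_cases h2 : Fin.tail (Fin.tail s) = Fin.tail (Fin.tail t) <;>
    simp [h1, h2] <;> ring

theorem onStrands_zero (B : Matrix (Fin N × Fin N) (Fin N × Fin N) Kv) :
    onStrands (0 : Fin (n + 1)) B = (B ⊗ₖ 1).submatrix (headTail₂ n N) (headTail₂ n N) := by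
  ext s t
  rw [onStrands, Matrix.of_apply, Matrix.submatrix_apply, Matrix.kroneckerMap_apply,
    headTail₂_apply, headTail₂_apply, Matrix.one_apply]
  have : (∀ p : Fin (n + 2), p ≠ (0 : Fin (n + 1)).castSucc → p ≠ (0 : Fin (n + 1)).succ →
      s p = t p) ↔ Fin.tail (Fin.tail s) = Fin.tail (Fin.tail t) := by
    constructor
    · intro h
      funext p
      exact h p.succ.succ (Fin.succ_ne_zero _) (by simp [Fin.ext_iff])
    · intro h p h1 h2
      obtain ⟨p, rfl⟩ := Fin.exists_succ_eq.2 h1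
      obtain ⟨p, rfl⟩ := Fin.exists_succ_eq.2 (show p ≠ 0 from fun hp => h2 (by rw [hp]))
      exact congrFun h p
  simp only [this]
  rw [mul_ite, mul_one, mul_zero]
  rfl

theorem onStrands_succ (i : Fin n) (B : Matrix (Fin N × Fin N) (Fin N × Fin N) Kv) :
    onStrands i.succ B = ((1 : Matrix (Fin N) (Fin N) Kv) ⊗ₖ onStrands i B).submatrix
      (headTail (n + 1) N) (headTail (n + 1) N) := by
  ext s t
  rw [onStrands, Matrix.of_apply, Matrix.submatrix_apply, Matrix.kroneckerMap_apply,
    headTail_apply, headTail_apply, Matrix.one_apply, onStrands, Matrix.of_apply]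
  have : (∀ p : Fin (n + 2), p ≠ i.succ.castSucc → p ≠ i.succ.succ → s p = t p) ↔
      s 0 = t 0 ∧ ∀ p, p ≠ i.castSucc → p ≠ i.succ → Fin.tail s p = Fin.tail t p := by
    constructor
    · intro h
      refine ⟨h 0 (by simp [Fin.ext_iff]) (Fin.succ_ne_zero _).symm, fun p h1 h2 => h p.succ ?_ ?_⟩
      · rw [← Fin.succ_castSucc]
        exact fun h => h1 (Fin.succ_injective _ h)
      · exact fun h => h2 (Fin.succ_injective _ h)
    · rintro ⟨h0, h⟩ p
      refine Fin.cases (fun _ _ => h0) (fun p h1 h2 => h p ?_ ?_) p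
      · rintro rfl
        exact h1 (Fin.succ_castSucc i)
      · rintro rfl
        exact h2 rfl
  simp only [this]
  by_cases h0 : s 0 = t 0
  · simp only [h0, true_and, if_true, one_mul]
    rfl
  · simp [h0]

theorem submatrix_commute {m m' R : Type*} [Fintype m] [Fintype m'] [Semiring R]
    {A B : Matrix m m R} (h : Commute A B) (e : m' ≃ m) :
    Commute (A.submatrix e e) (B.submatrix e e) := by
  rw [Commute, SemiconjBy, Matrix.submatrix_mul_equiv, Matrix.submatrix_mul_equiv, h.eq]

theorem onStrands_commute_lowOp {B : Matrix (Fin N × Fin N) (Fin N × Fin N) Kv}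
    (h₁ : Commute B (lowMat₂ N κ z)) (h₂ : Commute B (cartMat N κ z ⊗ₖ cartMat N κ z))
    (i : Fin n) : Commute (onStrands i B) (lowOp N κ z (n + 1)) := by
  induction n with
  | zero => exact i.elim0
  | succ n ih =>
    refine Fin.cases ?_ (fun i => ?_) i
    · rw [onStrands_zero, lowOp_succ_succ]
      refine submatrix_commute (Commute.add_right ?_ ?_) _
      · rw [Commute, SemiconjBy, ← Matrix.mul_kronecker_mul, ← Matrix.mul_kronecker_mul, h₁.eq]
      · rw [Commute, SemiconjBy, ← Matrix.mul_kronecker_mul, ← Matrix.mul_kronecker_mul, h₂.eq,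
          one_mul, mul_one]
    · rw [onStrands_succ, lowOp_succ]
      refine submatrix_commute (Commute.add_right ?_ ?_) _
      · rw [Commute, SemiconjBy, ← Matrix.mul_kronecker_mul, ← Matrix.mul_kronecker_mul,
          one_mul, mul_one, one_mul, mul_one]
      · rw [Commute, SemiconjBy, ← Matrix.mul_kronecker_mul, ← Matrix.mul_kronecker_mul,
          (ih i).eq, one_mul, mul_one]

/-- The weighted partial trace over all strands but the first. -/
def partialTrace (q : Kv) (M : Matrix (Fin (n + 1) → Fin N) (Fin (n + 1) → Fin N) Kv) (i : Fin N) :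
    Kv :=
  ∑ m : Fin n → Fin N, q ^ (∑ p, (m p : ℕ)) * M (Fin.cons i m) (Fin.cons i m)

theorem sum_headTail (f : (Fin (n + 1) → Fin N) → Kv) :
    ∑ s, f s = ∑ i, ∑ m : Fin n → Fin N, f (Fin.cons i m) := by
  rw [← (headTail n N).symm.sum_comp, Fintype.sum_prod_type]
  rfl

/-- Take the entry of ML = LM from (a, m) to (b, m), weight it by κ^(-∑ m_p) and sum over m. When L
acts on the first strand the result is 1 - κ^a, which is non-zero, times the two partial traces.
When L acts on the other strands the two sides agree: L changes the degree by one, hence the weight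
by κ⁻¹, and this compensates κ^a against κ^b. -/
theorem partialTrace_eq_of_succ (hκ0 : κ ≠ 0) (hκ : ∀ m : ℕ, κ ^ (m + 1) ≠ 1)
    {M : Matrix (Fin (n + 1) → Fin N) (Fin (n + 1) → Fin N) Kv}
    (hM : Commute M (lowOp N κ z (n + 1))) {a b : Fin N} (hab : (b : ℕ) + 1 = a) :
    partialTrace κ⁻¹ M a = partialTrace κ⁻¹ M b := by
  have hL : ∀ (c d : Fin N) (m m' : Fin n → Fin N),
      lowOp N κ z (n + 1) (Fin.cons c m) (Fin.cons d m') =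
      lowMat N κ c d * (if m = m' then 1 else 0) +
        (if c = d then z * κ ^ (c : ℕ) else 0) * lowOp N κ z n m m' := by
    intro c d m m'
    rw [lowOp_succ, Matrix.submatrix_apply, headTail_apply, headTail_apply, Matrix.add_apply,
      Matrix.kroneckerMap_apply, Matrix.kroneckerMap_apply, Matrix.one_apply, cartMat,
      Matrix.diagonal_apply]
    rfl
  have hlow : ∀ c, lowMat N κ c b = if c = a then 1 - κ ^ (a : ℕ) else 0 := by
    intro c
    rw [lowMat, Matrix.of_apply]
    by_cases hc : c = a
    · rw [if_pos hc, hc, if_pos hab]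
    · rw [if_neg hc, if_neg]
      intro h
      exact hc (Fin.ext (h.symm.trans hab))
  have hlow' : ∀ c, lowMat N κ a c = if c = b then 1 - κ ^ (a : ℕ) else 0 := by
    intro c
    rw [lowMat, Matrix.of_apply]
    by_cases hc : c = b
    · rw [if_pos hc, hc, if_pos hab]
    · rw [if_neg hc, if_neg]
      intro h
      exact hc (Fin.ext (by omega))
  have h1 : ∀ m : Fin n → Fin N, (M * lowOp N κ z (n + 1)) (Fin.cons a m) (Fin.cons b m) =
      (1 - κ ^ (a : ℕ)) * M (Fin.cons a m) (Fin.cons a m) + z * κ ^ (b : ℕ) *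
        ∑ m', M (Fin.cons a m) (Fin.cons b m') * lowOp N κ z n m' m := by
    intro m
    rw [Matrix.mul_apply, sum_headTail]
    simp only [hL, hlow, mul_add, Finset.sum_add_distrib]
    congr 1
    · simp [mul_comm]
    · rw [Finset.sum_comm, Finset.mul_sum]
      refine Finset.sum_congr rfl fun m' _ => ?_
      simp only [ite_mul, zero_mul, mul_ite, mul_zero, Finset.sum_ite_eq', Finset.mem_univ, if_true]
      ring
  have h2 : ∀ m : Fin n → Fin N, (lowOp N κ z (n + 1) * M) (Fin.cons a m) (Fin.cons b m) =
      (1 - κ ^ (a : ℕ)) * M (Fin.cons b m) (Fin.cons b m) + z * κ ^ (a : ℕ) *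
        ∑ m', lowOp N κ z n m m' * M (Fin.cons a m') (Fin.cons b m) := by
    intro m
    rw [Matrix.mul_apply, sum_headTail]
    simp only [hL, hlow', add_mul, Finset.sum_add_distrib]
    congr 1
    · simp
    · rw [Finset.sum_comm, Finset.mul_sum]
      refine Finset.sum_congr rfl fun m' _ => ?_
      simp only [ite_mul, zero_mul, Finset.sum_ite_eq, Finset.mem_univ, if_true]
      ring
  have h3 : ∑ m : Fin n → Fin N, κ⁻¹ ^ (∑ p, (m p : ℕ)) * (z * κ ^ (b : ℕ) *
        ∑ m', M (Fin.cons a m) (Fin.cons b m') * lowOp N κ z n m' m) =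
      ∑ m : Fin n → Fin N, κ⁻¹ ^ (∑ p, (m p : ℕ)) * (z * κ ^ (a : ℕ) *
        ∑ m', lowOp N κ z n m m' * M (Fin.cons a m') (Fin.cons b m)) := by
    simp only [Finset.mul_sum]
    rw [Finset.sum_comm]
    refine Finset.sum_congr rfl fun m _ => Finset.sum_congr rfl fun m' _ => ?_
    by_cases h : lowOp N κ z n m m' = 0
    · rw [h]; ring
    · rw [lowOp_degree h, ← hab, pow_succ, pow_succ]
      have : κ⁻¹ * κ = 1 := inv_mul_cancel₀ hκ0
      linear_combination (-(κ⁻¹ ^ (∑ p, (m' p : ℕ)) * z * κ ^ (b : ℕ) *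
        M (Fin.cons a m') (Fin.cons b m) * lowOp N κ z n m m')) * this
  have h4 : ∑ m : Fin n → Fin N, κ⁻¹ ^ (∑ p, (m p : ℕ)) *
        (M * lowOp N κ z (n + 1)) (Fin.cons a m) (Fin.cons b m) =
      ∑ m : Fin n → Fin N, κ⁻¹ ^ (∑ p, (m p : ℕ)) *
        (lowOp N κ z (n + 1) * M) (Fin.cons a m) (Fin.cons b m) := by rw [hM.eq]
  simp only [h1, h2, mul_add, Finset.sum_add_distrib, h3] at h4
  have h5 := add_right_cancel h4
  simp only [mul_left_comm _ (1 - κ ^ (a : ℕ)), ← Finset.mul_sum] at h5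
  refine mul_left_cancel₀ (sub_ne_zero.2 (Ne.symm ?_)) h5
  rw [← hab]
  exact hκ b

theorem partialTrace_eq (hκ0 : κ ≠ 0) (hκ : ∀ m : ℕ, κ ^ (m + 1) ≠ 1)
    {M : Matrix (Fin (n + 1) → Fin N) (Fin (n + 1) → Fin N) Kv}
    (hM : Commute M (lowOp N κ z (n + 1))) (hN : 0 < N) (a : Fin N) :
    partialTrace κ⁻¹ M a = partialTrace κ⁻¹ M ⟨0, hN⟩ := by
  obtain ⟨a, ha⟩ := a
  induction a with
  | zero => rfl
  | succ a ih =>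
    rw [← ih (by omega)]
    exact partialTrace_eq_of_succ hκ0 hκ hM rfl

/-- Each state i of the first strand contributes the same partial trace, weighted by q^i where q is
the inverse of κ; this produces the factor [N] up to a power of v. -/
theorem weighted_trace_eq (hκ0 : κ ≠ 0) (hκ : ∀ m : ℕ, κ ^ (m + 1) ≠ 1)
    {M : Matrix (Fin (n + 1) → Fin N) (Fin (n + 1) → Fin N) Kv}
    (hM : Commute M (lowOp N κ z (n + 1))) (hN : 0 < N) :
    ∑ s, κ⁻¹ ^ (∑ p, (s p : ℕ)) * M s s =
      (∑ i ∈ Finset.range N, κ⁻¹ ^ i) * partialTrace κ⁻¹ M ⟨0, hN⟩ := by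
  rw [sum_headTail, Finset.sum_range, Finset.sum_mul]
  refine Finset.sum_congr rfl fun i _ => ?_
  rw [← partialTrace_eq hκ0 hκ hM hN i, partialTrace, Finset.mul_sum]
  refine Finset.sum_congr rfl fun m _ => ?_
  rw [Fin.sum_univ_succ, Fin.cons_zero, pow_add, mul_assoc]
  simp only [Fin.cons_succ]

end Lowering

end

/-! ### Comparison with the R-matrix and with the colored Jones polynomial. -/

section

variable {n k : ℕ}

/-! ### The evaluated coefficients as a product of matrices -/

theorem v_ne_zero : v ≠ 0 := pow_ne_zero _ RatFunc.X_ne_zero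

theorem vHalf_ne_zero : vHalf ≠ 0 := RatFunc.X_ne_zero

theorem vHalf_pow_ne_one {m : ℕ} (hm : m ≠ 0) : vHalf ^ m ≠ 1 := by
  intro h
  have h1 : algebraMap (Polynomial ℂ) (RatFunc ℂ) (Polynomial.X ^ m) =
      algebraMap (Polynomial ℂ) (RatFunc ℂ) 1 := by
    rw [map_pow, RatFunc.algebraMap_X, map_one]
    exact h
  have h2 := congrArg Polynomial.natDegree (RatFunc.algebraMap_injective ℂ h1)
  rw [Polynomial.natDegree_X_pow, Polynomial.natDegree_one] at h2
  exact hm h2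

/-- The inverse of `q` in `ℂ(v^(1/2))`. -/
def kap : Kv := (v ^ 2)⁻¹

/-- The value `q^(N-1)` of `z` in `ℂ(v^(1/2))`. -/
def zval (N : ℕ) : Kv := (v ^ 2) ^ ((N : ℤ) - 1)

theorem kap_ne_zero : kap ≠ 0 := inv_ne_zero (pow_ne_zero _ v_ne_zero)

theorem kap_inv : kap⁻¹ = v ^ 2 := inv_inv _

theorem kap_pow_ne_one (m : ℕ) : kap ^ (m + 1) ≠ 1 := by
  rw [kap, inv_pow, v, ← pow_mul, ← pow_mul]
  exact fun h => vHalf_pow_ne_one (by omega) (inv_eq_one.1 h)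

theorem zval_mul_kap {N : ℕ} (hN : 0 < N) : zval N * kap ^ (N - 1) = 1 := by
  rw [zval, kap, inv_pow, ← zpow_natCast (v ^ 2) (N - 1), Nat.cast_sub hN, Nat.cast_one,
    mul_inv_cancel₀ (zpow_ne_zero _ (pow_ne_zero _ v_ne_zero))]

theorem inclRq_T (e : ℤ) : inclRq (LaurentPolynomial.T e) = (v ^ 2) ^ e := by
  rw [inclRq, LaurentPolynomial.eval₂_T, Units.val_zpow_eq_zpow_val, Units.val_mk0]

/-- The matrix of a letter with the given sign. -/
def crossMat (N : ℕ) (positive : Bool) : Matrix (Fin N × Fin N) (Fin N × Fin N) Kv :=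
  if positive then posMat N kap (zval N) else negMat N kap (zval N)

theorem inclRq_crossingWeight (N : ℕ) (b : Bool) (s t x y : Fin N) :
    inclRq (crossingWeight N b s t x y) = crossMat N b (s, t) (x, y) := by
  cases b
  · change inclRq (negWeight _ _ _ _ _ _) = negWeight _ _ _ _ _ _
    rw [map_negWeight, inclRq_T, inclRq_T, kap_inv, zpow_one, zpow_neg]
    rfl
  · change inclRq (posWeight _ _ _ _ _ _) = posWeight _ _ _ _ _ _
    rw [map_posWeight, qInv, inclRq_T, inclRq_T, zpow_neg, zpow_one]
    rfl

theorem crossMat_sum {N : ℕ} {b : Bool} {s t : Fin N × Fin N} (h : crossMat N b s t ≠ 0) :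
    (s.1 : ℕ) + s.2 = t.1 + t.2 := by
  by_contra hne
  apply h
  cases b
  · exact if_neg (by omega)
  · exact if_neg (by omega)

theorem crossingWeight_bounded {N : ℕ} {b : Bool} {s t x y : ℕ} (hs : s < N) (ht : t < N)
    (h : crossingWeight N b s t x y ≠ 0) : x < N ∧ y < N := by
  have e : ∀ e : ℤ, (LaurentPolynomial.T e : Rq) ^ (N - 1) =
      LaurentPolynomial.T (e * ((N : ℤ) - 1)) := by
    intro e
    rw [LaurentPolynomial.T_pow, Nat.cast_sub (by omega), Nat.cast_one, mul_comm]
  cases b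
  · change negWeight _ _ _ _ _ _ ≠ 0 at h
    constructor
    · by_contra hx
      exact h (negWeight_eq_zero_left (by omega))
    · by_contra hy
      refine h (negWeight_eq_zero (N := N) ?_ hs (by omega))
      rw [e, T_mul_T, one_mul, neg_add_cancel, LaurentPolynomial.T_zero]
  · change posWeight _ _ _ _ _ _ ≠ 0 at h
    constructor
    · by_contra hx
      refine h (posWeight_eq_zero (N := N) ?_ ht (by omega))
      rw [qInv, e, T_mul_T, neg_one_mul, add_neg_cancel, LaurentPolynomial.T_zero]
    · by_contra hy
      exact h (posWeight_eq_zero_right (by omega))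

/-- The product of the matrices of the letters in a list. -/
def numMat (N : ℕ) (γ : BraidWord n k) (l : List (Fin k)) :
    Matrix (Fin (n + 1) → Fin N) (Fin (n + 1) → Fin N) Kv :=
  (l.map fun j => onStrands (γ j).1 (crossMat N (γ j).2)).prod

theorem inclRq_letter (N : ℕ) (γ : BraidWord n k) (j : Fin k) (s t : Fin (n + 1) → Fin N) :
    inclRq (evalLin k N (symCoeff qInv (letterMatrix γ j) (fun p => (s p : ℕ))
      fun p => (t p : ℕ))) = onStrands (γ j).1 (crossMat N (γ j).2) s t := by
  classical
  rw [evalLin_letter, onStrands, Matrix.of_apply, apply_ite inclRq, inclRq_crossingWeight, map_zero]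
  have : SameOff (γ j).1 (fun p => (s p : ℕ)) (fun p => (t p : ℕ)) ↔
      ∀ p, p ≠ (γ j).1.castSucc → p ≠ (γ j).1.succ → s p = t p := by
    simp only [SameOff, Fin.ext_iff]
  simp only [this]

/-- Intermediate exponents range over all natural numbers, but starting from contents below N every
non-zero term stays below N, so the sum is a matrix product over `Fin N`. -/
theorem inclRq_numCoeff (N : ℕ) (γ : BraidWord n k) {l : List (Fin k)} (hl : l.Nodup)
    (s t : Fin (n + 1) → Fin N) :
    inclRq (numCoeff N γ l (fun p => (s p : ℕ)) fun p => (t p : ℕ)) = numMat N γ l s t := by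
  classical
  induction l generalizing s with
  | nil =>
    rw [numCoeff_nil, numMat, List.map_nil, List.prod_nil, Matrix.one_apply, apply_ite inclRq,
      map_one, map_zero]
    have : ((fun p => (s p : ℕ)) = fun p => (t p : ℕ)) ↔ s = t := by
      simp only [funext_iff, Fin.ext_iff]
    simp only [this]
  | cons j l ih =>
    rw [numCoeff_cons N γ hl, numMat, List.map_cons, List.prod_cons, Matrix.mul_apply, map_sum]
    symm
    refine Finset.sum_bij_ne_zero (fun s₁ _ _ => fun p => (s₁ p : ℕ)) ?_ ?_ ?_ ?_
    · intro s₁ _ hne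
      have h := left_ne_zero_of_mul hne
      rw [← inclRq_letter] at h
      rw [Finset.mem_piAntidiag]
      refine ⟨?_, by simp⟩
      by_contra hsum
      apply h
      rw [(rightQuantum_letterMatrix γ j).symCoeff_eq_zero _ _ (fun h => hsum h.symm)]
      rw [map_zero, map_zero]
    · intro s₁ _ _ s₂ _ _ h
      funext p
      exact Fin.ext (congrFun h p)
    · intro m _ hne
      have h := left_ne_zero_of_mul (fun h => hne (by rw [h, map_zero]) :
        evalLin k N (symCoeff qInv (letterMatrix γ j) _ m) * numCoeff N γ l m _ ≠ 0)
      rw [evalLin_letter] at h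
      have hoff : SameOff (γ j).1 (fun p => (s p : ℕ)) m := by
        by_contra hcon
        exact h (if_neg hcon)
      rw [if_pos hoff] at h
      have hb := crossingWeight_bounded (s _).2 (s _).2 h
      have hlt : ∀ p, m p < N := by
        intro p
        by_cases h1 : p = (γ j).1.castSucc
        · rw [h1]; exact hb.1
        · by_cases h2 : p = (γ j).1.succ
          · rw [h2]; exact hb.2
          · rw [← hoff p h1 h2]; exact (s p).2
      refine ⟨fun p => ⟨m p, hlt p⟩, Finset.mem_univ _, ?_, rfl⟩
      rw [map_mul] at hne
      rw [← inclRq_letter]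
      have hih := ih (List.nodup_cons.1 hl).2 (fun p => ⟨m p, hlt p⟩)
      rw [numMat] at hih
      rw [← hih]
      exact hne
    · intro s₁ _ _
      rw [map_mul, inclRq_letter, ih (List.nodup_cons.1 hl).2, numMat]

theorem numMat_commute_lowOp {N : ℕ} (hN : 0 < N) (γ : BraidWord n k) (l : List (Fin k)) :
    Commute (numMat N γ l) (lowOp N kap (zval N) (n + 1)) := by
  have hz := zval_mul_kap hN
  rw [numMat]
  refine Commute.list_prod_left _ _ fun M hM => ?_
  obtain ⟨j, -, rfl⟩ := List.mem_map.1 hM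
  have hp1 := posMat_commute_lowMat₂ (N := N) hz kap_pow_ne_one
  have hp2 := posMat_commute_cartMat (N := N) (κ := kap) (z := zval N)
  rw [crossMat]
  cases (γ j).2
  · exact onStrands_commute_lowOp (negMat_commute_of_posMat kap_ne_zero hz kap_pow_ne_one hp1)
      (negMat_commute_of_posMat kap_ne_zero hz kap_pow_ne_one hp2) _
  · exact onStrands_commute_lowOp hp1 hp2 _

end

section

variable {n k : ℕ}

/-! ### The braiding in terms of the matrix of a positive crossing -/

/-- The difference `v^a - v^(-a)`. -/
def vDiff (a : ℕ) : Kv := v ^ (a : ℤ) - v ^ (-(a : ℤ))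

/-- The product of the first differences `v^a - v^(-a)`. -/
def vFac (m : ℕ) : Kv := ∏ i ∈ Finset.range m, vDiff (i + 1)

theorem v_zpow_ne_one {m : ℕ} (hm : m ≠ 0) : v ^ m ≠ 1 := by
  rw [v, ← pow_mul]
  exact vHalf_pow_ne_one (by omega)

theorem vDiff_ne_zero {a : ℕ} (ha : a ≠ 0) : vDiff a ≠ 0 := by
  intro h
  rw [vDiff, sub_eq_zero] at h
  refine v_zpow_ne_one (show a + a ≠ 0 by omega) ?_
  have h2 : v ^ (a : ℤ) * v ^ (a : ℤ) = 1 := by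
    nth_rewrite 2 [h]
    rw [← zpow_add₀ v_ne_zero, add_neg_cancel, zpow_zero]
  rw [pow_add, ← zpow_natCast, h2]

theorem vFac_ne_zero (m : ℕ) : vFac m ≠ 0 :=
  Finset.prod_ne_zero_iff.2 fun i _ => vDiff_ne_zero (Nat.succ_ne_zero i)

theorem vFac_add (a m : ℕ) :
    vFac (a + m) = vFac a * ∏ i ∈ Finset.range m, vDiff (a + i + 1) := by
  rw [vFac, Finset.prod_range_add]
  rfl

theorem vFac_add' (a m : ℕ) :
    vFac (a + m) = vFac a * ∏ i ∈ Finset.range m, vDiff (a + m - i) := by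
  rw [vFac_add, ← Finset.prod_range_reflect]
  congr 1
  refine Finset.prod_congr rfl fun i hi => ?_
  rw [Finset.mem_range] at hi
  rw [show a + (m - 1 - i) + 1 = a + m - i by omega]

theorem v_sub_inv_ne_zero : v - v⁻¹ ≠ 0 := by
  have := vDiff_ne_zero one_ne_zero
  rwa [vDiff, Nat.cast_one, zpow_one, zpow_neg, zpow_one] at this

theorem qInt_eq (a : ℕ) : qInt a = vDiff a / (v - v⁻¹) := rfl

theorem qFactorial_eq (m : ℕ) : qFactorial m = vFac m / (v - v⁻¹) ^ m := by
  rw [qFactorial, vFac, show (v - v⁻¹) ^ m = ∏ _i ∈ Finset.range m, (v - v⁻¹) by simp,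
    ← Finset.prod_div_distrib]
  exact Finset.prod_congr rfl fun i _ => by rw [← qInt_eq]; norm_cast

theorem prod_v_pow (a m : ℕ) :
    ∏ i ∈ Finset.range m, v ^ (a + i) = v ^ (a * m + m.choose 2) := by
  induction m with
  | zero => simp
  | succ m ih =>
    rw [Finset.prod_range_succ, ih, Nat.choose_succ_succ' m 1, Nat.choose_one_right, ← pow_add]
    congr 1
    ring

theorem prod_qInt (a m : ℕ) :
    ∏ i ∈ Finset.range m, qInt ((a + m - i : ℕ) : ℤ) =
      vFac (a + m) / (vFac a * (v - v⁻¹) ^ m) := by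
  rw [vFac_add', mul_div_mul_left _ _ (vFac_ne_zero a),
    show (v - v⁻¹) ^ m = ∏ _i ∈ Finset.range m, (v - v⁻¹) by simp, ← Finset.prod_div_distrib]
  rfl

theorem one_sub_neg_zpow (a : ℕ) : 1 - (v ^ 2) ^ (-(a : ℤ)) = v ^ (-(a : ℤ)) * vDiff a := by
  have h := v_ne_zero
  rw [vDiff, mul_sub, ← zpow_add₀ h, ← zpow_add₀ h, neg_add_cancel, zpow_zero, ← zpow_natCast,
    ← zpow_mul]
  congr 2
  push_cast
  ring

theorem one_sub_zpow (a : ℕ) : 1 - (v ^ 2) ^ (a : ℤ) = -v ^ (a : ℤ) * vDiff a := by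
  have h := v_ne_zero
  have e : (v ^ 2) ^ (a : ℤ) = v ^ (a : ℤ) * v ^ (a : ℤ) := by
    rw [← zpow_add₀ h, ← zpow_natCast v 2, ← zpow_mul]
    congr 1
    push_cast
    ring
  rw [vDiff, neg_mul, mul_sub, ← zpow_add₀ h (a : ℤ) (-(a : ℤ)), add_neg_cancel, zpow_zero, e]
  ring

theorem prod_one_sub (a m : ℕ) :
    ∏ i ∈ Finset.range m, (1 - (v ^ 2) ^ (-((a + i + 1 : ℕ) : ℤ))) =
      v ^ (-((a * m + m.choose 2 + m : ℕ) : ℤ)) * (vFac (a + m) / vFac a) := by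
  rw [vFac_add, mul_div_cancel_left₀ _ (vFac_ne_zero a)]
  simp only [one_sub_neg_zpow]
  rw [Finset.prod_mul_distrib]
  congr 1
  induction m with
  | zero => simp
  | succ m ih =>
    rw [Finset.prod_range_succ, ih, ← zpow_add₀ v_ne_zero, Nat.choose_succ_succ' m 1,
      Nat.choose_one_right]
    congr 1
    push_cast
    ring

theorem matF_apply (N : ℕ) (r c : Fin N) : matF N r c =
    if (r : ℕ) = (c : ℕ) + 1 then v ^ (c : ℕ) * qInt ((N : ℤ) - 1 - (c : ℕ)) else 0 := rfl

theorem matE_apply (N : ℕ) (r c : Fin N) : matE N r c =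
    if (r : ℕ) + 1 = c then (1 - (v ^ 2) ^ (-((c : ℕ) : ℤ))) / (1 - (v ^ 2)⁻¹) else 0 := rfl

theorem matF_pow (N a : ℕ) (r c : Fin N) : (matF N ^ a) r c =
    if (r : ℕ) = c + a then ∏ i ∈ Finset.range a, v ^ ((c : ℕ) + i) * qInt ((N : ℤ) - 1 - (c + i))
    else 0 := by
  induction a generalizing r with
  | zero => simp [Matrix.one_apply, Fin.ext_iff]
  | succ a ih =>
    rw [pow_succ', Matrix.mul_apply]
    simp only [ih, matF_apply]
    by_cases h : (r : ℕ) = c + (a + 1)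
    · rw [if_pos h, Finset.sum_eq_single ⟨c + a, by omega⟩]
      · rw [if_pos (by simp only; omega), if_pos rfl, Finset.prod_range_succ, mul_comm]
        simp
      · intro b _ hb
        rw [if_neg (fun h' => hb (Fin.ext h')) (c := (b : ℕ) = c + a), mul_zero]
      · simp
    · rw [if_neg h]
      refine Finset.sum_eq_zero fun b _ => ?_
      by_cases h' : (b : ℕ) = c + a
      · rw [if_neg (by omega), zero_mul]
      · rw [if_neg h', mul_zero]

theorem matE_pow (N a : ℕ) (r c : Fin N) : (matE N ^ a) r c =
    if (r : ℕ) + a = c then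
      ∏ i ∈ Finset.range a, (1 - (v ^ 2) ^ (-(((r : ℕ) + i + 1 : ℕ) : ℤ))) / (1 - (v ^ 2)⁻¹)
    else 0 := by
  induction a generalizing c with
  | zero => simp [Matrix.one_apply, Fin.ext_iff]
  | succ a ih =>
    rw [pow_succ, Matrix.mul_apply]
    simp only [ih, matE_apply]
    by_cases h : (r : ℕ) + (a + 1) = c
    · rw [if_pos h, Finset.sum_eq_single ⟨r + a, by omega⟩]
      · rw [if_pos rfl, if_pos (by simp only; omega), Finset.prod_range_succ, ← h]
        rfl
      · intro b _ hb
        rw [if_neg (fun h' => hb (Fin.ext h'.symm)) (c := (r : ℕ) + a = b), zero_mul]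
      · simp
    · rw [if_neg h]
      refine Finset.sum_eq_zero fun b _ => ?_
      by_cases h' : (r : ℕ) + a = b
      · rw [if_neg (show ¬ (b : ℕ) + 1 = c by omega), mul_zero]
      · rw [if_neg h', zero_mul]

theorem theta_apply (N : ℕ) (s t y x : Fin N) : theta N (s, t) (y, x) =
    if (s : ℕ) + t = x + y ∧ (t : ℕ) ≤ x then
      ((-1) ^ (x - t : ℕ) * v ^ (-(((x - t : ℕ).choose 2 : ℕ) : ℤ)) * (v - v⁻¹) ^ (x - t : ℕ) /
        qFactorial (x - t)) *
      ((∏ i ∈ Finset.range (x - t), v ^ ((y : ℕ) + i) * qInt ((N : ℤ) - 1 - (y + i))) *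
        ∏ i ∈ Finset.range (x - t), (1 - (v ^ 2) ^ (-(((t : ℕ) + i + 1 : ℕ) : ℤ))) /
          (1 - (v ^ 2)⁻¹))
    else 0 := by
  rw [theta, Matrix.sum_apply]
  simp only [Matrix.smul_apply, Matrix.kroneckerMap_apply, smul_eq_mul, matF_pow, matE_pow]
  by_cases h : (s : ℕ) + t = x + y ∧ (t : ℕ) ≤ x
  · rw [if_pos h, Finset.sum_eq_single (x - t : ℕ)]
    · rw [if_pos (by omega), if_pos (by omega)]
    · intro b _ hb
      rw [if_neg (show ¬ (t : ℕ) + b = x by omega), mul_zero, mul_zero]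
    · intro hx
      exact absurd (Finset.mem_range.2 (by omega)) hx
  · rw [if_neg h]
    refine Finset.sum_eq_zero fun b _ => ?_
    by_cases h1 : (t : ℕ) + b = x
    · rw [if_neg (show ¬ (s : ℕ) = y + b by omega), zero_mul, mul_zero]
    · rw [if_neg h1, mul_zero, mul_zero]

theorem braiding_apply (N : ℕ) (s t x y : Fin N) : braiding N (s, t) (x, y) =
    theta N (s, t) (y, x) * vHalf ^ (-(weight y * weight x)) := by
  rw [braiding, Matrix.mul_apply, Finset.sum_eq_single (y, x)]
  · have : diagFlip N (y, x) (x, y) = vHalf ^ (-(weight y * weight x)) := if_pos rfl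
    rw [this]
  · intro r _ hr
    have : diagFlip N r (x, y) = 0 := if_neg (by simpa using hr)
    rw [this, mul_zero]
  · simp

/-- The change of basis on one strand. -/
def strandFac (N a : ℕ) : Kv := vFac a * vFac (N - 1 - a)

theorem strandFac_ne_zero (N a : ℕ) : strandFac N a ≠ 0 :=
  mul_ne_zero (vFac_ne_zero _) (vFac_ne_zero _)

theorem qPoch_kap (m : ℕ) :
    qPoch kap m = v ^ (-((m.choose 2 + m : ℕ) : ℤ)) * vFac m := by
  have h := prod_one_sub 0 m
  simp only [zero_add, zero_mul] at h
  rw [show vFac 0 = 1 from rfl, div_one] at h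
  rw [← h, qPoch]
  refine Finset.prod_congr rfl fun i _ => ?_
  rw [kap, inv_pow, zpow_neg, zpow_natCast]

theorem choose_two_add (a b : ℕ) : (a + b).choose 2 = a.choose 2 + b.choose 2 + a * b := by
  induction b with
  | zero => simp
  | succ b ih =>
    rw [← add_assoc, Nat.choose_succ_succ' (a + b) 1, Nat.choose_succ_succ' b 1,
      Nat.choose_one_right, Nat.choose_one_right, ih]
    ring

theorem gaussBinom_kap (a b : ℕ) :
    gaussBinom kap (a + b) a = v ^ (-((a * b : ℕ) : ℤ)) * (vFac (a + b) / (vFac a * vFac b)) := by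
  have h := gaussBinom_mul_qPoch kap a b
  rw [qPoch_kap, qPoch_kap, qPoch_kap] at h
  have h1 := vFac_ne_zero a
  have h2 := vFac_ne_zero b
  have hv := v_ne_zero
  have h3 : v ^ (-((a.choose 2 + a : ℕ) : ℤ)) * v ^ (-((b.choose 2 + b : ℕ) : ℤ)) ≠ 0 :=
    mul_ne_zero (zpow_ne_zero _ hv) (zpow_ne_zero _ hv)
  rw [← mul_div_assoc, eq_div_iff (mul_ne_zero h1 h2)]
  apply mul_left_cancel₀ h3
  have e : v ^ (-(((a + b).choose 2 + (a + b) : ℕ) : ℤ)) =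
      v ^ (-((a.choose 2 + a : ℕ) : ℤ)) * v ^ (-((b.choose 2 + b : ℕ) : ℤ)) *
        v ^ (-((a * b : ℕ) : ℤ)) := by
    rw [← zpow_add₀ hv, ← zpow_add₀ hv, choose_two_add]
    congr 1
    push_cast
    ring
  rw [e] at h
  linear_combination h

theorem prod_one_sub_zval (N t m : ℕ) (h : t + m < N) :
    ∏ i ∈ Finset.range m, (1 - zval N * kap ^ (t + i)) =
      (-1) ^ m * v ^ (((N : ℤ) - 1 - t) * m - m.choose 2) *
        (vFac (N - 1 - t) / vFac (N - 1 - (t + m))) := by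
  induction m with
  | zero => simp [div_self (vFac_ne_zero _)]
  | succ m ih =>
    rw [Finset.prod_range_succ, ih (by omega), Nat.choose_succ_succ' m 1, Nat.choose_one_right]
    have e1 : zval N * kap ^ (t + m) = (v ^ 2) ^ ((N - 1 - (t + m) : ℕ) : ℤ) := by
      rw [zval, kap, inv_pow, ← zpow_natCast (v ^ 2) (t + m), ← zpow_neg,
        ← zpow_add₀ (pow_ne_zero _ v_ne_zero)]
      congr 1
      omega
    have e2 : vFac (N - 1 - (t + m)) = vFac (N - 1 - (t + (m + 1))) * vDiff (N - 1 - (t + m)) := by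
      rw [show N - 1 - (t + m) = N - 1 - (t + (m + 1)) + 1 by omega, vFac, vFac,
        Finset.prod_range_succ]
    have e3 : v ^ (((N : ℤ) - 1 - t) * (m + 1 : ℕ) - (m + m.choose 2 : ℕ)) =
        v ^ (((N : ℤ) - 1 - t) * m - m.choose 2) * v ^ ((N - 1 - (t + m) : ℕ) : ℤ) := by
      rw [← zpow_add₀ v_ne_zero, show ((N - 1 - (t + m) : ℕ) : ℤ) = (N : ℤ) - 1 - (t + m) by omega]
      congr 1
      push_cast
      ring
    rw [e1, one_sub_zpow, e2, e3]
    have n1 := vFac_ne_zero (N - 1 - (t + (m + 1)))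
    have n2 := vDiff_ne_zero (show N - 1 - (t + m) ≠ 0 by omega)
    generalize v ^ ((N - 1 - (t + m) : ℕ) : ℤ) = X
    generalize v ^ (((N : ℤ) - 1 - t) * m - m.choose 2) = Y
    field_simp
    ring

/-- The braiding is conjugate to the matrix of a positive crossing, up to a scalar. -/
theorem braiding_eq (N : ℕ) (s t x y : Fin N) :
    braiding N (s, t) (x, y) * (strandFac N s * strandFac N t * v ^ (((N : ℤ) - 1) * t)) =
      vHalf ^ (-((N : ℤ) - 1) ^ 2) * posMat N kap (zval N) (s, t) (x, y) *
        (strandFac N x * strandFac N y * v ^ (((N : ℤ) - 1) * y)) := by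
  rw [braiding_apply, theta_apply, posMat, Matrix.of_apply, posWeight]
  have hc : ((x : ℕ) + y = s + t ∧ (t : ℕ) ≤ x) ↔ ((s : ℕ) + t = x + y ∧ (t : ℕ) ≤ x) := by
    rw [eq_comm]
  simp only [hc]
  split_ifs with h
  swap
  · ring
  obtain ⟨s, hs⟩ := s
  obtain ⟨t, ht⟩ := t
  obtain ⟨x, hx⟩ := x
  obtain ⟨y, hy⟩ := y
  simp only at h ⊢
  obtain ⟨m, rfl⟩ := Nat.exists_eq_add_of_le h.2
  obtain rfl : s = m + y := by omega
  rw [Nat.add_sub_cancel_left, Finset.prod_mul_distrib, prod_v_pow, Finset.prod_div_distrib,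
    prod_one_sub, Finset.prod_const, Finset.card_range, prod_one_sub_zval N t m hx, gaussBinom_kap]
  have hF : ∏ i ∈ Finset.range m, qInt ((N : ℤ) - 1 - (y + i)) =
      vFac (N - 1 - y) / (vFac (N - 1 - (m + y)) * (v - v⁻¹) ^ m) := by
    have := prod_qInt (N - 1 - (m + y)) m
    rw [show N - 1 - (m + y) + m = N - 1 - y by omega] at this
    rw [← this]
    refine Finset.prod_congr rfl fun i hi => ?_
    rw [Finset.mem_range] at hi
    congr 1
    omega
  have hone : 1 - (v ^ 2)⁻¹ = v⁻¹ * (v - v⁻¹) := by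
    have := v_ne_zero
    field_simp
  have hz : zval N ^ t = v ^ (2 * ((N : ℤ) - 1) * t) := by
    rw [zval, ← zpow_natCast, ← zpow_mul, ← zpow_natCast v 2, ← zpow_mul]
    congr 1
    push_cast
    ring
  have hk : kap ^ (t * y) = v ^ (-2 * (t : ℤ) * y) := by
    rw [kap, inv_pow, ← zpow_natCast, ← zpow_natCast v 2, ← zpow_mul, ← zpow_neg]
    congr 1
    push_cast
    ring
  -- The factor v^(-kl/2) splits into a scalar depending only on N and an integral power of v;
  -- half-integral powers occur only in the scalar.
  have hw : vHalf ^ (-(weight (⟨y, hy⟩ : Fin N) * weight (⟨t + m, hx⟩ : Fin N))) =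
      vHalf ^ (-((N : ℤ) - 1) ^ 2) * v ^ (((N : ℤ) - 1) * (t + m + y) - 2 * (t + m) * y) := by
    rw [v, ← zpow_natCast vHalf 2, ← zpow_mul, ← zpow_add₀ vHalf_ne_zero, weight, weight]
    congr 1
    push_cast
    ring
  rw [hF, hone, hz, hk, hw, qFactorial_eq, strandFac, strandFac, strandFac, strandFac, mul_pow,
    inv_pow, ← zpow_natCast v m, ← zpow_natCast v (y * m + m.choose 2), ← zpow_neg]
  have hv := v_ne_zero
  -- With everything written in symmetric factorials, the factorials match and this comparison of
  -- exponents of v is all that remains; the factors are then made opaque for the field arithmetic.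
  have key : v ^ (-((m.choose 2 : ℕ) : ℤ)) * v ^ ((y * m + m.choose 2 : ℕ) : ℤ) *
      v ^ (-((t * m + m.choose 2 + m : ℕ) : ℤ)) * v ^ (m : ℤ) *
      v ^ (((N : ℤ) - 1) * (t + m + y) - 2 * (t + m) * y) * v ^ (((N : ℤ) - 1) * t) =
      v ^ (-2 * (t : ℤ) * y) * v ^ (-((m * y : ℕ) : ℤ)) * v ^ (2 * ((N : ℤ) - 1) * t) *
        v ^ (((N : ℤ) - 1 - t) * m - m.choose 2) * v ^ (((N : ℤ) - 1) * y) := by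
    simp only [← zpow_add₀ hv]
    congr 1
    push_cast
    ring
  have n1 := vFac_ne_zero (N - 1 - (m + y))
  have n2 := vFac_ne_zero (N - 1 - (t + m))
  have n3 := vFac_ne_zero m
  have n4 := vFac_ne_zero t
  have n5 := vFac_ne_zero y
  have n6 := pow_ne_zero m v_sub_inv_ne_zero
  have n7 : v ^ (-(m : ℤ)) ≠ 0 := zpow_ne_zero _ hv
  have n8 : v ^ (m : ℤ) = (v ^ (-(m : ℤ)))⁻¹ := by rw [zpow_neg, inv_inv]
  rw [n8] at key
  generalize vFac (N - 1 - (m + y)) = a1 at *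
  generalize vFac (N - 1 - (t + m)) = a2 at *
  generalize vFac m = a3 at *
  generalize vFac t = a4 at *
  generalize vFac y = a5 at *
  generalize (v - v⁻¹) ^ m = a6 at *
  generalize v ^ (-(m : ℤ)) = a7 at *
  generalize v ^ (-((m.choose 2 : ℕ) : ℤ)) = b1 at *
  generalize v ^ ((y * m + m.choose 2 : ℕ) : ℤ) = b2 at *
  generalize v ^ (-((t * m + m.choose 2 + m : ℕ) : ℤ)) = b3 at *
  generalize v ^ (((N : ℤ) - 1) * (t + m + y) - 2 * (t + m) * y) = b4 at *
  generalize v ^ (((N : ℤ) - 1) * t) = b5 at *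
  generalize v ^ (-2 * (t : ℤ) * y) = b6 at *
  generalize v ^ (-((m * y : ℕ) : ℤ)) = b7 at *
  generalize v ^ (2 * ((N : ℤ) - 1) * t) = b8 at *
  generalize v ^ (((N : ℤ) - 1 - t) * m - m.choose 2) = b9 at *
  generalize v ^ (((N : ℤ) - 1) * y) = b10 at *
  push_cast at *
  field_simp at key ⊢
  linear_combination (vFac (N - 1 - y) * vFac (t + m) * vHalf ^ (-((N : ℤ) - 1) ^ 2) *
    vFac (m + y) * vFac (N - 1 - t)) * key

end

section

variable {n k : ℕ}

/-! ### The colored Jones polynomial as a partial trace -/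

/-- The change of basis on two strands. -/
def pairFac (N : ℕ) (a : Fin N × Fin N) : Kv :=
  strandFac N a.1 * strandFac N a.2 * v ^ (((N : ℤ) - 1) * (a.2 : ℕ))

theorem pairFac_ne_zero (N : ℕ) (a : Fin N × Fin N) : pairFac N a ≠ 0 :=
  mul_ne_zero (mul_ne_zero (strandFac_ne_zero _ _) (strandFac_ne_zero _ _))
    (zpow_ne_zero _ v_ne_zero)

/-- The matrix of the braiding or of its inverse. -/
def letterBraiding (N : ℕ) (b : Bool) : Matrix (Fin N × Fin N) (Fin N × Fin N) Kv :=
  if b then braiding N else (braiding N)⁻¹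

/-- The scalar relating the braiding of the given sign to the matrix of a crossing. -/
def letterScalar (N : ℕ) (b : Bool) : Kv := vHalf ^ (-((N : ℤ) - 1) ^ 2 * if b then 1 else -1)

theorem braiding_eq_conj (N : ℕ) : braiding N = vHalf ^ (-((N : ℤ) - 1) ^ 2) •
    (Matrix.diagonal (fun a => (pairFac N a)⁻¹) * posMat N kap (zval N) *
      Matrix.diagonal (pairFac N)) := by
  ext ⟨s, t⟩ ⟨x, y⟩
  rw [Matrix.smul_apply, Matrix.mul_diagonal, Matrix.diagonal_mul, smul_eq_mul]
  have h := braiding_eq N s t x y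
  change _ * pairFac N (s, t) = _ * pairFac N (x, y) at h
  apply mul_right_cancel₀ (pairFac_ne_zero N (s, t))
  rw [h]
  have := pairFac_ne_zero N (s, t)
  field_simp

theorem braiding_inv_eq_conj {N : ℕ} (hN : 0 < N) : (braiding N)⁻¹ = vHalf ^ (((N : ℤ) - 1) ^ 2) •
    (Matrix.diagonal (fun a => (pairFac N a)⁻¹) * negMat N kap (zval N) *
      Matrix.diagonal (pairFac N)) := by
  refine Matrix.inv_eq_right_inv ?_
  rw [braiding_eq_conj, smul_mul_smul_comm, ← zpow_add₀ vHalf_ne_zero, neg_add_cancel, zpow_zero,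
    one_smul]
  have h1 : Matrix.diagonal (pairFac N) * Matrix.diagonal (fun a => (pairFac N a)⁻¹) = 1 := by
    rw [Matrix.diagonal_mul_diagonal, ← Matrix.diagonal_one]
    congr 1
    funext a
    exact mul_inv_cancel₀ (pairFac_ne_zero N a)
  have h2 := mul_eq_one_comm.1 h1
  have h3 := posMat_mul_negMat (N := N) kap_ne_zero (zval_mul_kap hN) kap_pow_ne_one
  calc _ = Matrix.diagonal (fun a => (pairFac N a)⁻¹) * (posMat N kap (zval N) *
        (Matrix.diagonal (pairFac N) * Matrix.diagonal (fun a => (pairFac N a)⁻¹)) *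
          negMat N kap (zval N)) * Matrix.diagonal (pairFac N) := by simp only [mul_assoc]
    _ = 1 := by rw [h1, mul_one, h3, mul_one, h2]

theorem letterBraiding_eq {N : ℕ} (hN : 0 < N) (b : Bool) (s t : Fin N × Fin N) :
    pairFac N s * letterBraiding N b s t = letterScalar N b * crossMat N b s t * pairFac N t := by
  have hs := pairFac_ne_zero N s
  cases b
  · have e : letterScalar N false = vHalf ^ (((N : ℤ) - 1) ^ 2) := by
      rw [letterScalar]; simp
    rw [e]
    change _ * (braiding N)⁻¹ s t = _ * negMat N kap (zval N) s t * _
    rw [braiding_inv_eq_conj hN, Matrix.smul_apply, Matrix.mul_diagonal, Matrix.diagonal_mul,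
      smul_eq_mul]
    field_simp
  · have e : letterScalar N true = vHalf ^ (-((N : ℤ) - 1) ^ 2) := by
      rw [letterScalar]; simp
    rw [e]
    change _ * braiding N s t = _ * posMat N kap (zval N) s t * _
    rw [braiding_eq_conj, Matrix.smul_apply, Matrix.mul_diagonal, Matrix.diagonal_mul,
      smul_eq_mul]
    field_simp

/-- The change of basis on all strands. -/
def stateFac {N : ℕ} (s : Fin (n + 1) → Fin N) : Kv :=
  ∏ p, strandFac N (s p) * v ^ (((N : ℤ) - 1) * (p : ℕ) * (s p : ℕ))

theorem stateFac_ne_zero {N : ℕ} (s : Fin (n + 1) → Fin N) : stateFac s ≠ 0 :=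
  Finset.prod_ne_zero_iff.2 fun _ _ =>
    mul_ne_zero (strandFac_ne_zero _ _) (zpow_ne_zero _ v_ne_zero)

theorem prod_eq_pair_mul (i : Fin n) (f : Fin (n + 1) → Kv) : ∏ p, f p =
    f i.castSucc * f i.succ * ∏ p ∈ Finset.univ.filter (fun p => p ≠ i.castSucc ∧ p ≠ i.succ), f p := by
  rw [← Finset.prod_filter_mul_prod_filter_not Finset.univ
    (fun p => p ≠ i.castSucc ∧ p ≠ i.succ), mul_comm, ← Finset.prod_pair (castSucc_ne_succ i)]
  congr 1
  refine Finset.prod_congr ?_ fun _ _ => rfl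
  ext p
  simp only [Finset.mem_filter, Finset.mem_univ, true_and, Finset.mem_insert, Finset.mem_singleton]
  tauto

/-- `pairFac` twists only the second factor. A twist growing linearly with the position restricts to
it on every adjacent pair, up to a power of v in the total content of the pair, which crossings
preserve. -/
theorem stateFac_eq {N : ℕ} (i : Fin n) (s : Fin (n + 1) → Fin N) : stateFac s =
    pairFac N (s i.castSucc, s i.succ) *
      v ^ (((N : ℤ) - 1) * (i : ℕ) * ((s i.castSucc : ℕ) + (s i.succ : ℕ) : ℕ)) *
      ∏ p ∈ Finset.univ.filter (fun p => p ≠ i.castSucc ∧ p ≠ i.succ),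
        (strandFac N (s p) * v ^ (((N : ℤ) - 1) * (p : ℕ) * (s p : ℕ))) := by
  rw [stateFac, prod_eq_pair_mul i]
  congr 1
  have h : v ^ (((N : ℤ) - 1) * (i.castSucc : ℕ) * (s i.castSucc : ℕ)) *
      v ^ (((N : ℤ) - 1) * (i.succ : ℕ) * (s i.succ : ℕ)) =
      v ^ (((N : ℤ) - 1) * (s i.succ : ℕ)) *
      v ^ (((N : ℤ) - 1) * (i : ℕ) * ((s i.castSucc : ℕ) + (s i.succ : ℕ) : ℕ)) := by
    rw [← zpow_add₀ v_ne_zero, ← zpow_add₀ v_ne_zero]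
    congr 1
    rw [Fin.val_castSucc, Fin.val_succ]
    push_cast
    ring
  rw [pairFac]
  linear_combination (strandFac N (s i.castSucc) * strandFac N (s i.succ)) * h

theorem onStrands_letterBraiding {N : ℕ} (hN : 0 < N) (b : Bool) (i : Fin n)
    (s t : Fin (n + 1) → Fin N) :
    stateFac s * onStrands i (letterBraiding N b) s t =
      letterScalar N b * onStrands i (crossMat N b) s t * stateFac t := by
  rw [onStrands, onStrands, Matrix.of_apply, Matrix.of_apply]
  split_ifs with hoff
  · rw [stateFac_eq i s, stateFac_eq i t]
    have hrest : ∏ p ∈ Finset.univ.filter (fun p => p ≠ i.castSucc ∧ p ≠ i.succ),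
        (strandFac N (s p) * v ^ (((N : ℤ) - 1) * (p : ℕ) * (s p : ℕ))) =
        ∏ p ∈ Finset.univ.filter (fun p => p ≠ i.castSucc ∧ p ≠ i.succ),
        (strandFac N (t p) * v ^ (((N : ℤ) - 1) * (p : ℕ) * (t p : ℕ))) := by
      refine Finset.prod_congr rfl fun p hp => ?_
      rw [Finset.mem_filter] at hp
      rw [hoff p hp.2.1 hp.2.2]
    have h := letterBraiding_eq hN b (s i.castSucc, s i.succ) (t i.castSucc, t i.succ)
    rw [hrest]
    generalize ∏ p ∈ Finset.univ.filter (fun p => p ≠ i.castSucc ∧ p ≠ i.succ),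
        (strandFac N (t p) * v ^ (((N : ℤ) - 1) * (p : ℕ) * (t p : ℕ))) = P
    by_cases h0 : crossMat N b (s i.castSucc, s i.succ) (t i.castSucc, t i.succ) = 0
    · rw [h0, mul_zero, zero_mul] at h
      have := (mul_eq_zero.1 h).resolve_left (pairFac_ne_zero _ _)
      rw [this, h0]
      ring
    · rw [crossMat_sum h0]
      linear_combination (v ^ (((N : ℤ) - 1) * (i : ℕ) *
        ((t i.castSucc : ℕ) + (t i.succ : ℕ) : ℕ)) * P) * h
  · ring

theorem prod_letterScalar (N : ℕ) (γ : BraidWord n k) :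
    ((List.finRange k).map fun j => letterScalar N (γ j).2).prod =
      vHalf ^ (-((N : ℤ) - 1) ^ 2 * writhe γ) := by
  rw [writhe, ← List.ofFn_eq_map, List.prod_ofFn, Finset.mul_sum]
  have h : ∀ s : Finset (Fin k), ∏ j ∈ s, letterScalar N (γ j).2 =
      vHalf ^ (∑ j ∈ s, -((N : ℤ) - 1) ^ 2 * letterSign (γ j)) := by
    intro s
    induction s using Finset.induction_on with
    | empty => simp
    | insert j s hj ih =>
      rw [Finset.prod_insert hj, Finset.sum_insert hj, zpow_add₀ vHalf_ne_zero, ih]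
      rfl
  exact h Finset.univ

theorem stateFac_mul_braidOp {N : ℕ} (hN : 0 < N) (γ : BraidWord n k) (l : List (Fin k))
    (s t : Fin (n + 1) → Fin N) :
    stateFac s * (l.map fun j => onStrands (γ j).1 (letterBraiding N (γ j).2)).prod s t =
      (l.map fun j => letterScalar N (γ j).2).prod * numMat N γ l s t * stateFac t := by
  induction l generalizing s with
  | nil =>
    simp only [numMat, List.map_nil, List.prod_nil, Matrix.one_apply]
    by_cases h : s = t
    · simp [h]
    · simp [h]
  | cons j l ih =>
    rw [numMat, List.map_cons, List.map_cons, List.map_cons, List.prod_cons, List.prod_cons,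
      List.prod_cons, Matrix.mul_apply, Matrix.mul_apply, Finset.mul_sum, Finset.mul_sum,
      Finset.sum_mul]
    refine Finset.sum_congr rfl fun r _ => ?_
    rw [← mul_assoc, onStrands_letterBraiding hN, mul_assoc, ih r, numMat]
    ring

theorem braidOp_diag {N : ℕ} (hN : 0 < N) (γ : BraidWord n k) (s : Fin (n + 1) → Fin N) :
    braidOp N γ s s = vHalf ^ (-((N : ℤ) - 1) ^ 2 * writhe γ) * numMat N γ (List.finRange k) s s := by
  have h := stateFac_mul_braidOp hN γ (List.finRange k) s s
  rw [prod_letterScalar, mul_comm] at h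
  have h2 := mul_right_cancel₀ (stateFac_ne_zero s) h
  rw [← h2, braidOp, List.ofFn_eq_map]
  rfl

theorem sum_range_v_pow (N : ℕ) :
    ∑ i ∈ Finset.range N, (v ^ 2) ^ i = v ^ ((N : ℤ) - 1) * qInt N := by
  have h1 : (v ^ 2 - 1) * ∑ i ∈ Finset.range N, (v ^ 2) ^ i = (v ^ 2) ^ N - 1 := mul_geom_sum _ _
  have hv := v_ne_zero
  have h2 : v ^ 2 - 1 = v * (v - v⁻¹) := by field_simp
  have h3 := v_sub_inv_ne_zero
  rw [qInt, ← mul_div_assoc, eq_div_iff h3]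
  apply mul_left_cancel₀ hv
  have e : v * (v ^ ((N : ℤ) - 1) * (v ^ (N : ℤ) - v ^ (-(N : ℤ)))) = (v ^ 2) ^ N - 1 := by
    have e1 : v * v ^ ((N : ℤ) - 1) = v ^ (N : ℤ) := by
      rw [← zpow_one_add₀ hv]
      congr 1
      ring
    rw [← mul_assoc, e1, mul_sub, ← zpow_add₀ hv, ← zpow_add₀ hv, add_neg_cancel, zpow_zero,
      ← pow_mul, ← zpow_natCast]
    congr 2
    push_cast
    ring
  rw [e, ← h1, h2]
  ring

theorem kInv_entry {N : ℕ} (s : Fin (n + 1) → Fin N) :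
    ∏ p, v ^ (-weight (s p)) =
      v ^ (-((n + 1 : ℕ) : ℤ) * ((N : ℤ) - 1)) * (v ^ 2) ^ (∑ p, (s p : ℕ)) := by
  rw [← Finset.prod_pow_eq_pow_sum]
  have : ∀ p, v ^ (-weight (s p)) = v ^ (-((N : ℤ) - 1)) * (v ^ 2) ^ (s p : ℕ) := by
    intro p
    rw [← zpow_natCast (v ^ 2), ← zpow_natCast v 2, ← zpow_mul, ← zpow_add₀ v_ne_zero, weight]
    congr 1
    push_cast
    ring
  simp only [this]
  rw [Finset.prod_mul_distrib, Finset.prod_const, Finset.card_univ, Fintype.card_fin,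
    ← zpow_natCast, ← zpow_mul]
  congr 2
  ring

theorem qInt_ne_zero {N : ℕ} (hN : 0 < N) : qInt N ≠ 0 := by
  rw [qInt_eq]
  exact div_ne_zero (vDiff_ne_zero hN.ne') v_sub_inv_ne_zero

/-- The writhe factor v^(w(N²-1)/2) and the scalars v^(-w(N-1)²/2) of the braidings combine to
v^(w(N-1)). The action of K⁻¹ contributes v^(-(n+1)(N-1)), and the geometric sum over the first
strand contributes v^(N-1) [N]. -/
theorem normalizedColoredJones_eq {N : ℕ} (hN : 0 < N) (γ : BraidWord n k) :
    normalizedColoredJones γ N = v ^ (((N : ℤ) - 1) * (writhe γ - n)) *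
      partialTrace (v ^ 2) (numMat N γ (List.finRange k)) ⟨0, hN⟩ := by
  have htr : (braidOp N γ * kInv N n).trace =
      vHalf ^ (-((N : ℤ) - 1) ^ 2 * writhe γ) * v ^ (-((n + 1 : ℕ) : ℤ) * ((N : ℤ) - 1)) *
        ∑ s : Fin (n + 1) → Fin N, (v ^ 2) ^ (∑ p, (s p : ℕ)) *
          numMat N γ (List.finRange k) s s := by
    rw [Matrix.trace, Finset.mul_sum]
    refine Finset.sum_congr rfl fun s _ => ?_
    rw [Matrix.diag_apply, kInv, Matrix.mul_diagonal, braidOp_diag hN, kInv_entry]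
    ring
  have hw := weighted_trace_eq kap_ne_zero kap_pow_ne_one
    (numMat_commute_lowOp hN γ (List.finRange k)) hN
  rw [kap_inv] at hw
  have hpow : vHalf ^ (writhe γ * ((N : ℤ) ^ 2 - 1)) * (vHalf ^ (-((N : ℤ) - 1) ^ 2 * writhe γ) *
      v ^ (-((n + 1 : ℕ) : ℤ) * ((N : ℤ) - 1)) * v ^ ((N : ℤ) - 1)) =
      v ^ (((N : ℤ) - 1) * (writhe γ - n)) := by
    have e : ∀ a : ℤ, v ^ a = vHalf ^ (2 * a) := by
      intro a
      rw [v, ← zpow_natCast, ← zpow_mul]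
      rfl
    simp only [e, ← zpow_add₀ vHalf_ne_zero]
    congr 1
    push_cast
    ring
  rw [normalizedColoredJones, coloredJones, htr, hw, sum_range_v_pow, ← hpow,
    div_eq_iff (qInt_ne_zero hN)]
  ring

theorem inclRq_trace_eq {N : ℕ} (hN : 0 < N) (γ : BraidWord n k) :
    inclRq (∑ m : Fin n → Fin N, (LaurentPolynomial.T 1 : Rq) ^ (∑ p, (m p : ℕ)) *
        numCoeff N γ (List.finRange k) (Fin.cons 0 fun p => (m p : ℕ) : Fin (n + 1) → ℕ)
          (Fin.cons 0 fun p => (m p : ℕ) : Fin (n + 1) → ℕ)) =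
      partialTrace (v ^ 2) (numMat N γ (List.finRange k)) ⟨0, hN⟩ := by
  rw [map_sum, partialTrace]
  refine Finset.sum_congr rfl fun m _ => ?_
  rw [map_mul, map_pow, inclRq_T, zpow_one, ← inclRq_numCoeff N γ (List.nodup_finRange k)]
  have : (Fin.cons 0 fun p => (m p : ℕ) : Fin (n + 1) → ℕ) =
      fun p => ((Fin.cons ⟨0, hN⟩ m : Fin (n + 1) → Fin N) p : ℕ) := by
    funext p
    refine Fin.cases rfl (fun p => rfl) p
  rw [this]

/-! ### Parity -/

theorem sign_of_isCycleOn_univ {n : ℕ} {σ : Equiv.Perm (Fin (n + 1))} (h : σ.IsCycleOn Set.univ) :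
    Equiv.Perm.sign σ = (-1) ^ n := by
  cases n with
  | zero =>
    have : Subsingleton (Fin (0 + 1)) := inferInstanceAs (Subsingleton (Fin 1))
    rw [Subsingleton.elim σ 1, Equiv.Perm.sign_one, pow_zero]
  | succ n =>
    have hc : σ.IsCycle ∧ σ.support = Finset.univ := by
      have hne : ∀ x, σ x ≠ x := fun x => h.apply_ne Set.nontrivial_univ (Set.mem_univ x)
      refine ⟨Equiv.Perm.isCycle_iff_exists_isCycleOn.2 ⟨Set.univ, Set.nontrivial_univ, h,
        fun _ _ => Set.mem_univ _⟩, ?_⟩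
      ext x
      simp [hne x]
    rw [hc.1.sign, hc.2, Finset.card_univ, Fintype.card_fin, pow_succ (-1 : ℤˣ) (n + 1)]
    simp

theorem sign_braidPerm (γ : BraidWord n k) : Equiv.Perm.sign (braidPerm γ) = (-1) ^ k := by
  rw [braidPerm, Equiv.Perm.sign_prod_list_swap, List.length_ofFn]
  intro g hg
  obtain ⟨j, rfl⟩ := (List.mem_ofFn' _ _).1 hg
  exact ⟨_, _, castSucc_ne_succ _, rfl⟩

theorem even_writhe_sub (γ : BraidWord n k) : Even (writhe γ - k) := by
  have : writhe γ - k = ∑ j, (letterSign (γ j) - 1) := by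
    simp [writhe, Finset.sum_sub_distrib]
  rw [this]
  refine Finset.even_sum _ fun j _ => ?_
  rw [letterSign]
  split_ifs <;> decide

/-- A cycle through all n + 1 strands has sign (-1)^n, a product of k transpositions has sign
(-1)^k, and the writhe has the parity of k. -/
theorem two_dvd_writhe (γ : BraidWord n k) (hK : ClosureIsKnot γ) :
    (2 : ℤ) ∣ writhe γ - ((n + 1 : ℕ) : ℤ) + 1 := by
  have h1 := sign_of_isCycleOn_univ hK
  rw [sign_braidPerm] at h1
  have h2 : Even (k + n) := by
    rw [← neg_one_pow_eq_one_iff_even (R := ℤˣ) (by decide), pow_add, h1, ← mul_pow]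
    simp
  have h3 := even_writhe_sub γ
  have h4 : Even ((k : ℤ) + n) := by exact_mod_cast h2
  rw [← even_iff_two_dvd]
  have h5 := (h3.add h4).sub (even_two_mul (n : ℤ))
  have e : writhe γ - ((n + 1 : ℕ) : ℤ) + 1 = writhe γ - k + (k + n) - 2 * n := by
    push_cast
    ring
  rwa [e]

theorem coloredJones_part {γ : BraidWord n k} (hK : ClosureIsKnot γ) {N : ℕ} (hN : 0 < N) :
    inclRq
        (LaurentPolynomial.T (((N : ℤ) - 1) * ((writhe γ - ((n + 1 : ℕ) : ℤ) + 1) / 2)) *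
          ∑ᶠ i : ℕ, evalN N ((1 - qDetOneSub ((LaurentPolynomial.T 1 : Rq) • rho' γ)) ^ i)) =
        normalizedColoredJones γ N := by
  rw [map_mul, (finsum_evalN_pow hK hN).2, inclRq_trace_eq hN, normalizedColoredJones_eq hN,
    inclRq_T]
  congr 1
  obtain ⟨c, hc⟩ := two_dvd_writhe γ hK
  rw [hc, Int.mul_ediv_cancel_left _ two_ne_zero, ← zpow_natCast v 2, ← zpow_mul]
  congr 1
  push_cast at hc ⊢
  rw [show writhe γ - n = 2 * c by linarith]
  ring

end

/-! ### The Alexander polynomial: elementary ideals, the Burau matrix and Fox calculus. -/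

section

/-! ### The first elementary ideal of a matrix with a left and a right null vector -/

section ElementaryIdeal

variable {A : Type*} [CommRing A]

theorem exists_succAbove_perm {c : ℕ} {f : Fin c → Fin (c + 1)} (hf : Function.Injective f) :
    ∃ (i : Fin (c + 1)) (π : Equiv.Perm (Fin c)), ∀ x, f x = i.succAbove (π x) := by
  have hns : ¬ Function.Surjective f := fun h => by
    have := Fintype.card_le_of_surjective f h
    simp at this
  obtain ⟨i, hi⟩ := not_forall.1 hns
  have h : ∀ x, ∃ y, i.succAbove y = f x := fun x =>
    Fin.exists_succAbove_eq fun hx => hi ⟨x, hx⟩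
  choose π hπ using h
  have hinj : Function.Injective π := fun x y hxy => hf (by rw [← hπ, ← hπ, hxy])
  exact ⟨i, Equiv.ofBijective π (Finite.injective_iff_bijective.1 hinj), fun x => (hπ x).symm⟩

/-- After scaling by the units the rows sum to zero, and then omitting any one row gives the same
minor up to sign. An injective choice of rows is such an omission followed by a permutation. -/
theorem associated_det_of_injective {ρ : Type*} {c : ℕ} (e : ρ ≃ Fin (c + 1))
    (M : Matrix ρ (Fin c) A) (w : ρ → Aˣ) (hw : ∀ x, ∑ i, (w (e.symm i) : A) * M (e.symm i) x = 0)
    {f : Fin c → ρ} (hf : Function.Injective f) :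
    Associated (M.submatrix f id).det
      ((Matrix.of fun i x => (w (e.symm i) : A) * M (e.symm i) x).submatrix
        (Fin.succAbove (0 : Fin (c + 1))) id).det := by
  set M' : Matrix (Fin (c + 1)) (Fin c) A :=
    Matrix.of fun i x => (w (e.symm i) : A) * M (e.symm i) x with hM'
  obtain ⟨i, π, hπ⟩ := exists_succAbove_perm (e.injective.comp hf)
  have hv : ∑ j, M' j = 0 := by
    funext x
    exact (Finset.sum_apply x _ _).trans (hw x)
  have hf' : ∀ x, f x = e.symm (i.succAbove (π x)) := fun x => by rw [← hπ]; simp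
  have h1 : (M'.submatrix (fun x => i.succAbove (π x)) id).det =
      (∏ x, (w (f x) : A)) * (M.submatrix f id).det := by
    rw [← Matrix.det_mul_column]
    congr 1
    ext x y
    simp [hM', hf']
  have h2 : (M'.submatrix (fun x => i.succAbove (π x)) id).det =
      Equiv.Perm.sign π * (M'.submatrix i.succAbove id).det := by
    rw [← Matrix.det_permute]
    rfl
  have h3 := Matrix.submatrix_succAbove_det_eq_negOnePow_submatrix_succAbove_det M' hv i 0
  have hu : IsUnit (∏ x, (w (f x) : A)) := by
    rw [← Units.coe_prod]
    exact Units.isUnit _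
  have hs : IsUnit ((Equiv.Perm.sign π : ℤ) : A) :=
    (Units.isUnit (Equiv.Perm.sign π)).map (Int.castRingHom A)
  rw [h1] at h2
  have a1 : Associated ((∏ x, (w (f x) : A)) * (M.submatrix f id).det) (M.submatrix f id).det :=
    associated_unit_mul_left _ _ hu
  have a2 : Associated (((Equiv.Perm.sign π : ℤ) : A) * (M'.submatrix i.succAbove id).det)
      (M'.submatrix i.succAbove id).det := associated_unit_mul_left _ _ hs
  refine a1.symm.trans ?_
  rw [h2]
  refine a2.trans ?_
  rw [h3, Units.smul_def, zsmul_eq_mul]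
  exact associated_unit_mul_left _ _ ((Units.isUnit _).map (Int.castRingHom A))

/-- Divisibility, rather than association, also covers repeated rows, where the minor is zero. -/
theorem det_dvd_det {ρ : Type*} [Fintype ρ] {c : ℕ} (hc : Fintype.card ρ = c + 1)
    (M : Matrix ρ (Fin c) A) (w : ρ → Aˣ) (hw : ∀ x, ∑ r, (w r : A) * M r x = 0)
    {f : Fin c → ρ} (hf : Function.Injective f) (f' : Fin c → ρ) :
    (M.submatrix f id).det ∣ (M.submatrix f' id).det := by
  by_cases hf' : Function.Injective f'
  · have e := Fintype.equivFinOfCardEq hc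
    have hw' : ∀ x, ∑ i, (w (e.symm i) : A) * M (e.symm i) x = 0 := fun x => by
      rw [e.symm.sum_comp fun r => (w r : A) * M r x, hw]
    exact ((associated_det_of_injective e M w hw' hf).trans
      (associated_det_of_injective e M w hw' hf').symm).dvd
  · obtain ⟨x, y, hxy, hne⟩ : ∃ x y, f' x = f' y ∧ x ≠ y := by
      simpa [Function.Injective] using hf'
    have hz : (M.submatrix f' id).det = 0 := Matrix.det_zero_of_row_eq hne (by ext z; simp [hxy])
    rw [hz]
    exact dvd_zero _

/-- If the columns of a matrix sum to zero with unit coefficients, and the rows sum to zero, then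
its first elementary ideal is generated by any minor of corank one. -/
theorem elementaryIdeal_one_eq {ρ α ι : Type*} [Fintype ρ] [Fintype α] [Fintype ι] [DecidableEq ι]
    (M : Matrix ρ α A) (hcard : Fintype.card ρ = Fintype.card α) (hrow : ∀ r, ∑ x, M r x = 0)
    (w : ρ → Aˣ) (hcol : ∀ x, ∑ r, (w r : A) * M r x = 0) {f : ι → ρ} {g : ι → α}
    (hf : Function.Injective f) (hg : Function.Injective g)
    (hι : Fintype.card ι + 1 = Fintype.card α) :
    elementaryIdeal M 1 = Ideal.span {(M.submatrix f g).det} := by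
  have hc : Fintype.card α = Fintype.card α - 1 + 1 := by omega
  have e : Fin (Fintype.card α - 1) ≃ ι := (Fintype.equivFinOfCardEq (by omega)).symm
  have hdet : (M.submatrix f g).det = (M.submatrix (f ∘ e) (g ∘ e)).det := by
    rw [← Matrix.det_submatrix_equiv_self e, Matrix.submatrix_submatrix]
  apply le_antisymm
  · refine Ideal.span_le.2 ?_
    rintro _ ⟨f', g', rfl⟩
    rw [SetLike.mem_coe, Ideal.mem_span_singleton, hdet]
    -- The rows are exchanged at fixed columns by the unit relation, and then the columns by the
    -- same lemma applied to the transpose, where all the units are 1.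
    have h1 : (M.submatrix (f ∘ e) g').det ∣ (M.submatrix f' g').det :=
      det_dvd_det (hcard.trans hc) (M.submatrix id g') w (fun x => hcol (g' x))
        (hf.comp e.injective) f'
    have h2 : (M.submatrix (f ∘ e) (g ∘ e)).det ∣ (M.submatrix (f ∘ e) g').det := by
      rw [← Matrix.det_transpose, ← Matrix.det_transpose (M.submatrix (f ∘ e) g')]
      refine det_dvd_det hc (M.submatrix (f ∘ e) id).transpose 1 (fun x => ?_)
        (hg.comp e.injective) g'
      simpa using hrow (f (e x))
    exact h2.trans h1
  · rw [Ideal.span_singleton_le_iff_mem, hdet]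
    exact Ideal.subset_span ⟨_, _, rfl⟩

end ElementaryIdeal

/-! ### The evaluated Burau matrix -/

section Burau

variable {n k : ℕ}

/-- The `2 × 2` block of the Burau representation for a letter of the given sign. -/
def burauBlock (b : Bool) : Matrix (Fin 2) (Fin 2) ℤ[T;T⁻¹] :=
  if b then !![1 - LaurentPolynomial.T 1, 1; LaurentPolynomial.T 1, 0]
  else !![0, LaurentPolynomial.T (-1); 1, 1 - LaurentPolynomial.T (-1)]

/-- The Burau matrix of a letter. -/
def letterBurau (γ : BraidWord n k) (j : Fin k) :
    Matrix (Fin (n + 1)) (Fin (n + 1)) ℤ[T;T⁻¹] :=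
  blockSum (γ j).1 (burauBlock (γ j).2)

/-- The Burau matrix of a list of letters. -/
def burauList (γ : BraidWord n k) (l : List (Fin k)) :
    Matrix (Fin (n + 1)) (Fin (n + 1)) ℤ[T;T⁻¹] :=
  (l.map (letterBurau γ)).prod

theorem evalZ_one : evalZ (1 : Op k) = 1 := by
  rw [evalZ, Module.End.one_apply, map_one]

theorem evalZ_zero : evalZ (0 : Op k) = 0 := by
  rw [evalZ, LinearMap.zero_apply, map_zero]

theorem evalZ_sub (P Q : Op k) : evalZ (P - Q) = evalZ P - evalZ Q := by
  rw [evalZ, LinearMap.sub_apply, map_sub]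
  rfl

theorem evalZ_sum {ι : Type*} (s : Finset ι) (P : ι → Op k) :
    evalZ (∑ i ∈ s, P i) = ∑ i ∈ s, evalZ (P i) := by
  rw [evalZ, LinearMap.sum_apply, map_sum]
  rfl

theorem units_zpow_eq_T {R : Type*} [CommRing R] {u : R[T;T⁻¹]ˣ}
    (hu : (u : R[T;T⁻¹]) = LaurentPolynomial.T 1) (e : ℤ) :
    ((u ^ e : R[T;T⁻¹]ˣ) : R[T;T⁻¹]) = LaurentPolynomial.T e := by
  have hpow : ∀ m : ℕ, ((u ^ m : R[T;T⁻¹]ˣ) : R[T;T⁻¹]) = LaurentPolynomial.T m := fun m => by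
    rw [Units.val_pow_eq_pow_val, hu, LaurentPolynomial.T_pow, mul_one]
  obtain ⟨m, rfl | rfl⟩ := e.eq_nat_or_neg
  · rw [zpow_natCast, hpow]
  · rw [zpow_neg, zpow_natCast, Units.inv_eq_of_mul_eq_one_right]
    rw [hpow, ← LaurentPolynomial.T_add, add_neg_cancel, LaurentPolynomial.T_zero]

theorem inclZ_T (e : ℤ) : inclZ (LaurentPolynomial.T e) = LaurentPolynomial.T e := by
  rw [inclZ, LaurentPolynomial.eval₂_T]
  exact units_zpow_eq_T rfl e

theorem substZ_single (α : Fin k × Var → ℤ) (c : Rq) :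
    substZ k (AddMonoidAlgebra.single α c) =
      c • LaurentPolynomial.T (∑ j, (α (j, Var.x) + α (j, Var.y))) := by
  rw [substZ, AddMonoidAlgebra.lift_single]
  rfl

/-- All shifts fix the constant 1, so q disappears and only the multiplication parts of the
operators remain. -/
theorem evalZ_sBlock (b : Bool) (j : Fin k) (x y : Fin 2) :
    evalZ (sBlock b j x y) = inclZ (burauBlock b x y) := by
  have h1 : (1 : LaurentPoly k) = AddMonoidAlgebra.single 0 1 := rfl
  have hs : ∀ (w : Var) (e : ℤ), ∑ x, (Pi.single (j, w) e : Fin k × Var → ℤ) (x, w) = e := by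
    intro w e
    simp [Pi.single_apply]
  cases b <;> fin_cases x <;> fin_cases y <;>
    simp [sBlock, burauBlock, evalZ, inclZ_T, h1, aPlus_single, bPlus_single,
      cPlus_single, aMinus_single, cMinus_single, substZ_single, bMinus, mulVar_single, hs]

theorem evalZ_letterMatrix (γ : BraidWord n k) (j : Fin k) (x y : Fin (n + 1)) :
    evalZ (letterMatrix γ j x y) = inclZ (letterBurau γ j x y) := by
  simp only [letterMatrix, letterBurau, blockSum, Matrix.of_apply]
  split_ifs <;> simp only [evalZ_sBlock, evalZ_zero, evalZ_one, map_zero, map_one]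

/-- Distinct letters make the evaluation multiplicative, so the deformed matrix becomes the ordinary
Burau matrix over ℤ[z^±1]. -/
theorem evalZ_rhoList (γ : BraidWord n k) {l : List (Fin k)} (hl : l.Nodup) (x y : Fin (n + 1)) :
    evalZ (rhoList γ l x y) = inclZ (burauList γ l x y) := by
  induction l generalizing x y with
  | nil =>
    rw [rhoList, burauList, List.map_nil, List.map_nil, List.prod_nil, List.prod_nil,
      Matrix.one_apply, Matrix.one_apply]
    split_ifs
    · rw [evalZ_one, map_one]
    · rw [evalZ_zero, map_zero]
  | cons j l ih =>
    rw [rhoList_cons, burauList, List.map_cons, List.prod_cons, Matrix.mul_apply, Matrix.mul_apply,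
      evalZ_sum, map_sum]
    refine Finset.sum_congr rfl fun r _ => ?_
    rw [evalZ_mul (disjoint_letter hl) (letterMatrix_mem γ j x r) (rhoList_mem γ l r y), map_mul,
      evalZ_letterMatrix, ih (List.nodup_cons.1 hl).2, burauList]

theorem det_map_evalZ (γ : BraidWord n k) : ((1 - rho' γ).map evalZ).det =
    inclZ (1 - (burauList γ (List.finRange k)).submatrix Fin.succ Fin.succ).det := by
  rw [RingHom.map_det]
  congr 1
  ext x y
  rw [Matrix.map_apply, Matrix.sub_apply, evalZ_sub, rho', Matrix.submatrix_apply, rho_eq_rhoList,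
    evalZ_rhoList γ (List.nodup_finRange k), RingHom.mapMatrix_apply, Matrix.map_apply,
    Matrix.sub_apply, Matrix.submatrix_apply, map_sub]
  congr 1
  rw [Matrix.one_apply, Matrix.one_apply]
  split_ifs
  · rw [evalZ_one, map_one]
  · rw [evalZ_zero, map_zero]

end Burau

end

section

/-! ### The Alexander matrix -/

section Alexander

variable {n k : ℕ}

theorem alexanderMatrix_inr (γ : BraidWord n k) (p : Fin (n + 1)) (a : Segment n k) :
    alexanderMatrix γ (.inr p) a =
      (if (Fin.last k, p) = a then 1 else 0) - if ((0 : Fin (k + 1)), p) = a then 1 else 0 := by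
  change foxDeriv a [((Fin.last k, p), true), ((0, p), false)] = _
  simp only [foxDeriv, zero_sub, mul_neg, ← mul_assoc, ← LaurentPolynomial.T_add]
  simp [sub_eq_add_neg]

theorem blockSum_apply_eq_zero_of_ne {A : Type*} [Ring A] (i : Fin n)
    (S : Matrix (Fin 2) (Fin 2) A) {c : Fin (n + 1)} (h : c ≠ i.castSucc) (h' : c ≠ i.succ)
    (p : Fin (n + 1)) : blockSum i S p c = if p = c then 1 else 0 := by
  by_cases h1 : p = i.castSucc
  · rw [h1, blockSum_castSucc_of_ne i S h h', if_neg h.symm]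
  · by_cases h2 : p = i.succ
    · rw [h2, blockSum_succ_of_ne i S h h', if_neg h'.symm]
    · exact blockSum_of_ne i S h1 h2 c

theorem sum_mul_blockSum_castSucc {A : Type*} [Ring A] (i : Fin n) (S : Matrix (Fin 2) (Fin 2) A)
    (v : Fin (n + 1) → A) : ∑ p, v p * blockSum i S p i.castSucc =
      v i.castSucc * S 0 0 + v i.succ * S 1 0 := by
  have hne : i.castSucc ≠ i.succ := (Fin.castSucc_lt_succ (i := i)).ne
  rw [Fintype.sum_eq_add _ _ hne, blockSum_castSucc_castSucc, blockSum_succ_castSucc]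
  rintro p ⟨h1, h2⟩
  rw [blockSum_of_ne i S h1 h2, if_neg h1, mul_zero]

theorem sum_mul_blockSum_succ {A : Type*} [Ring A] (i : Fin n) (S : Matrix (Fin 2) (Fin 2) A)
    (v : Fin (n + 1) → A) : ∑ p, v p * blockSum i S p i.succ =
      v i.castSucc * S 0 1 + v i.succ * S 1 1 := by
  have hne : i.castSucc ≠ i.succ := (Fin.castSucc_lt_succ (i := i)).ne
  rw [Fintype.sum_eq_add _ _ hne, blockSum_castSucc_succ, blockSum_succ_succ]
  rintro p ⟨h1, h2⟩
  rw [blockSum_of_ne i S h1 h2, if_neg h2, mul_zero]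

theorem sum_mul_blockSum_of_ne {A : Type*} [Ring A] (i : Fin n) (S : Matrix (Fin 2) (Fin 2) A)
    (v : Fin (n + 1) → A) {c : Fin (n + 1)} (h : c ≠ i.castSucc) (h' : c ≠ i.succ) :
    ∑ p, v p * blockSum i S p c = v c := by
  simp [blockSum_apply_eq_zero_of_ne i S h h']

/-- The Fox derivative of a crossing relator, as a combination of incoming segments. -/
theorem foxDeriv_crossingRelator (γ : BraidWord n k) (j : Fin k) (p : Fin (n + 1))
    (a : Segment n k) : foxDeriv a (crossingRelator γ j p) =
      (∑ r, (if (j.castSucc, r) = a then 1 else 0) * letterBurau γ j r p) -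
        if (j.succ, p) = a then 1 else 0 := by
  have hT : LaurentPolynomial.T 1 * LaurentPolynomial.T (-1) = (1 : ℤ[T;T⁻¹]) := by
    rw [← LaurentPolynomial.T_add, add_neg_cancel, LaurentPolynomial.T_zero]
  have hne : (γ j).1.succ ≠ (γ j).1.castSucc := (Fin.castSucc_lt_succ (i := (γ j).1)).ne'
  rw [letterBurau]
  by_cases h1 : p = (γ j).1.castSucc
  · subst h1
    rw [sum_mul_blockSum_castSucc, crossingRelator, if_pos rfl]
    cases (γ j).2
    · simp only [foxDeriv, burauBlock, Bool.false_eq_true, if_false, Matrix.of_apply,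
        Matrix.cons_val', Matrix.cons_val_zero, Matrix.cons_val_one, Matrix.cons_val_fin_one]
      linear_combination (-(if (j.succ, (γ j).1.castSucc) = a then 1 else 0)) * hT
    · simp only [foxDeriv, burauBlock, if_true, Matrix.of_apply,
        Matrix.cons_val', Matrix.cons_val_zero, Matrix.cons_val_one, Matrix.cons_val_fin_one]
      linear_combination (-(if (j.succ, (γ j).1.castSucc) = a then 1 else 0) *
        (1 + LaurentPolynomial.T 1 * LaurentPolynomial.T (-1)) -
        LaurentPolynomial.T 1 * (if (j.castSucc, (γ j).1.castSucc) = a then 1 else 0)) * hT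
  · by_cases h2 : p = (γ j).1.succ
    · subst h2
      rw [sum_mul_blockSum_succ, crossingRelator, if_neg hne, if_pos rfl]
      cases (γ j).2
      · simp only [foxDeriv, burauBlock, Bool.false_eq_true, if_false, Matrix.of_apply,
          Matrix.cons_val', Matrix.cons_val_zero, Matrix.cons_val_one, Matrix.cons_val_fin_one]
        linear_combination (-(if (j.succ, (γ j).1.succ) = a then 1 else 0) *
          (1 + LaurentPolynomial.T 1 * LaurentPolynomial.T (-1)) +
          (if (j.castSucc, (γ j).1.succ) = a then 1 else 0)) * hT
      · simp only [foxDeriv, burauBlock, if_true, Matrix.of_apply,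
          Matrix.cons_val', Matrix.cons_val_zero, Matrix.cons_val_one, Matrix.cons_val_fin_one]
        linear_combination (-(if (j.succ, (γ j).1.succ) = a then 1 else 0)) * hT
    · rw [sum_mul_blockSum_of_ne _ _ _ h1 h2, crossingRelator, if_neg h1, if_neg h2]
      simp only [foxDeriv]
      linear_combination (-(if (j.succ, p) = a then 1 else 0)) * hT

theorem alexanderMatrix_inl (γ : BraidWord n k) (j : Fin k) (p : Fin (n + 1)) (a : Segment n k) :
    alexanderMatrix γ (.inl (j, p)) a =
      (∑ r, (if (j.castSucc, r) = a then 1 else 0) * letterBurau γ j r p) -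
        if (j.succ, p) = a then 1 else 0 :=
  foxDeriv_crossingRelator γ j p a

theorem alexanderMatrix_inl_mul (γ : BraidWord n k) (j : Fin k) (p : Fin (n + 1))
    (v : Segment n k → ℤ[T;T⁻¹]) : ∑ a, alexanderMatrix γ (.inl (j, p)) a * v a =
      ∑ r, v (j.castSucc, r) * letterBurau γ j r p - v (j.succ, p) := by
  simp only [alexanderMatrix_inl, sub_mul, Finset.sum_sub_distrib, Finset.sum_mul]
  rw [Finset.sum_comm]
  simp [mul_comm]

theorem alexanderMatrix_inr_mul (γ : BraidWord n k) (p : Fin (n + 1))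
    (v : Segment n k → ℤ[T;T⁻¹]) : ∑ a, alexanderMatrix γ (.inr p) a * v a =
      v (Fin.last k, p) - v (0, p) := by
  simp [alexanderMatrix_inr, sub_mul, Finset.sum_sub_distrib]

/-- This makes the free derivatives of each crossing relator sum to zero, as they must when every
generator is sent to t. -/
theorem sum_letterBurau (γ : BraidWord n k) (j : Fin k) (p : Fin (n + 1)) :
    ∑ r, letterBurau γ j r p = 1 := by
  have h : ∑ r, (1 : ℤ[T;T⁻¹]) * letterBurau γ j r p = 1 := by
    rw [letterBurau]
    by_cases h1 : p = (γ j).1.castSucc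
    · subst h1
      rw [sum_mul_blockSum_castSucc]
      cases (γ j).2 <;> simp [burauBlock]
    · by_cases h2 : p = (γ j).1.succ
      · subst h2
        rw [sum_mul_blockSum_succ]
        cases (γ j).2 <;> simp [burauBlock]
      · rw [sum_mul_blockSum_of_ne _ _ _ h1 h2]
  simpa using h

theorem sum_alexanderMatrix (γ : BraidWord n k) (r : (Fin k × Fin (n + 1)) ⊕ Fin (n + 1)) :
    ∑ a, alexanderMatrix γ r a = 0 := by
  obtain ⟨j, p⟩ | p := r
  · have h := alexanderMatrix_inl_mul γ j p fun _ => 1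
    simp only [mul_one, one_mul, sum_letterBurau, sub_self] at h
    exact h
  · have h := alexanderMatrix_inr_mul γ p fun _ => 1
    simp only [mul_one, sub_self] at h
    exact h

/-- The vector (t^p) is fixed by every Burau matrix. It supplies the coefficients of the relation
that makes one Wirtinger relator redundant. -/
theorem letterBurau_mul_T (γ : BraidWord n k) (j : Fin k) (r : Fin (n + 1)) :
    ∑ p : Fin (n + 1), letterBurau γ j r p * LaurentPolynomial.T ((p : ℕ) : ℤ) =
      LaurentPolynomial.T ((r : ℕ) : ℤ) := by
  have hne : (γ j).1.castSucc ≠ (γ j).1.succ := (Fin.castSucc_lt_succ (i := (γ j).1)).ne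
  have hT : ∀ e : ℤ, LaurentPolynomial.T (e + 1) =
      (LaurentPolynomial.T e * LaurentPolynomial.T 1 : ℤ[T;T⁻¹]) := fun e =>
    LaurentPolynomial.T_add e 1
  have hT' : LaurentPolynomial.T 1 * LaurentPolynomial.T (-1) = (1 : ℤ[T;T⁻¹]) := by
    rw [← LaurentPolynomial.T_add, add_neg_cancel, LaurentPolynomial.T_zero]
  rw [letterBurau]
  by_cases h1 : r = (γ j).1.castSucc
  · subst h1
    rw [Fintype.sum_eq_add _ _ hne, blockSum_castSucc_castSucc, blockSum_castSucc_succ,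
      Fin.val_succ, Fin.val_castSucc, Nat.cast_add, Nat.cast_one, hT]
    · cases (γ j).2
      · simp only [burauBlock, Bool.false_eq_true, if_false, Matrix.of_apply,
          Matrix.cons_val', Matrix.cons_val_zero, Matrix.cons_val_one, Matrix.cons_val_fin_one]
        linear_combination LaurentPolynomial.T (((γ j).1 : ℕ) : ℤ) * hT'
      · simp only [burauBlock, if_true, Matrix.of_apply,
          Matrix.cons_val', Matrix.cons_val_zero, Matrix.cons_val_one, Matrix.cons_val_fin_one]
        ring
    · rintro p ⟨hp, hp'⟩
      rw [blockSum_castSucc_of_ne _ _ hp hp', zero_mul]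
  · by_cases h2 : r = (γ j).1.succ
    · subst h2
      rw [Fintype.sum_eq_add _ _ hne, blockSum_succ_castSucc, blockSum_succ_succ,
        Fin.val_succ, Fin.val_castSucc, Nat.cast_add, Nat.cast_one, hT]
      · cases (γ j).2
        · simp only [burauBlock, Bool.false_eq_true, if_false, Matrix.of_apply,
            Matrix.cons_val', Matrix.cons_val_zero, Matrix.cons_val_one, Matrix.cons_val_fin_one]
          linear_combination -LaurentPolynomial.T (((γ j).1 : ℕ) : ℤ) * hT'
        · simp only [burauBlock, if_true, Matrix.of_apply,
            Matrix.cons_val', Matrix.cons_val_zero, Matrix.cons_val_one, Matrix.cons_val_fin_one]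
          ring
      · rintro p ⟨hp, hp'⟩
        rw [blockSum_succ_of_ne _ _ hp hp', zero_mul]
    · simp [blockSum_of_ne _ _ h1 h2]

/-- The unit `t ^ e`. -/
def unitT (e : ℤ) : ℤ[T;T⁻¹]ˣ where
  val := LaurentPolynomial.T e
  inv := LaurentPolynomial.T (-e)
  val_inv := by rw [← LaurentPolynomial.T_add, add_neg_cancel, LaurentPolynomial.T_zero]
  inv_val := by rw [← LaurentPolynomial.T_add, neg_add_cancel, LaurentPolynomial.T_zero]

/-- The weights in the linear relation between the rows of the Alexander matrix. -/
def relatorWeight : (Fin k × Fin (n + 1)) ⊕ Fin (n + 1) → ℤ[T;T⁻¹]ˣ :=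
  Sum.elim (fun x => unitT (x.2 : ℕ)) fun p => unitT (p : ℕ)

/-- In the column of a segment at position s, each letter contributes t^s at the level before it and
-t^s at the level after it. This telescopes, and the closing relators cancel the two ends. -/
theorem sum_relatorWeight_mul (γ : BraidWord n k) (a : Segment n k) :
    ∑ r, (relatorWeight r : ℤ[T;T⁻¹]) * alexanderMatrix γ r a = 0 := by
  obtain ⟨i, s⟩ := a
  set t : ℤ[T;T⁻¹] := LaurentPolynomial.T ((s : ℕ) : ℤ) with ht
  have hl : ∀ j : Fin k, ∑ p, (relatorWeight (.inl (j, p)) : ℤ[T;T⁻¹]) *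
      alexanderMatrix γ (.inl (j, p)) (i, s) =
        (if j.castSucc = i then t else 0) - if j.succ = i then t else 0 := fun j => by
    simp only [relatorWeight, Sum.elim_inl, unitT, alexanderMatrix_inl, mul_sub,
      Finset.sum_sub_distrib, Prod.mk.injEq]
    congr 1
    · by_cases h : j.castSucc = i
      · simp only [h, true_and, if_true, ite_mul, one_mul, zero_mul, Finset.sum_ite_eq',
          Finset.mem_univ]
        rw [ht, ← letterBurau_mul_T γ j s]
        exact Finset.sum_congr rfl fun p _ => mul_comm _ _
      · simp [h]
    · by_cases h : j.succ = i <;> simp [h, ht]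
  have hr : ∑ p, (relatorWeight (k := k) (.inr p) : ℤ[T;T⁻¹]) * alexanderMatrix γ (.inr p) (i, s) =
      (if Fin.last k = i then t else 0) - if 0 = i then t else 0 := by
    simp only [relatorWeight, Sum.elim_inr, unitT, alexanderMatrix_inr, mul_sub,
      Finset.sum_sub_distrib, Prod.mk.injEq]
    congr 1
    · by_cases h : Fin.last k = i <;> simp [h, ht]
    · by_cases h : 0 = i <;> simp [h, ht]
  rw [Fintype.sum_sum_type, Fintype.sum_prod_type, hr, Finset.sum_congr rfl fun j _ => hl j,
    Finset.sum_sub_distrib]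
  have h1 := Fin.sum_univ_castSucc fun x : Fin (k + 1) => if x = i then t else 0
  have h2 := Fin.sum_univ_succ fun x : Fin (k + 1) => if x = i then t else 0
  linear_combination h2 - h1

/-- The Burau matrix of the letters before `j`, transposed. -/
def burauBefore (γ : BraidWord n k) (j : ℕ) : Matrix (Fin (n + 1)) (Fin (n + 1)) ℤ[T;T⁻¹] :=
  (burauList γ ((List.finRange k).take j)).transpose

theorem burauBefore_succ (γ : BraidWord n k) (j : Fin k) (p c : Fin (n + 1)) :
    burauBefore γ (j + 1) p c = ∑ r, burauBefore γ j r c * letterBurau γ j r p := by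
  rw [burauBefore, List.take_add_one, List.getElem?_eq_getElem (by simp), burauList,
    List.map_append, List.prod_append, Matrix.transpose_apply, Matrix.mul_apply]
  simp [burauBefore, burauList]

theorem burauBefore_zero (γ : BraidWord n k) : burauBefore γ 0 = 1 := by
  simp [burauBefore, burauList]

theorem burauBefore_last (γ : BraidWord n k) :
    burauBefore γ k = (burauList γ (List.finRange k)).transpose := by
  rw [burauBefore, List.take_of_length_le (by simp)]

/-- The second factor expresses each segment through the initial ones; on the initial level it is
the identity, which leaves the single extra term. -/
theorem sum_alexanderMatrix_mul_burauBefore (γ : BraidWord n k)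
    (r : (Fin k × Fin (n + 1)) ⊕ Fin (n + 1)) (c : Fin (n + 1)) :
    ∑ x : Fin k × Fin (n + 1), alexanderMatrix γ r (x.1.succ, x.2) * burauBefore γ (x.1 + 1) x.2 c +
      alexanderMatrix γ r (0, c) =
        ∑ a : Segment n k, alexanderMatrix γ r a * burauBefore γ a.1 a.2 c := by
  rw [Fintype.sum_prod_type, Fintype.sum_prod_type, Fin.sum_univ_succ, add_comm]
  congr 1
  simp [burauBefore_zero, Matrix.one_apply]

/-- The block is L - 1, where L links a letter only to the segments produced by the letter just
before it. Hence L is nilpotent, and L - 1 is invertible. -/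
theorem isUnit_det_alexanderMatrix_block (γ : BraidWord n k) :
    IsUnit ((alexanderMatrix γ).submatrix (Sum.inl : Fin k × Fin (n + 1) → _)
      fun x : Fin k × Fin (n + 1) => (x.1.succ, x.2)).det := by
  set L : Matrix (Fin k × Fin (n + 1)) (Fin k × Fin (n + 1)) ℤ[T;T⁻¹] :=
    Matrix.of fun x y => ∑ r, (if (x.1.castSucc, r) = (y.1.succ, y.2) then 1 else 0) *
      letterBurau γ x.1 r x.2 with hL
  have hpow : ∀ (s : ℕ) (x y : Fin k × Fin (n + 1)), (x.1 : ℕ) < y.1 + s → (L ^ s) x y = 0 := by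
    intro s
    induction s with
    | zero =>
      intro x y h
      rw [pow_zero, Matrix.one_apply_ne]
      rintro rfl
      omega
    | succ s ih =>
      intro x y h
      rw [pow_succ', Matrix.mul_apply]
      refine Finset.sum_eq_zero fun z _ => ?_
      by_cases hz : (x.1 : ℕ) = z.1 + 1
      · rw [ih z y (by omega), mul_zero]
      · have : L x z = 0 := by
          rw [hL, Matrix.of_apply]
          refine Finset.sum_eq_zero fun r _ => ?_
          rw [if_neg, zero_mul]
          intro he
          exact hz (by simpa using congrArg (fun e => (e.1 : ℕ)) he)
        rw [this, zero_mul]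
  have hnil : IsNilpotent L := ⟨k, by
    ext x y
    rw [hpow k x y (by omega), Matrix.zero_apply]⟩
  have heq : (alexanderMatrix γ).submatrix (Sum.inl : Fin k × Fin (n + 1) → _)
      (fun x : Fin k × Fin (n + 1) => (x.1.succ, x.2)) = L - 1 := by
    ext x y
    rw [Matrix.submatrix_apply, alexanderMatrix_inl, Matrix.sub_apply, hL, Matrix.of_apply,
      Matrix.one_apply]
    congr 1
    simp only [Prod.ext_iff, Fin.succ_inj]
  rw [heq]
  exact (Matrix.isUnit_iff_isUnit_det _).1 hnil.isUnit_sub_one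

/-- The rows of the chosen minor of the Alexander matrix. -/
def minorRow : (Fin k × Fin (n + 1)) ⊕ Fin n → (Fin k × Fin (n + 1)) ⊕ Fin (n + 1) :=
  Sum.map id Fin.succ

/-- The columns of the chosen minor of the Alexander matrix. -/
def minorCol : (Fin k × Fin (n + 1)) ⊕ Fin n → Segment n k :=
  Sum.elim (fun x => (x.1.succ, x.2)) fun p => (0, p.succ)

theorem minorCol_injective : Function.Injective (minorCol (n := n) (k := k)) := by
  rintro (⟨i, p⟩ | p) (⟨j, r⟩ | r) h
  · simpa [minorCol] using h
  · exact absurd (congrArg Prod.fst h) (Fin.succ_ne_zero i)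
  · exact absurd (congrArg Prod.fst h).symm (Fin.succ_ne_zero j)
  · simpa [minorCol] using h

/-- The minor omits the closing relator and the initial segment of strand 0, to match the deletion
in ρ'. A unipotent column operation replaces each remaining initial column by its propagation
through the braid: the crossing relators then vanish on it, and the closing relators give last level
minus first level, that is Bᵀ - 1. -/
theorem associated_det_minor (γ : BraidWord n k) :
    Associated ((alexanderMatrix γ).submatrix minorRow minorCol).det
      (1 - (burauList γ (List.finRange k)).submatrix Fin.succ Fin.succ).det := by
  set Y := (alexanderMatrix γ).submatrix (minorRow (n := n) (k := k)) minorCol with hY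
  set P := (alexanderMatrix γ).submatrix (Sum.inl : Fin k × Fin (n + 1) → _)
    fun x : Fin k × Fin (n + 1) => (x.1.succ, x.2) with hP
  set B := (burauList γ (List.finRange k)).submatrix Fin.succ Fin.succ with hB
  let X : Matrix (Fin k × Fin (n + 1)) (Fin n) ℤ[T;T⁻¹] :=
    Matrix.of fun x c => burauBefore γ (x.1 + 1) x.2 c.succ
  have hmul : Y * Matrix.fromBlocks 1 X 0 1 =
      Matrix.fromBlocks P 0 Y.toBlocks₂₁ (B.transpose - 1) := by
    conv_lhs => rw [← Matrix.fromBlocks_toBlocks Y]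
    rw [Matrix.fromBlocks_multiply]
    simp only [Matrix.mul_one, Matrix.mul_zero, add_zero]
    congr 1
    · refine Matrix.ext fun ⟨j, p⟩ c => ?_
      refine (sum_alexanderMatrix_mul_burauBefore γ (.inl (j, p)) c.succ).trans ?_
      rw [alexanderMatrix_inl_mul, Fin.val_succ, burauBefore_succ]
      exact sub_self _
    · refine Matrix.ext fun p c => ?_
      refine (sum_alexanderMatrix_mul_burauBefore γ (.inr p.succ) c.succ).trans ?_
      rw [alexanderMatrix_inr_mul, Fin.val_last, Fin.val_zero, burauBefore_last, burauBefore_zero,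
        Matrix.sub_apply, Matrix.transpose_apply, Matrix.transpose_apply, hB,
        Matrix.submatrix_apply, Matrix.one_apply, Matrix.one_apply]
      simp only [Fin.succ_inj]
  have hdet := congrArg Matrix.det hmul
  rw [Matrix.det_mul, Matrix.det_fromBlocks_zero₂₁, Matrix.det_fromBlocks_zero₁₂, Matrix.det_one,
    Matrix.det_one, mul_one, mul_one] at hdet
  have hneg : (B.transpose - 1).det = (-1) ^ Fintype.card (Fin n) * (1 - B).det := by
    rw [← Matrix.det_neg, ← Matrix.det_transpose, Matrix.transpose_sub, Matrix.transpose_transpose,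
      Matrix.transpose_one, neg_sub]
  rw [hdet, hneg, ← mul_assoc]
  exact associated_unit_mul_left _ _
    ((isUnit_det_alexanderMatrix_block γ).mul (isUnit_one.neg.pow _))

theorem isAlexanderPolynomial_burau (γ : BraidWord n k) : IsAlexanderPolynomial γ
    (1 - (burauList γ (List.finRange k)).submatrix Fin.succ Fin.succ).det := by
  rw [IsAlexanderPolynomial, elementaryIdeal_one_eq (alexanderMatrix γ) (by simp; ring)
    (sum_alexanderMatrix γ) relatorWeight (sum_relatorWeight_mul γ)
    (Function.injective_id.sumMap (Fin.succ_injective n)) minorCol_injective (by simp; ring)]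
  exact Ideal.span_singleton_eq_span_singleton.2 (associated_det_minor γ)

end Alexander

end

end ColoredJones

end

theorem theorem1 (n k : ℕ) (γ : BraidWord n k) (hK : ClosureIsKnot γ) :
    (2 : ℤ) ∣ writhe γ - ((n + 1 : ℕ) : ℤ) + 1 ∧
    (∀ N : ℕ, 0 < N →
      {i : ℕ | evalN N ((1 - qDetOneSub ((LaurentPolynomial.T 1 : Rq) • rho' γ)) ^ i) ≠ 0}.Finite ∧
      inclRq
        (LaurentPolynomial.T (((N : ℤ) - 1) * ((writhe γ - ((n + 1 : ℕ) : ℤ) + 1) / 2)) *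
          ∑ᶠ i : ℕ, evalN N ((1 - qDetOneSub ((LaurentPolynomial.T 1 : Rq) • rho' γ)) ^ i)) =
        normalizedColoredJones γ N) ∧
    ∃ Δ : ℤ[T;T⁻¹], IsAlexanderPolynomial γ Δ ∧
      ((1 - rho' γ).map evalZ).det = inclZ Δ := by
  exact ⟨two_dvd_writhe γ hK, fun N hN => ⟨(finsum_evalN_pow hK hN).1, coloredJones_part hK hN⟩,
    _, isAlexanderPolynomial_burau γ, det_map_evalZ γ⟩
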